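/- The following is a theorem of ZF (no form of the axiom of choice is used); equivalently, it holds in every model of ZF. Conventions. A set is finite if it is in bijection with a natural number. A metric space is $\sigma$-complete if every decreasing sequence $(A_n)$ of nonempty closed subsets with $\operatorname{diam}(A_n)\to 0$ has nonempty intersection. A Hilbert space is a complex inner product space that is $\sigma$-complete for its norm; it is finite-dimensional if it is spanned by a finite set of vectors. For a set $X$, $\ell^2(X)$ is the space of functions $\eta:X\to\mathbb C$ with $\sum_{x\in X}|\eta(x)|^2<\infty$ (the supremum of the sums over finite subsets), with pointwise operations and inner product $\langle\eta,\zeta\rangle=\sum_{x\in X}\eta(x)\overline{\zeta(x)}$ (the limit of the net of sums over finite subsets of $X$); it is a Hilbert space. A set $Y$ is Dedekind-finite if every injective function $Y\to Y$ is surjective. A set $X$ is CF if $X$ is infinite and the set $\mathrm{Fin}(X)$ of all finite subsets of $X$ is Dedekind-finite. A Hilbert space $\mathcal H$ is Hilbert Dedekind-infinite if it is isometrically isomorphic to a proper linear subspace of itself, and Hilbert dually Dedekind-infinite if there is a bounded linear operator $T:\mathcal H\to\mathcal H$ that is surjective but not injective. $\mathcal H$ is HDF (respectively HDDF) if it is infinite-dimensional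 and not Hilbert Dedekind-infinite (respectively infinite-dimensional and not Hilbert dually Dedekind-infinite). (1) For every Hilbert space $\mathcal H$ the following are equivalent: (i) $\mathcal H$ contains an infinite orthonormal sequence $(e_n)_{n\in\mathbb N}$; (ii) $\mathcal H$ is Hilbert Dedekind-infinite; (iii) $\mathcal H$ is Hilbert dually Dedekind-infinite. (2) For every infinite set $X$ the following are equivalent: (i) $X$ is CF; (ii) $\ell^2(X)$ is HDF; (iii) $\ell^2(X)$ is HDDF. -/

import Mathlib

/-! Hilbert spaces inside an arbitrary model of ZF (no form of the axiom of choice). -/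

universe u v w

namespace ZFModel

/-! ### Models of ZF -/

/-- The only non-logical symbol of the language of set theory: a binary relation symbol. -/
inductive MemRel : ℕ → Type
  | mem : MemRel 2

/-- The first-order language of set theory. -/
def setLanguage : FirstOrder.Language := ⟨fun _ => Empty, MemRel⟩

/-- A type with a membership relation on itself, as a structure for the language of set theory. -/
instance setStructure (M : Type u) [Membership M M] : setLanguage.Structure M where
  funMap := fun f => nomatch f
  RelMap := fun r => match r with
    | .mem => fun x => x 0 ∈ x 1

/-- `e` is the empty set. -/
def IsEmptySet {M : Type u} [Membership M M] (e : M) : Prop := ∀ z, z ∉ e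

/-- `b = a ∪ {x}`. -/
def IsInsert {M : Type u} [Membership M M] (x a b : M) : Prop := ∀ z, z ∈ b ↔ z ∈ a ∨ z = x

/-- Inductive sets: they contain `∅` and are closed under `x ↦ x ∪ {x}`. -/
def IsInductive {M : Type u} [Membership M M] (I : M) : Prop :=
  (∃ e, e ∈ I ∧ IsEmptySet e) ∧ ∀ x, x ∈ I → ∃ y, y ∈ I ∧ IsInsert x x y

/-- `M` with its relation `∈` is a model of ZF. Separation and Replacement are the first-order
schemes: they are required exactly for the classes that are definable with parameters in `M`. -/
class ZF (M : Type u) [Membership M M] : Prop where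
  extensionality : ∀ a b : M, (∀ z, z ∈ a ↔ z ∈ b) → a = b
  foundation : ∀ a : M, (∃ x, x ∈ a) → ∃ x, x ∈ a ∧ ∀ y, y ∈ x → y ∉ a
  pairing : ∀ a b : M, ∃ c : M, ∀ z, z ∈ c ↔ z = a ∨ z = b
  union : ∀ a : M, ∃ b : M, ∀ z, z ∈ b ↔ ∃ y, y ∈ a ∧ z ∈ y
  powerset : ∀ a : M, ∃ b : M, ∀ z, z ∈ b ↔ ∀ y, y ∈ z → y ∈ a
  infinity : ∃ I : M, IsInductive I
  separation : ∀ p : Set M, (Set.univ : Set M).Definable₁ setLanguage p →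
    ∀ a : M, ∃ b : M, ∀ x, x ∈ b ↔ x ∈ a ∧ x ∈ p
  replacement : ∀ r : Set (M × M), (Set.univ : Set M).Definable₂ setLanguage r →
    ∀ a : M, (∀ x, x ∈ a → ∃! y, (x, y) ∈ r) → ∃ b : M, ∀ y, y ∈ b ↔ ∃ x, x ∈ a ∧ (x, y) ∈ r

/-! ### Sets, relations and functions of the model

A set `a` of the model gives the Lean type `El a` of its elements. A subset of such a type, a
relation or a function between such types *belongs to the model* if it is given by a set of the
model. All quantifiers over subsets, relations, functions and sequences below are restricted to
those that belong to the model. -/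

/-- The type of elements of the set `a` of the model. -/
def El {M : Type u} [Membership M M] (a : M) : Type u := {x : M // x ∈ a}

/-- A Lean type whose elements are represented by sets of the model. -/
class Coded (M : outParam (Type u)) (α : Type v) where
  code : α → M

instance {M : Type u} [Membership M M] (a : M) : Coded M (El a) := ⟨fun x => x.1⟩

/-- The unordered pair of the model. -/
noncomputable def upair {M : Type u} [Membership M M] [ZF M] (a b : M) : M :=
  Classical.choose (ZF.pairing a b)

/-- The Kuratowski ordered pair of the model. -/
noncomputable def pair {M : Type u} [Membership M M] [ZF M] (a b : M) : M :=
  upair (upair a a) (upair a b)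

noncomputable instance {M : Type u} [Membership M M] [ZF M] {α : Type v} {β : Type w}
    [Coded M α] [Coded M β] : Coded M (α × β) :=
  ⟨fun p => pair (Coded.code p.1) (Coded.code p.2)⟩

/-- The subset `s` belongs to the model. -/
def InModel {M : Type u} [Membership M M] {α : Type v} [Coded M α] (s : Set α) : Prop :=
  ∃ a : M, ∀ m, m ∈ a ↔ ∃ x ∈ s, Coded.code x = m

/-- The function `f` belongs to the model: its graph is a set of the model. -/
def FunInModel {M : Type u} [Membership M M] [ZF M] {α : Type v} {β : Type w}
    [Coded M α] [Coded M β] (f : α → β) : Prop :=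
  InModel {p : α × β | f p.1 = p.2}

/-! ### Natural numbers, finiteness, Dedekind-finiteness -/

/-- The natural numbers of the model (elements of its `ω`). -/
def Nats (M : Type u) [Membership M M] : Type u := {n : M // ∀ I : M, IsInductive I → n ∈ I}

instance (M : Type u) [Membership M M] : Coded M (Nats M) := ⟨fun n => n.1⟩

/-- The set `a` is finite in the model: it is in bijection with a natural number. -/
def IsFin {M : Type u} [Membership M M] [ZF M] (a : M) : Prop :=
  ∃ (n : Nats M) (f : El n.1 → El a), FunInModel f ∧ Function.Bijective f

/-- `Fin(X)`: the finite subsets of `X`. -/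
def FinSub {M : Type u} [Membership M M] [ZF M] (X : M) : Type u :=
  {s : M // (∀ z, z ∈ s → z ∈ X) ∧ IsFin s}

instance {M : Type u} [Membership M M] [ZF M] (X : M) : Coded M (FinSub X) := ⟨fun s => s.1⟩

/-- Every injective function from `α` to itself is surjective (in the model). -/
def DedekindFinite {M : Type u} [Membership M M] [ZF M] (α : Type v) [Coded M α] : Prop :=
  ∀ f : α → α, FunInModel f → Function.Injective f → Function.Surjective f

/-- `X` is CF: infinite and Cohen-finite. -/
def IsCF {M : Type u} [Membership M M] [ZF M] (X : M) : Prop :=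
  ¬ IsFin X ∧ DedekindFinite (FinSub X)

/-! ### Real and complex numbers -/

/-- `R`, with the given operations and order, is the field of real numbers of the model: the
complete ordered field (which is unique up to a unique isomorphism in the model). -/
class IsReals {M : Type u} [Membership M M] [ZF M] (R : M) [Field (El R)] [LinearOrder (El R)] :
    Prop extends IsStrictOrderedRing (El R) where
  add_inModel : FunInModel (fun p : El R × El R => p.1 + p.2)
  mul_inModel : FunInModel (fun p : El R × El R => p.1 * p.2)
  le_inModel : InModel {p : El R × El R | p.1 ≤ p.2}
  exists_isLUB : ∀ s : Set (El R), InModel s → s.Nonempty → BddAbove s → ∃ x, IsLUB s x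

/-- The complex numbers `a + b i`, with `i ^ 2 = -1`. -/
abbrev Cx {M : Type u} [Membership M M] (R : M) [Field (El R)] : Type u :=
  QuadraticAlgebra (El R) (-1) 0

/-- The complex number `a + b i` is the ordered pair of `a` and `b`. -/
noncomputable instance {M : Type u} [Membership M M] [ZF M] (R : M) [Field (El R)] :
    Coded M (Cx R) := ⟨fun z => Coded.code (z.re, z.im)⟩

/-- `|z| ^ 2` -/
def absSq {M : Type u} [Membership M M] {R : M} [Field (El R)] (z : Cx R) : El R :=
  z.re ^ 2 + z.im ^ 2

/-! ### Inner product spaces and Hilbert spaces -/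

/-- A complex inner product space of the model; the inner product is linear in the first
variable. -/
structure InnerSpace {M : Type u} [Membership M M] [ZF M] (R : M) [Field (El R)]
    [LinearOrder (El R)] where
  carrier : M
  [addCommGroup : AddCommGroup (El carrier)]
  [module : Module (Cx R) (El carrier)]
  inner : El carrier → El carrier → Cx R
  add_inModel : FunInModel (fun p : El carrier × El carrier => p.1 + p.2)
  smul_inModel : FunInModel (fun p : Cx R × El carrier => p.1 • p.2)
  inner_inModel : FunInModel (fun p : El carrier × El carrier => inner p.1 p.2)
  inner_add_left : ∀ x y z, inner (x + y) z = inner x z + inner y z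
  inner_smul_left : ∀ (c : Cx R) x y, inner (c • x) y = c * inner x y
  inner_conj_symm : ∀ x y, star (inner y x) = inner x y
  inner_self_nonneg : ∀ x, 0 ≤ (inner x x).re
  inner_self_eq_zero : ∀ x, inner x x = 0 → x = 0

attribute [instance] InnerSpace.addCommGroup InnerSpace.module

namespace InnerSpace

variable {M : Type u} [Membership M M] [ZF M] {R : M} [Field (El R)] [LinearOrder (El R)]

/-- The vectors of `H`. -/
abbrev Vec (H : InnerSpace R) : Type u := El H.carrier

/-- `‖x‖ ^ 2` -/
def normSq (H : InnerSpace R) (x : H.Vec) : El R := (H.inner x x).re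

/-- `s` is closed for the norm: it contains every `x` at distance `0` from `s`. -/
def IsClosedSet (H : InnerSpace R) (s : Set H.Vec) : Prop :=
  ∀ x, (∀ ε : El R, 0 < ε → ∃ y ∈ s, H.normSq (x - y) < ε ^ 2) → x ∈ s

/-- σ-completeness: every decreasing sequence of nonempty closed sets whose diameters tend to `0`
has nonempty intersection. -/
def IsSigmaComplete (H : InnerSpace R) : Prop :=
  ∀ A : Nats M → Set H.Vec, InModel {p : Nats M × H.Vec | p.2 ∈ A p.1} →
    (∀ n, (A n).Nonempty) → (∀ n, H.IsClosedSet (A n)) →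
    (∀ m n : Nats M, m.1 ∈ n.1 → A n ⊆ A m) →
    (∀ ε : El R, 0 < ε → ∃ n, ∀ x ∈ A n, ∀ y ∈ A n, H.normSq (x - y) < ε ^ 2) →
    ∃ x, ∀ n, x ∈ A n

/-- `H` is spanned by a finite set of vectors (lies in no proper subspace containing them). -/
def IsFiniteDimensional (H : InnerSpace R) : Prop :=
  ∃ F : FinSub H.carrier, ∀ K : Submodule (Cx R) H.Vec, InModel (K : Set H.Vec) →
    (∀ x : H.Vec, x.1 ∈ F.1 → x ∈ K) → K = ⊤

/-- `H` contains an infinite orthonormal sequence. -/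
def HasOrthonormalSeq (H : InnerSpace R) : Prop :=
  ∃ e : Nats M → H.Vec, FunInModel e ∧ (∀ n, H.inner (e n) (e n) = 1) ∧
    ∀ m n, m ≠ n → H.inner (e m) (e n) = 0

/-- `H` is isometrically isomorphic to a proper subspace of itself. -/
def HilbertDedekindInfinite (H : InnerSpace R) : Prop :=
  ∃ K : Submodule (Cx R) H.Vec, InModel (K : Set H.Vec) ∧ K ≠ ⊤ ∧
    ∃ V : H.Vec ≃ₗ[Cx R] K, FunInModel (fun x => (V x : H.Vec)) ∧
      ∀ x, H.normSq (V x : H.Vec) = H.normSq x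

/-- There is a bounded operator on `H` which is surjective but not injective. -/
def HilbertDuallyDedekindInfinite (H : InnerSpace R) : Prop :=
  ∃ T : H.Vec →ₗ[Cx R] H.Vec, FunInModel T ∧
    (∃ c : El R, ∀ x, H.normSq (T x) ≤ c ^ 2 * H.normSq x) ∧
    Function.Surjective T ∧ ¬ Function.Injective T

/-- HDF: infinite-dimensional and Hilbert Dedekind-finite. -/
def IsHDF (H : InnerSpace R) : Prop :=
  ¬ H.IsFiniteDimensional ∧ ¬ H.HilbertDedekindInfinite

/-- HDDF: infinite-dimensional and Hilbert dually Dedekind-finite. -/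
def IsHDDF (H : InnerSpace R) : Prop :=
  ¬ H.IsFiniteDimensional ∧ ¬ H.HilbertDuallyDedekindInfinite

end InnerSpace

/-! ### The space `ℓ²(X)` -/

/-- `S F` is the sum of `g x` over `x ∈ F`, for every finite `F ⊆ X`. -/
def IsFinSum {M : Type u} [Membership M M] [ZF M] {X : M} {α : Type v} [AddCommGroup α]
    [Coded M α] (g : El X → α) (S : FinSub X → α) : Prop :=
  FunInModel S ∧ (∀ F : FinSub X, IsEmptySet F.1 → S F = 0) ∧
    ∀ (F G : FinSub X) (x : El X), x.1 ∉ F.1 → IsInsert x.1 F.1 G.1 → S G = S F + g x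

section EllTwo

variable {M : Type u} [Membership M M] [ZF M] {R : M} [Field (El R)] [LinearOrder (El R)]

/-- `η : X → ℂ` is a function of the model with `∑ |η x| ^ 2 < ∞`: the sums over finite subsets
of `X` are bounded. -/
def IsSqSummable {X : M} (η : El X → Cx R) : Prop :=
  FunInModel η ∧ ∃ S : FinSub X → El R, IsFinSum (fun x => absSq (η x)) S ∧ BddAbove (Set.range S)

/-- The net of the sums of `g` over finite subsets of `X` converges to `c`. -/
def HasNetSum {X : M} (g : El X → Cx R) (c : Cx R) : Prop :=
  ∃ S : FinSub X → Cx R, IsFinSum g S ∧ ∀ ε : El R, 0 < ε → ∃ F : FinSub X, ∀ G : FinSub X,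
    (∀ z, z ∈ F.1 → z ∈ G.1) → absSq (S G - c) < ε ^ 2

/-- `L` is the inner product space `ℓ²(X)`: its vectors are exactly the graphs of the
square-summable functions `X → ℂ` (`ev ξ` is the function with graph `ξ`), its operations are
pointwise, and the inner product of `ξ` and `ζ` is the sum of `ξ x * conj (ζ x)`. -/
def IsEllTwo (X : M) (L : InnerSpace R) : Prop :=
  ∃ ev : L.Vec → El X → Cx R,
    (∀ (ξ : L.Vec) (m : M), m ∈ ξ.1 ↔ ∃ x, Coded.code (x, ev ξ x) = m) ∧
    (∀ η : El X → Cx R, IsSqSummable η ↔ ∃ ξ, ev ξ = η) ∧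
    (∀ ξ ζ x, ev (ξ + ζ) x = ev ξ x + ev ζ x) ∧
    (∀ (c : Cx R) ξ x, ev (c • ξ) x = c * ev ξ x) ∧
    ∀ ξ ζ, HasNetSum (fun x => ev ξ x * star (ev ζ x)) (L.inner ξ ζ)

end EllTwo

end ZFModel

set_option linter.unusedSectionVars false

/-! Two tasks run in parallel: the Hilbert space argument must make no choices, and every object it
produces must be a set of the model.

For the second task, a subset of, or a function between, types whose codes form a set belongs to the
model exactly when it is first-order definable with parameters (`inModel_iff`, `funInModel_iff`).
Definability `Df` is closed under composition, connectives and quantifiers, so it is mostly checked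
mechanically. The tactic `choose` acts outside the model and does no harm: whenever the chosen
function has to lie in the model, its values have a unique definable description, and `Df.of_iff`
applies.

Part (1) rests on `IsSigmaComplete.exists_near`: a point is found by intersecting the closures of
all sets of approximate solutions, never by picking a Cauchy sequence. This gives orthogonal
projections onto closed subspaces (`exists_projection`). An orthonormal sequence yields a shift
isometry whose range is orthogonal to `e 0`. Infinite sums are avoided: the graph of the shift is a
double orthogonal complement, and its domain is everything because it is closed with zero orthogonal
complement. The adjoint of an isometry onto a proper subspace is a bounded surjection with a nonzero
kernel. Finally, if `T` is onto with a kernel, preimages can be taken canonically in the orthogonal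
complement of `ker T`; iterating from a nonzero kernel vector gives a vector in `ker T^(n+1)`
outside `ker T^n` for each `n`, and its component orthogonal to `ker T^n` is the `n`-th member of an
orthogonal sequence.

Part (2) reduces to: `ℓ²(X)` has an orthonormal sequence iff `Fin(X)` is Dedekind-infinite. Both
sides are compared with a map enlarging every finite subset of `X` (`Enlarges`). From such a map one
gets a strictly increasing sequence of finite sets, whose successive differences have orthogonal
indicators. Conversely, for an orthonormal sequence `e`, the finite sets where `|e m|^2` is at least
`δ n` cannot all lie in one finite set, because the vectors supported on a finite set form a
Noetherian space; the first of them not contained in `U` enlarges `U`. Noetherianity replaces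
dimension theory and also shows that `ℓ²(X)` is infinite-dimensional. Part (1) applies to `ℓ²(X)`
once `EvalMap.isSigmaComplete` is known. -/

namespace ZFModel

/-! ### First-order definability over a model -/

section Definability

variable {M : Type u} [Membership M M] {ι κ : Type}

/-- The relation `p` between finitely many sets of the model is first-order definable with
parameters. -/
def RelDef {ι : Type} (p : (ι → M) → Prop) : Prop :=
  (Set.univ : Set M).Definable setLanguage {v : ι → M | p v}

namespace RelDef

theorem congr {p q : (ι → M) → Prop} (hp : RelDef p) (h : ∀ v, q v ↔ p v) : RelDef q := by
  have : q = p := funext fun v => propext (h v)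
  rwa [this]

theorem and {p q : (ι → M) → Prop} (hp : RelDef p) (hq : RelDef q) :
    RelDef fun v => p v ∧ q v := by
  have := Set.Definable.inter hp hq
  exact this

theorem or {p q : (ι → M) → Prop} (hp : RelDef p) (hq : RelDef q) :
    RelDef fun v => p v ∨ q v := by
  have := Set.Definable.union hp hq
  exact this

theorem not {p : (ι → M) → Prop} (hp : RelDef p) : RelDef fun v => ¬ p v := by
  have := Set.Definable.compl hp
  exact this

theorem iff {p q : (ι → M) → Prop} (hp : RelDef p) (hq : RelDef q) :
    RelDef fun v => (p v ↔ q v) :=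
  ((hp.and hq).or (hp.not.and hq.not)).congr fun v => by tauto

theorem subst {p : (κ → M) → Prop} (hp : RelDef p) (σ : κ → ι) :
    RelDef fun v : ι → M => p (v ∘ σ) :=
  Set.Definable.preimage_comp σ hp

/-- The bound variable is the extra index `Sum.inr ()`, so an existential quantifier is a projection
of a definable set. In the formulas below, each further quantifier wraps the older indices in one
more `Sum.inl`. -/
theorem ex [Finite ι] {p : (ι → M) → M → Prop}
    (hp : RelDef fun v : ι ⊕ Unit → M => p (v ∘ Sum.inl) (v (Sum.inr ()))) :
    RelDef fun v => ∃ m, p v m := by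
  have := Set.Definable.exists_of_finite (α := ι) (β := Unit) hp
  refine RelDef.congr this fun v => ⟨fun ⟨m, hm⟩ => ⟨fun _ => m, hm⟩, fun ⟨u, hu⟩ => ⟨u (), hu⟩⟩

theorem all [Finite ι] {p : (ι → M) → M → Prop}
    (hp : RelDef fun v : ι ⊕ Unit → M => p (v ∘ Sum.inl) (v (Sum.inr ()))) :
    RelDef fun v => ∀ m, p v m :=
  (ex (p := fun v m => ¬ p v m) hp.not).not.congr fun v => by simp

theorem mem (i j : ι) : RelDef fun v : ι → M => v i ∈ v j := by
  have : RelDef fun v : Fin 2 → M => v 0 ∈ v 1 := by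
    have h : (∅ : Set M).Definable setLanguage {v : Fin 2 → M | v 0 ∈ v 1} := by
      rw [Set.empty_definable_iff]
      refine ⟨FirstOrder.Language.Relations.formula (L := setLanguage) (n := 2) MemRel.mem
        (fun i => FirstOrder.Language.Term.var i), ?_⟩
      ext v
      simp only [Set.mem_ofPred_eq]
      rfl
    exact h.mono (Set.empty_subset _)
  exact this.subst ![i, j]

theorem eq (i j : ι) : RelDef fun v : ι → M => v i = v j := by
  have : RelDef fun v : Fin 2 → M => v 0 = v 1 :=
    Set.Definable.diagonal setLanguage (Set.univ : Set M)
  exact this.subst ![i, j]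

theorem eqConst (i : ι) (c : M) : RelDef fun v : ι → M => v i = c := by
  have : RelDef fun v : Fin 1 → M => v 0 = c :=
    Set.Definable.singleton_of_mem setLanguage (Set.mem_univ c)
  exact this.subst ![i]

end RelDef

end Definability

/-! ### Pairs -/

section Pairs

variable {M : Type u} [Membership M M] [ZF M]

theorem ext_mem {a b : M} (h : ∀ z, z ∈ a ↔ z ∈ b) : a = b := ZF.extensionality a b h

@[simp] theorem mem_upair {a b z : M} : z ∈ upair a b ↔ z = a ∨ z = b :=
  Classical.choose_spec (ZF.pairing a b) z

theorem upair_self_inj {a b : M} (h : upair a a = upair b b) : a = b := by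
  have : a ∈ upair b b := by rw [← h]; simp
  simpa using this

theorem pair_inj {a b c d : M} : pair a b = pair c d ↔ a = c ∧ b = d := by
  refine ⟨fun h => ?_, by rintro ⟨rfl, rfl⟩; rfl⟩
  have h1 : upair a a ∈ pair c d := by rw [← h]; simp [pair]
  have h2 : upair a b ∈ pair c d := by rw [← h]; simp [pair]
  have h3 : upair c d ∈ pair a b := by rw [h]; simp [pair]
  simp only [pair, mem_upair] at h1 h2 h3
  have hac : a = c := by
    rcases h1 with h1 | h1
    · exact upair_self_inj h1
    · have : c ∈ upair a a := by rw [h1]; simp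
      exact (by simpa using this : c = a).symm
  subst hac
  refine ⟨rfl, ?_⟩
  have hb : b = a ∨ b = d := by
    rcases h2 with h2 | h2
    · have : b ∈ upair a a := by rw [← h2]; simp
      left; simpa using this
    · have : b ∈ upair a d := by rw [← h2]; simp
      simpa using this
  have hd : d = a ∨ d = b := by
    rcases h3 with h3 | h3
    · have : d ∈ upair a a := by rw [← h3]; simp
      left; simpa using this
    · have : d ∈ upair a b := by rw [← h3]; simp
      simpa using this
  rcases hb with rfl | rfl
  · rcases hd with rfl | rfl <;> rfl
  · rfl

theorem relDef_upair {ι : Type} [Finite ι] (i j k : ι) :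
    RelDef fun v : ι → M => v i = upair (v j) (v k) := by
  refine RelDef.congr (p := fun v => ∀ z, z ∈ v i ↔ z = v j ∨ z = v k) ?_ fun v =>
    ⟨fun h z => by rw [h, mem_upair], fun h => ext_mem fun z => by rw [h, mem_upair]⟩
  exact RelDef.all ((RelDef.mem (Sum.inr ()) (Sum.inl i)).iff
    ((RelDef.eq (Sum.inr ()) (Sum.inl j)).or (RelDef.eq (Sum.inr ()) (Sum.inl k))))

theorem relDef_pair {ι : Type} [Finite ι] (i j k : ι) :
    RelDef fun v : ι → M => v i = pair (v j) (v k) := by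
  refine RelDef.congr
    (p := fun v => ∃ a, a = upair (v j) (v j) ∧ ∃ b, b = upair (v j) (v k) ∧ v i = upair a b) ?_
    fun v => by simp [pair]
  refine RelDef.ex ((relDef_upair (Sum.inr ()) (Sum.inl j) (Sum.inl j)).and
    (RelDef.ex ((relDef_upair (Sum.inr ()) (Sum.inl (Sum.inl j)) (Sum.inl (Sum.inl k))).and
      (relDef_upair (Sum.inl (Sum.inl i)) (Sum.inl (Sum.inr ())) (Sum.inr ())))))

theorem exists_sep {p : M → Prop} (h : RelDef fun v : Fin 1 → M => p (v 0)) (a : M) :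
    ∃ b : M, ∀ x, x ∈ b ↔ x ∈ a ∧ p x :=
  ZF.separation {x | p x} h a

theorem exists_empty : ∃ e : M, ∀ z, z ∉ e := by
  obtain ⟨I, ⟨e, -, he⟩, -⟩ := ZF.infinity (M := M)
  exact ⟨e, he⟩

/-- The empty set of the model. -/
noncomputable def emp (M : Type u) [Membership M M] [ZF M] : M := Classical.choose exists_empty

@[simp] theorem notMem_emp (z : M) : z ∉ emp M := Classical.choose_spec exists_empty z

end Pairs

/-! ### Definable types and definable functions -/

section DefType

/-- A Lean type whose elements are represented by the members of a definable class of the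
model. -/
class DefType (M : Type u) [Membership M M] (α : Type v) where
  cd : α → M
  cd_injective : Function.Injective cd
  relDef_range : RelDef fun v : Fin 1 → M => ∃ x, cd x = v 0

variable {M : Type u} [Membership M M] [ZF M] {α : Type*} {β : Type*} {γ : Type*}

theorem cd_inj [DefType M α] {x y : α} : DefType.cd (M := M) x = DefType.cd y ↔ x = y :=
  DefType.cd_injective.eq_iff

/-- The class of the codes of the elements of `α` with the property `p`. -/
def CodesOf [DefType M α] (p : α → Prop) (m : M) : Prop := ∃ x, DefType.cd x = m ∧ p x

/-- The graph of `f` on codes. -/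
def GraphOf [DefType M α] [DefType M β] (f : α → β) (a b : M) : Prop :=
  ∃ x, DefType.cd x = a ∧ DefType.cd (f x) = b

theorem codesOf_cd [DefType M α] {p : α → Prop} {x : α} :
    CodesOf p (DefType.cd x : M) ↔ p x := by
  simp [CodesOf, cd_inj]

theorem graphOf_cd [DefType M α] [DefType M β] {f : α → β} {x : α} {b : M} :
    GraphOf f (DefType.cd x : M) b ↔ DefType.cd (f x) = b := by
  simp [GraphOf, cd_inj]

variable (M α) in
/-- The class of the codes of the elements of `α`. -/
def Codes [DefType M α] (m : M) : Prop := ∃ x : α, DefType.cd x = m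

theorem relDef_codes [DefType M α] {ι : Type} (i : ι) :
    RelDef fun v : ι → M => Codes M α (v i) :=
  RelDef.subst DefType.relDef_range ![i]

-- Coding truth values by the two distinct sets `{∅}` and `∅` makes a definable predicate a
-- definable function into `Prop`. A single notion `Df` then serves for classes and for functions.
open DefType Classical in
noncomputable instance : DefType M Prop where
  cd p := if p then upair (emp M) (emp M) else emp M
  cd_injective p q h := by
    have : emp M ∈ (if p then upair (emp M) (emp M) else emp M) ↔
      emp M ∈ (if q then upair (emp M) (emp M) else emp M) := by
        simp only at h; rw [h]
    by_cases hp : p <;> by_cases hq : q <;> simp only [hp, hq, if_true, if_false, mem_upair,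
      notMem_emp, or_self, true_iff, iff_true] at this ⊢
  relDef_range := ((RelDef.eqConst 0 (upair (emp M) (emp M))).or
    (RelDef.eqConst 0 (emp M))).congr fun v => by
      constructor
      · rintro ⟨p, hp⟩
        by_cases h : p
        · exact Or.inl (by rw [← hp, if_pos h])
        · exact Or.inr (by rw [← hp, if_neg h])
      · rintro (h | h)
        · exact ⟨True, by rw [h, if_pos trivial]⟩
        · exact ⟨False, by rw [h, if_neg not_false]⟩

theorem cd_prop {p : Prop} : (DefType.cd p : M) = emp M ↔ ¬ p := by
  have : (DefType.cd False : M) = emp M := if_neg not_false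
  rw [← this, cd_inj]
  simp

instance : DefType M M where
  cd := id
  cd_injective := Function.injective_id
  relDef_range := (RelDef.eq 0 0).congr fun v => by simp

noncomputable instance [DefType M α] [DefType M β] : DefType M (α × β) where
  cd z := pair (DefType.cd z.1) (DefType.cd z.2)
  cd_injective := by
    rintro ⟨x, y⟩ ⟨x', y'⟩ h
    simp only [pair_inj, cd_inj] at h
    rw [h.1, h.2]
  relDef_range := by
    refine RelDef.congr (p := fun v : Fin 1 → M => ∃ a, Codes M α a ∧
      ∃ b, Codes M β b ∧ v 0 = pair a b) ?_ ?_
    · exact RelDef.ex ((relDef_codes (Sum.inr ())).and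
        (RelDef.ex ((relDef_codes (Sum.inr ())).and
          (relDef_pair (Sum.inl (Sum.inl 0)) (Sum.inl (Sum.inr ())) (Sum.inr ())))))
    · intro v
      constructor
      · rintro ⟨⟨x, y⟩, h⟩
        exact ⟨_, ⟨x, rfl⟩, _, ⟨y, rfl⟩, h.symm⟩
      · rintro ⟨_, ⟨x, rfl⟩, _, ⟨y, rfl⟩, h⟩
        exact ⟨(x, y), h.symm⟩

theorem cd_mk [DefType M α] [DefType M β] (x : α) (y : β) :
    DefType.cd (M := M) (x, y) = pair (DefType.cd x) (DefType.cd y) := rfl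

variable (M) in
/-- The function `f` is definable over the model, with parameters. -/
@[fun_prop] def Df [DefType M α] [DefType M β] (f : α → β) : Prop :=
  RelDef fun v : Fin 2 → M => GraphOf f (v 0) (v 1)

variable [DefType M α] [DefType M β] [DefType M γ]

open DefType

theorem Df.relDef {f : α → β} (h : Df M f) {ι : Type} (i j : ι) :
    RelDef fun v : ι → M => GraphOf f (v i) (v j) :=
  RelDef.subst h ![i, j]

theorem Df.relDef_codesOf {p : α → Prop} (h : Df M p) {ι : Type} [Finite ι] (i : ι) :
    RelDef fun v : ι → M => CodesOf p (v i) := by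
  refine RelDef.congr (p := fun v : ι → M => ∃ m, GraphOf p (v i) m ∧ ¬ m = emp M) ?_ ?_
  · exact RelDef.ex ((h.relDef (Sum.inl i) (Sum.inr ())).and
      (RelDef.eqConst (Sum.inr ()) (emp M)).not)
  · intro v
    constructor
    · rintro ⟨x, h1, h2⟩
      exact ⟨_, ⟨x, h1, rfl⟩, by rw [cd_prop]; simpa using h2⟩
    · rintro ⟨_, ⟨x, h1, rfl⟩, h3⟩
      rw [cd_prop, not_not] at h3
      exact ⟨x, h1, h3⟩

theorem df_of_codesOf {p : α → Prop} (h : RelDef fun v : Fin 1 → M => CodesOf p (v 0)) :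
    Df M p := by
  have h : RelDef fun v : Fin 2 → M => CodesOf p (v 0) := RelDef.subst h ![0]
  refine RelDef.congr (p := fun v : Fin 2 → M => (CodesOf p (v 0) ∧ v 1 = cd True) ∨
    ((Codes M α (v 0) ∧ ¬ CodesOf p (v 0)) ∧ v 1 = cd False)) ?_ ?_
  · exact (h.and (RelDef.eqConst 1 _)).or
      (((relDef_codes 0).and h.not).and (RelDef.eqConst 1 _))
  · intro v
    constructor
    · rintro ⟨x, h1, h2⟩
      rw [← h1, codesOf_cd]
      by_cases hp : p x
      · exact Or.inl ⟨hp, by simpa [hp] using h2.symm⟩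
      · exact Or.inr ⟨⟨⟨x, rfl⟩, hp⟩, by simpa [hp] using h2.symm⟩
    · rintro (⟨⟨x, h1, h2⟩, h3⟩ | ⟨⟨⟨x, h1⟩, h2⟩, h3⟩)
      · exact ⟨x, h1, by simp [h2, h3]⟩
      · rw [← h1, codesOf_cd] at h2
        exact ⟨x, h1, by simp [h2, h3]⟩

namespace Df

@[fun_prop] theorem id : Df M (fun x : α => x) :=
  ((RelDef.eq 0 1).and (relDef_codes 0)).congr (p := fun v => v 0 = v 1 ∧ Codes M α (v 0))
    fun v => by
    constructor
    · rintro ⟨x, h1, h2⟩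
      exact ⟨h1 ▸ h2, x, h1⟩
    · rintro ⟨h1, x, h2⟩
      exact ⟨x, h2, h2.trans h1⟩

@[fun_prop] theorem const (c : β) : Df M (fun _ : α => c) :=
  ((RelDef.eqConst 1 (cd c)).and (relDef_codes 0)).congr
    (p := fun v => v 1 = cd c ∧ Codes M α (v 0)) fun v => by
    constructor
    · rintro ⟨x, h1, h2⟩
      exact ⟨h2.symm, x, h1⟩
    · rintro ⟨h1, x, h2⟩
      exact ⟨x, h2, h1.symm⟩

@[fun_prop] theorem comp {g : β → γ} {f : α → β} (hg : Df M g) (hf : Df M f) :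
    Df M (fun x : α => g (f x)) := by
  refine RelDef.congr (p := fun v : Fin 2 → M => ∃ m, GraphOf f (v 0) m ∧ GraphOf g m (v 1)) ?_ ?_
  · exact RelDef.ex ((hf.relDef (Sum.inl 0) (Sum.inr ())).and
      (hg.relDef (Sum.inr ()) (Sum.inl 1)))
  · intro v
    constructor
    · rintro ⟨x, h1, h2⟩
      exact ⟨_, ⟨x, h1, rfl⟩, _, rfl, h2⟩
    · rintro ⟨_, ⟨x, h1, rfl⟩, h2⟩
      exact ⟨x, h1, graphOf_cd.1 h2⟩

@[fun_prop] theorem prodMk {f : α → β} {g : α → γ} (hf : Df M f) (hg : Df M g) :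
    Df M (fun x : α => (f x, g x)) := by
  refine RelDef.congr (p := fun v : Fin 2 → M => ∃ a, GraphOf f (v 0) a ∧
    ∃ b, GraphOf g (v 0) b ∧ v 1 = pair a b) ?_ ?_
  · exact RelDef.ex ((hf.relDef (Sum.inl 0) (Sum.inr ())).and (RelDef.ex
      ((hg.relDef (Sum.inl (Sum.inl 0)) (Sum.inr ())).and
        (relDef_pair (Sum.inl (Sum.inl 1)) (Sum.inl (Sum.inr ())) (Sum.inr ())))))
  · intro v
    constructor
    · rintro ⟨x, h1, h2⟩
      exact ⟨_, ⟨x, h1, rfl⟩, _, ⟨x, h1, rfl⟩, h2.symm⟩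
    · rintro ⟨_, ⟨x, h1, rfl⟩, _, h2, h3⟩
      rw [← h1, graphOf_cd] at h2
      exact ⟨x, h1, by rw [h3, ← h2]; rfl⟩

theorem prodFst : Df M (fun z : β × γ => z.1) := by
  refine RelDef.congr (p := fun v : Fin 2 → M => ∃ b, Codes M γ b ∧
    Codes M β (v 1) ∧ v 0 = pair (v 1) b) ?_ ?_
  · exact RelDef.ex ((relDef_codes (Sum.inr ())).and
      ((relDef_codes (Sum.inl 1)).and (relDef_pair (Sum.inl 0) (Sum.inl 1) (Sum.inr ()))))
  · intro v
    constructor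
    · rintro ⟨⟨x, y⟩, h1, h2⟩
      exact ⟨_, ⟨y, rfl⟩, ⟨x, h2⟩, by rw [← h1, ← h2]; rfl⟩
    · rintro ⟨_, ⟨y, rfl⟩, ⟨x, h1⟩, h2⟩
      exact ⟨(x, y), by rw [h2, ← h1]; rfl, h1⟩

theorem prodSnd : Df M (fun z : β × γ => z.2) := by
  refine RelDef.congr (p := fun v : Fin 2 → M => ∃ b, Codes M β b ∧
    Codes M γ (v 1) ∧ v 0 = pair b (v 1)) ?_ ?_
  · exact RelDef.ex ((relDef_codes (Sum.inr ())).and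
      ((relDef_codes (Sum.inl 1)).and (relDef_pair (Sum.inl 0) (Sum.inr ()) (Sum.inl 1))))
  · intro v
    constructor
    · rintro ⟨⟨x, y⟩, h1, h2⟩
      exact ⟨_, ⟨x, rfl⟩, ⟨y, h2⟩, by rw [← h1, ← h2]; rfl⟩
    · rintro ⟨_, ⟨x, rfl⟩, ⟨y, h1⟩, h2⟩
      exact ⟨(x, y), by rw [h2, ← h1]; rfl, h1⟩

@[fun_prop] theorem fst {f : α → β × γ} (hf : Df M f) : Df M (fun x : α => (f x).1) :=
  prodFst.comp hf

@[fun_prop] theorem snd {f : α → β × γ} (hf : Df M f) : Df M (fun x : α => (f x).2) :=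
  prodSnd.comp hf

@[fun_prop] theorem eq {f g : α → β} (hf : Df M f) (hg : Df M g) :
    Df M (fun x : α => f x = g x) := by
  apply df_of_codesOf
  refine RelDef.congr (p := fun v : Fin 1 → M => ∃ b, GraphOf f (v 0) b ∧ GraphOf g (v 0) b) ?_ ?_
  · exact RelDef.ex ((hf.relDef (Sum.inl 0) (Sum.inr ())).and
      (hg.relDef (Sum.inl 0) (Sum.inr ())))
  · intro v
    constructor
    · rintro ⟨x, h1, h2⟩
      exact ⟨_, ⟨x, h1, rfl⟩, ⟨x, h1, by rw [h2]⟩⟩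
    · rintro ⟨_, ⟨x, h1, rfl⟩, h2⟩
      rw [← h1, graphOf_cd, cd_inj] at h2
      exact ⟨x, h1, h2.symm⟩

@[fun_prop] theorem and {p q : α → Prop} (hp : Df M p) (hq : Df M q) :
    Df M (fun x : α => p x ∧ q x) := by
  apply df_of_codesOf
  refine ((hp.relDef_codesOf 0).and (hq.relDef_codesOf 0)).congr fun v => ⟨?_, ?_⟩
  · rintro ⟨x, h1, h2, h3⟩
    exact ⟨⟨x, h1, h2⟩, ⟨x, h1, h3⟩⟩
  · rintro ⟨⟨x, h1, h2⟩, h3⟩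
    rw [← h1, codesOf_cd] at h3
    exact ⟨x, h1, h2, h3⟩

-- The complement is taken among the codes of `α`, not in all of `M`; this is why `DefType` demands
-- that the class of codes be definable.
@[fun_prop] theorem not {p : α → Prop} (hp : Df M p) : Df M (fun x : α => ¬ p x) := by
  apply df_of_codesOf
  refine ((hp.relDef_codesOf 0).not.and (relDef_codes (α := α) 0)).congr fun v => ⟨?_, ?_⟩
  · rintro ⟨x, h1, h2⟩
    exact ⟨by rwa [← h1, codesOf_cd], x, h1⟩
  · rintro ⟨h1, x, h2⟩
    exact ⟨x, h2, by rwa [← h2, codesOf_cd] at h1⟩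

theorem congr {p q : α → Prop} (hp : Df M p) (h : ∀ x, q x ↔ p x) : Df M q := by
  have : q = p := funext fun x => propext (h x)
  rwa [this]

@[fun_prop] theorem or {p q : α → Prop} (hp : Df M p) (hq : Df M q) :
    Df M (fun x : α => p x ∨ q x) :=
  (hp.not.and hq.not).not.congr fun x => by tauto

@[fun_prop] theorem imp {p q : α → Prop} (hp : Df M p) (hq : Df M q) :
    Df M (fun x : α => p x → q x) :=
  (hp.not.or hq).congr fun x => by tauto

@[fun_prop] theorem iff {p q : α → Prop} (hp : Df M p) (hq : Df M q) :
    Df M (fun x : α => p x ↔ q x) :=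
  ((hp.imp hq).and (hq.imp hp)).congr fun x => by tauto

@[fun_prop] theorem ex {p : α → β → Prop} (hp : Df M (fun z : α × β => p z.1 z.2)) :
    Df M (fun x : α => ∃ y, p x y) := by
  apply df_of_codesOf
  refine RelDef.congr (p := fun v : Fin 1 → M => ∃ c, CodesOf (fun z : α × β => p z.1 z.2) c ∧
    ∃ b, c = pair (v 0) b) ?_ ?_
  · exact RelDef.ex ((hp.relDef_codesOf (Sum.inr ())).and (RelDef.ex
      (relDef_pair (Sum.inl (Sum.inr ())) (Sum.inl (Sum.inl 0)) (Sum.inr ()))))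
  · intro v
    constructor
    · rintro ⟨x, h1, y, h2⟩
      exact ⟨_, ⟨(x, y), rfl, h2⟩, _, by rw [← h1]; rfl⟩
    · rintro ⟨_, ⟨⟨x, y⟩, rfl, h2⟩, b, h3⟩
      rw [cd_mk, pair_inj] at h3
      exact ⟨x, h3.1, y, h2⟩

@[fun_prop] theorem all {p : α → β → Prop} (hp : Df M (fun z : α × β => p z.1 z.2)) :
    Df M (fun x : α => ∀ y, p x y) :=
  (ex (p := fun x y => ¬ p x y) hp.not).not.congr fun x => by simp

@[fun_prop] theorem exUnique {p : α → β → Prop} (hp : Df M (fun z : α × β => p z.1 z.2)) :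
    Df M (fun x : α => ∃! y, p x y) := by
  have h : Df M (fun z : (α × β) × β => p z.1.1 z.2) :=
    Df.comp (g := fun z : α × β => p z.1 z.2) (f := fun z : (α × β) × β => (z.1.1, z.2)) hp
      (by fun_prop)
  unfold ExistsUnique
  fun_prop

/-- A function with a definable graph is definable. -/
theorem of_iff {f : α → β} {p : α → β → Prop} (h : ∀ x y, f x = y ↔ p x y)
    (hp : Df M (fun z : α × β => p z.1 z.2)) : Df M f := by
  refine RelDef.congr (p := fun v : Fin 2 → M => ∃ c, CodesOf (fun z : α × β => p z.1 z.2) c ∧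
    c = pair (v 0) (v 1)) ?_ ?_
  · exact RelDef.ex ((hp.relDef_codesOf (Sum.inr ())).and
      (relDef_pair (Sum.inr ()) (Sum.inl 0) (Sum.inl 1)))
  · intro v
    constructor
    · rintro ⟨x, h1, h2⟩
      exact ⟨_, ⟨(x, f x), rfl, (h _ _).1 rfl⟩, by rw [← h1, ← h2]; rfl⟩
    · rintro ⟨_, ⟨⟨x, y⟩, rfl, h2⟩, h3⟩
      rw [cd_mk, pair_inj] at h3
      exact ⟨x, h3.1, by rw [(h x y).2 h2]; exact h3.2⟩

open Classical in
@[fun_prop] theorem ite {p : α → Prop} {f g : α → β} (hp : Df M p) (hf : Df M f) (hg : Df M g) :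
    Df M (fun x => if p x then f x else g x) := by
  refine of_iff (p := fun x y => (p x → f x = y) ∧ (¬ p x → g x = y)) (fun x y => ?_)
    (by fun_prop)
  by_cases h : p x <;> simp [h]

@[fun_prop] theorem cd {f : α → β} (hf : Df M f) : Df M (fun x => (DefType.cd (f x) : M)) := hf

/-- The graph of a function is read off from codes alone, so passing to the code of the value
changes nothing. -/
theorem of_cd {f : α → β} (hf : Df M (fun x => (DefType.cd (f x) : M))) : Df M f := hf

@[fun_prop] theorem mem {f g : α → M} (hf : Df M f) (hg : Df M g) :
    Df M (fun x => f x ∈ g x) := by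
  apply df_of_codesOf
  refine RelDef.congr (p := fun v : Fin 1 → M => ∃ b, GraphOf f (v 0) b ∧
    ∃ c : M, GraphOf g (v 0) c ∧ b ∈ c) ?_ ?_
  · exact RelDef.ex ((hf.relDef (Sum.inl 0) (Sum.inr ())).and (RelDef.ex
      ((hg.relDef (Sum.inl (Sum.inl 0)) (Sum.inr ())).and
        (RelDef.mem (Sum.inl (Sum.inr ())) (Sum.inr ())))))
  · intro v
    constructor
    · rintro ⟨x, h1, h2⟩
      exact ⟨_, ⟨x, h1, rfl⟩, _, ⟨x, h1, rfl⟩, h2⟩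
    · rintro ⟨_, ⟨x, h1, rfl⟩, _, h2, h3⟩
      rw [← h1, graphOf_cd] at h2
      subst h2
      exact ⟨x, h1, h3⟩

@[fun_prop] theorem pair {f g : α → M} (hf : Df M f) (hg : Df M g) :
    Df M (fun x => ZFModel.pair (f x) (g x)) :=
  (Df.prodMk hf hg).cd

end Df

theorem relDef_of_df {p : M → Prop} (h : Df M p) : RelDef fun v : Fin 1 → M => p (v 0) :=
  (h.relDef_codesOf 0).congr fun v => by
    constructor
    · exact fun h => ⟨v 0, rfl, h⟩
    · rintro ⟨x, h1, h2⟩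
      exact (show x = v 0 from h1) ▸ h2

theorem exists_sep_df {p : M → Prop} (h : Df M p) (a : M) : ∃ b : M, ∀ x, x ∈ b ↔ x ∈ a ∧ p x :=
  exists_sep (relDef_of_df h) a

end DefType

open DefType

/-! ### Types that are sets of the model -/

section SetTypes

variable {M : Type u} [Membership M M] [ZF M]

theorem DefType.relDef_of_iff {α : Type*} {cd : α → M} {p : M → Prop} (hp : Df M p)
    (h : ∀ m, (∃ x, cd x = m) ↔ p m) : RelDef fun v : Fin 1 → M => ∃ x, cd x = v 0 :=
  (relDef_of_df hp).congr fun v => h (v 0)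

@[fun_prop] theorem Df.isEmptySet {α : Type*} [DefType M α] {f : α → M} (hf : Df M f) :
    Df M fun x => IsEmptySet (f x) := by
  unfold IsEmptySet; fun_prop

@[fun_prop] theorem Df.isInsert {α : Type*} [DefType M α] {f g h : α → M} (hf : Df M f)
    (hg : Df M g) (hh : Df M h) : Df M fun x => IsInsert (f x) (g x) (h x) := by
  unfold IsInsert; fun_prop

@[fun_prop] theorem Df.isInductive {α : Type*} [DefType M α] {f : α → M} (hf : Df M f) :
    Df M fun x => IsInductive (f x) := by
  unfold IsInductive; fun_prop

instance (a : M) : DefType M (El a) where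
  cd x := x.1
  cd_injective := Subtype.val_injective
  relDef_range := DefType.relDef_of_iff (p := fun m => m ∈ a) (by fun_prop) fun m =>
    ⟨by rintro ⟨x, rfl⟩; exact x.2, fun h => ⟨⟨m, h⟩, rfl⟩⟩

instance : DefType M (Nats M) where
  cd x := x.1
  cd_injective := Subtype.val_injective
  relDef_range := DefType.relDef_of_iff (p := fun m => ∀ I : M, IsInductive I → m ∈ I)
    (by fun_prop) fun m => ⟨by rintro ⟨x, rfl⟩; exact x.2, fun h => ⟨⟨m, h⟩, rfl⟩⟩

@[fun_prop] theorem Df.elVal {α : Type*} [DefType M α] {a : M} {f : α → El a} (hf : Df M f) :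
    Df M fun x => (f x).1 := hf

@[fun_prop] theorem Df.natsVal {α : Type*} [DefType M α] {f : α → Nats M} (hf : Df M f) :
    Df M fun x => (f x).1 := hf

/-- The codes of the type `α` form a set of the model. -/
class SetType (M : Type u) [Membership M M] (α : Type v) [Coded M α] [DefType M α] : Prop where
  cd_eq_code : ∀ x : α, (cd x : M) = Coded.code x
  exists_bound : ∃ a : M, ∀ x : α, cd x ∈ a

instance (a : M) : SetType M (El a) := ⟨fun _ => rfl, a, fun x => x.2⟩

instance : SetType M (Nats M) :=
  ⟨fun _ => rfl, by
    obtain ⟨I, hI⟩ := ZF.infinity (M := M)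
    exact ⟨I, fun n => n.2 I hI⟩⟩

theorem exists_binUnion (a b : M) : ∃ c : M, ∀ z, z ∈ c ↔ z ∈ a ∨ z ∈ b := by
  obtain ⟨c, hc⟩ := ZF.union (upair a b)
  exact ⟨c, fun z => by rw [hc]; simp⟩

instance {α : Type v} {β : Type w} [Coded M α] [Coded M β] [DefType M α] [DefType M β]
    [SetType M α] [SetType M β] : SetType M (α × β) where
  cd_eq_code x := by
    rw [← Prod.mk.eta (p := x), cd_mk, SetType.cd_eq_code, SetType.cd_eq_code]; rfl
  exists_bound := by
    obtain ⟨a, ha⟩ := SetType.exists_bound (M := M) (α := α)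
    obtain ⟨b, hb⟩ := SetType.exists_bound (M := M) (α := β)
    -- A Kuratowski pair of elements of `a ∪ b` is a set of subsets of `a ∪ b`, so the double power
    -- set bounds all codes.
    obtain ⟨c, hc⟩ := exists_binUnion a b
    obtain ⟨p, hp⟩ := ZF.powerset c
    obtain ⟨q, hq⟩ := ZF.powerset p
    refine ⟨q, fun x => ?_⟩
    rw [hq]
    intro y hy
    rw [hp]
    intro z hz
    rw [hc]
    have h1 := ha x.1
    have h2 := hb x.2
    change y ∈ pair (cd x.1) (cd x.2) at hy
    simp only [pair, mem_upair] at hy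
    rcases hy with rfl | rfl
    · simp only [mem_upair, or_self] at hz
      exact Or.inl (hz ▸ h1)
    · simp only [mem_upair] at hz
      rcases hz with rfl | rfl
      · exact Or.inl h1
      · exact Or.inr h2

variable {α : Type v} {β : Type w} [Coded M α] [Coded M β] [DefType M α] [DefType M β]
  [SetType M α] [SetType M β]

theorem exists_set_of_df {α : Type v} [Coded M α] [DefType M α] [SetType M α] {p : α → Prop}
    (hp : Df M p) : ∃ a : M, ∀ m, m ∈ a ↔ ∃ x, p x ∧ cd x = m := by
  obtain ⟨b, hb⟩ := SetType.exists_bound (M := M) (α := α)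
  obtain ⟨a, ha⟩ := exists_sep_df (p := fun m => ∃ x, p x ∧ cd x = m) (by fun_prop) b
  refine ⟨a, fun m => ?_⟩
  rw [ha]
  refine ⟨fun h => h.2, fun h => ⟨?_, h⟩⟩
  obtain ⟨x, -, rfl⟩ := h
  exact hb x

/-- A set of the model is itself an admissible parameter, which gives definability. Conversely,
Separation inside a bound for the codes turns a definable predicate into a set. -/
theorem inModel_iff {s : Set α} : InModel s ↔ Df M fun x => x ∈ s := by
  constructor
  · rintro ⟨a, ha⟩
    refine Df.congr (p := fun x => cd x ∈ a) (by fun_prop) fun x => ?_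
    rw [ha]
    constructor
    · exact fun h => ⟨x, h, (SetType.cd_eq_code x).symm⟩
    · rintro ⟨y, h1, h2⟩
      rw [← SetType.cd_eq_code, cd_inj] at h2
      exact h2 ▸ h1
  · intro h
    obtain ⟨a, ha⟩ := exists_set_of_df h
    exact ⟨a, fun m => by simp only [ha, SetType.cd_eq_code]⟩

theorem funInModel_iff {f : α → β} : FunInModel f ↔ Df M f := by
  unfold FunInModel
  rw [inModel_iff]
  exact ⟨fun h => Df.of_iff (p := fun x y => f x = y) (fun x y => Iff.rfl) h,
    fun h => (by fun_prop : Df M fun p : α × β => f p.1 = p.2)⟩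

/-- The sets of the model whose elements are codes of elements of `α`. -/
structure PSet (M : Type u) [Membership M M] (α : Type v) [DefType M α] where
  carrier : M
  sub : ∀ m, m ∈ carrier → ∃ x : α, cd x = m

/-- `x` belongs to the set `s` of the model. -/
def PSet.Has (s : PSet M α) (x : α) : Prop := cd x ∈ s.carrier

instance : DefType M (PSet M α) where
  cd := PSet.carrier
  cd_injective := by
    rintro ⟨a, ha⟩ ⟨b, hb⟩ h
    simp only at h
    subst h
    rfl
  relDef_range := DefType.relDef_of_iff (p := fun a => ∀ m, m ∈ a → ∃ x : α, cd x = m)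
    (by fun_prop) fun a => ⟨by rintro ⟨x, rfl⟩; exact x.2, fun h => ⟨⟨a, h⟩, rfl⟩⟩

@[fun_prop] theorem Df.has {γ : Type*} [DefType M γ] {s : γ → PSet M α} {f : γ → α}
    (hs : Df M s) (hf : Df M f) : Df M fun x => (s x).Has (f x) := by
  have h : Df M fun x => (s x).carrier := hs
  unfold PSet.Has
  fun_prop

/-- Comprehension for definable predicates. Since `PSet` is itself a definable type, later formulas
may quantify over subsets and, through `Fn`, over functions of the model. -/
theorem exists_pset {p : α → Prop} (hp : Df M p) : ∃ s : PSet M α, ∀ x, s.Has x ↔ p x := by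
  obtain ⟨a, ha⟩ := exists_set_of_df hp
  refine ⟨⟨a, fun m hm => ?_⟩, fun x => ?_⟩
  · obtain ⟨x, -, h⟩ := (ha m).1 hm
    exact ⟨x, h⟩
  · unfold PSet.Has
    rw [ha]
    constructor
    · rintro ⟨y, h1, h2⟩
      exact cd_inj.1 h2 ▸ h1
    · exact fun h => ⟨x, h, rfl⟩

theorem PSet.df (s : PSet M α) : Df M s.Has := by
  have : Df M fun x => s.Has x := by fun_prop
  exact this

/-- The functions of the model from `α` to `β`. -/
def Fn (M : Type u) [Membership M M] [ZF M] (α : Type v) (β : Type w) [DefType M α]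
    [DefType M β] : Type _ :=
  {s : PSet M (α × β) // ∀ x, ∃! y, s.Has (x, y)}

/-- The value of a function of the model. -/
noncomputable def Fn.ev (f : Fn M α β) (x : α) : β := Classical.choose (f.2 x)

theorem Fn.ev_eq_iff (f : Fn M α β) (x : α) (y : β) : f.ev x = y ↔ f.1.Has (x, y) := by
  have h := Classical.choose_spec (f.2 x)
  exact ⟨fun e => e ▸ h.1, fun e => (h.2 y e).symm⟩

noncomputable instance : DefType M (Fn M α β) where
  cd f := cd f.1
  cd_injective := fun f g h => Subtype.ext (DefType.cd_injective h)
  relDef_range := DefType.relDef_of_iff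
    (p := fun m => ∃ s : PSet M (α × β), (∀ x, ∃! y, s.Has (x, y)) ∧ cd s = m)
    (by
      refine Df.ex ?_
      have h : Df M fun z : (M × PSet M (α × β)) × α => ∃! y, z.1.2.Has (z.2, y) :=
        Df.exUnique (by fun_prop)
      fun_prop) fun a => ⟨by rintro ⟨x, rfl⟩; exact ⟨x.1, x.2, rfl⟩, by
      rintro ⟨s, hs, rfl⟩; exact ⟨⟨s, hs⟩, rfl⟩⟩

@[fun_prop] theorem Df.fnVal {γ : Type*} [DefType M γ] {f : γ → Fn M α β} (hf : Df M f) :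
    Df M fun x => (f x).1 := hf

@[fun_prop] theorem Df.ev {γ : Type*} [DefType M γ] {f : γ → Fn M α β} {g : γ → α}
    (hf : Df M f) (hg : Df M g) : Df M fun x => (f x).ev (g x) := by
  refine Df.of_iff (p := fun x y => (f x).1.Has (g x, y)) (fun x y => Fn.ev_eq_iff _ _ _) ?_
  fun_prop

theorem exists_fn {f : α → β} (hf : Df M f) : ∃ F : Fn M α β, ∀ x, F.ev x = f x := by
  obtain ⟨s, hs⟩ := exists_pset (p := fun z : α × β => f z.1 = z.2) (by fun_prop)
  have h : ∀ x, ∃! y, s.Has (x, y) := fun x =>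
    ⟨f x, (hs _).2 rfl, fun y hy => ((hs _).1 hy).symm⟩
  exact ⟨⟨s, h⟩, fun x => (Fn.ev_eq_iff ⟨s, h⟩ x (f x)).2 ((hs _).2 rfl)⟩

theorem Fn.df (f : Fn M α β) : Df M f.ev := by
  have : Df M fun x => f.ev x := by fun_prop
  exact this

theorem Fn.ext {f g : Fn M α β} (h : ∀ x, f.ev x = g.ev x) : f = g := by
  apply Subtype.ext
  have key : ∀ f g : Fn M α β, (∀ x, f.ev x = g.ev x) → ∀ m, m ∈ f.1.carrier →
      m ∈ g.1.carrier := by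
    intro f g h m hm
    obtain ⟨⟨x, y⟩, rfl⟩ := f.1.sub m hm
    exact (g.ev_eq_iff x y).1 ((h x).symm.trans ((f.ev_eq_iff x y).2 hm))
  apply DefType.cd_injective (M := M)
  exact ext_mem fun m => ⟨key f g h m, key g f (fun x => (h x).symm) m⟩

end SetTypes

/-! ### Natural numbers -/

section Naturals

variable {M : Type u} [Membership M M] [ZF M]

theorem exists_insert (x a : M) : ∃ b : M, IsInsert x a b := by
  obtain ⟨c, hc⟩ := exists_binUnion a (upair x x)
  exact ⟨c, fun z => by rw [hc]; simp⟩

/-- `a ∪ {x}` -/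
noncomputable def ins (x a : M) : M := Classical.choose (exists_insert x a)

@[simp] theorem mem_ins {x a z : M} : z ∈ ins x a ↔ z ∈ a ∨ z = x :=
  Classical.choose_spec (exists_insert x a) z

theorem isInsert_iff {x a b : M} : IsInsert x a b ↔ b = ins x a :=
  ⟨fun h => ext_mem fun z => by rw [h, mem_ins], by rintro rfl z; exact mem_ins⟩

theorem isEmptySet_iff {a : M} : IsEmptySet a ↔ a = emp M :=
  ⟨fun h => ext_mem fun z => by simp [h z], by rintro rfl; exact notMem_emp⟩

theorem ins_eq_self {x a : M} (h : x ∈ a) : ins x a = a :=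
  ext_mem fun z => by rw [mem_ins]; exact ⟨by rintro (h | rfl) <;> assumption, Or.inl⟩

@[fun_prop] theorem Df.ins {α : Type*} [DefType M α] {f g : α → M} (hf : Df M f)
    (hg : Df M g) : Df M fun x => ZFModel.ins (f x) (g x) :=
  Df.of_iff (p := fun x y => IsInsert (f x) (g x) y)
    (fun x y => by rw [isInsert_iff, eq_comm]) (by fun_prop)

theorem isInductive_iff {I : M} : IsInductive I ↔ emp M ∈ I ∧ ∀ x, x ∈ I → ins x x ∈ I := by
  unfold IsInductive
  simp only [isEmptySet_iff, isInsert_iff, exists_eq_right]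

/-- Foundation applied to `{a}`. -/
theorem notMem_self (a : M) : a ∉ a := by
  intro h
  obtain ⟨x, hx, h2⟩ := ZF.foundation (upair a a) ⟨a, by simp⟩
  simp only [mem_upair, or_self] at hx
  subst hx
  exact h2 x h (by simp)

namespace Nats

noncomputable instance : Zero (Nats M) := ⟨⟨emp M, fun _ hI => (isInductive_iff.1 hI).1⟩⟩

/-- The successor of a natural number of the model. -/
noncomputable def succ (n : Nats M) : Nats M :=
  ⟨ins n.1 n.1, fun I hI => (isInductive_iff.1 hI).2 _ (n.2 I hI)⟩

@[ext] theorem ext {m n : Nats M} (h : m.1 = n.1) : m = n := Subtype.ext h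

@[fun_prop] theorem _root_.ZFModel.Df.natsSucc {α : Type*} [DefType M α] {f : α → Nats M}
    (hf : Df M f) : Df M fun x => (f x).succ := by
  have h : Df M fun x => (f x).1 := hf
  exact Df.of_cd (M := M) (by fun_prop : Df M fun x => ZFModel.ins (f x).1 (f x).1)

/-- Restricted to definable `p`, because only such a `p` cuts out an inductive set of the model. The
natural numbers may be nonstandard from outside, so induction for arbitrary predicates is
unavailable. -/
theorem ind {p : Nats M → Prop} (hp : Df M p) (h0 : p 0) (hs : ∀ n, p n → p n.succ)
    (n : Nats M) : p n := by
  obtain ⟨I, hI⟩ := exists_set_of_df hp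
  have hI' : IsInductive I := by
    rw [isInductive_iff, hI]
    refine ⟨⟨0, h0, rfl⟩, fun x hx => ?_⟩
    rw [hI] at hx ⊢
    obtain ⟨n, hn, rfl⟩ := hx
    exact ⟨n.succ, hs n hn, rfl⟩
  obtain ⟨m, hm, h⟩ := (hI _).1 (n.2 I hI')
  exact cd_inj.1 h ▸ hm

theorem eq_zero_or_succ (n : Nats M) : n = 0 ∨ ∃ m : Nats M, n = m.succ :=
  ind (p := fun n : Nats M => n = 0 ∨ ∃ m : Nats M, n = m.succ) (by fun_prop) (Or.inl rfl)
    (fun n _ => Or.inr ⟨n, rfl⟩) n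

theorem mem_succ {n : Nats M} {x : M} : x ∈ n.succ.1 ↔ x ∈ n.1 ∨ x = n.1 := mem_ins

theorem trans {m n : Nats M} (h : m.1 ∈ n.1) {x : M} (hx : x ∈ m.1) : x ∈ n.1 := by
  have := ind (p := fun n : Nats M => ∀ m : Nats M, m.1 ∈ n.1 → ∀ x : M, x ∈ m.1 → x ∈ n.1)
    (by fun_prop) (fun m hm => absurd hm (notMem_emp _)) (fun n h m hm x hx => by
      rw [mem_succ] at hm ⊢
      rcases hm with hm | hm
      · exact Or.inl (h m hm x hx)
      · exact Or.inl (hm ▸ hx)) n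
  exact this m h x hx

theorem zero_mem_succ (n : Nats M) : (0 : Nats M).1 ∈ n.succ.1 :=
  ind (p := fun n : Nats M => (0 : Nats M).1 ∈ n.succ.1) (by fun_prop)
    (mem_succ.2 (Or.inr rfl)) (fun _ h => mem_succ.2 (Or.inl h)) n

theorem succ_mem_succ {m n : Nats M} (h : m.1 ∈ n.1) : m.succ.1 ∈ n.succ.1 :=
  ind (p := fun n : Nats M => ∀ m : Nats M, m.1 ∈ n.1 → m.succ.1 ∈ n.succ.1)
    (by fun_prop) (fun m hm => absurd hm (notMem_emp _)) (fun n h m hm => by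
      rw [mem_succ]
      rcases mem_succ.1 hm with hm | hm
      · exact Or.inl (h m hm)
      · exact Or.inr (by rw [ext hm])) n m h

theorem trichotomy (m n : Nats M) : m.1 ∈ n.1 ∨ m = n ∨ n.1 ∈ m.1 :=
  ind (p := fun n : Nats M => ∀ m : Nats M, m.1 ∈ n.1 ∨ m = n ∨ n.1 ∈ m.1) (by fun_prop)
    (fun m => by
      rcases eq_zero_or_succ m with rfl | ⟨k, rfl⟩
      · simp
      · exact Or.inr (Or.inr (zero_mem_succ k))) (fun n h m => by
      rcases eq_zero_or_succ m with rfl | ⟨k, rfl⟩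
      · exact Or.inl (zero_mem_succ n)
      · rcases h k with h | rfl | h
        · exact Or.inl (succ_mem_succ h)
        · exact Or.inr (Or.inl rfl)
        · exact Or.inr (Or.inr (succ_mem_succ h))) n m

noncomputable instance : LinearOrder (Nats M) where
  le m n := m.1 ∈ n.1 ∨ m = n
  lt m n := m.1 ∈ n.1
  le_refl n := Or.inr rfl
  le_trans a b c := by
    rintro (h | rfl) (h' | rfl)
    · exact Or.inl (trans h' h)
    · exact Or.inl h
    · exact Or.inl h'
    · exact Or.inr rfl
  le_antisymm a b := by
    rintro (h | rfl) (h' | h')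
    · exact absurd (trans h' h) (notMem_self _)
    · exact h'.symm
    · rfl
    · rfl
  lt_iff_le_not_ge a b := by
    constructor
    · intro h
      refine ⟨Or.inl h, ?_⟩
      rintro (h' | rfl)
      · exact notMem_self _ (trans h' h)
      · exact notMem_self _ h
    · rintro ⟨h | rfl, h'⟩
      · exact h
      · exact absurd (Or.inr rfl) h'
  le_total a b := by
    rcases trichotomy a b with h | rfl | h
    · exact Or.inl (Or.inl h)
    · exact Or.inl (Or.inr rfl)
    · exact Or.inr (Or.inl h)
  toDecidableLE := Classical.decRel _

theorem lt_iff_mem {m n : Nats M} : m < n ↔ m.1 ∈ n.1 := Iff.rfl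

@[fun_prop] theorem _root_.ZFModel.Df.natsLt {α : Type*} [DefType M α] {f g : α → Nats M}
    (hf : Df M f) (hg : Df M g) : Df M fun x => f x < g x := by
  simp only [lt_iff_mem]; fun_prop

@[fun_prop] theorem _root_.ZFModel.Df.natsLe {α : Type*} [DefType M α] {f g : α → Nats M}
    (hf : Df M f) (hg : Df M g) : Df M fun x => f x ≤ g x := by
  simp only [← not_lt]; fun_prop

theorem lt_succ {m n : Nats M} : m < n.succ ↔ m ≤ n := by
  rw [lt_iff_mem, mem_succ, le_iff_lt_or_eq, lt_iff_mem, Nats.ext_iff]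

theorem lt_succ_self (n : Nats M) : n < n.succ := lt_succ.2 le_rfl

theorem not_lt_zero (n : Nats M) : ¬ n < 0 := notMem_emp _

theorem succ_le {m n : Nats M} : m.succ ≤ n ↔ m < n := by
  constructor
  · exact fun h => (lt_succ_self m).trans_le h
  · intro h
    by_contra h'
    rw [not_le, lt_succ] at h'
    exact absurd h (not_lt.2 h')

theorem succ_inj {m n : Nats M} : m.succ = n.succ ↔ m = n := by
  refine ⟨fun h => le_antisymm ?_ ?_, fun h => h ▸ rfl⟩
  · exact lt_succ.1 (h ▸ lt_succ_self m)
  · exact lt_succ.1 (h ▸ lt_succ_self n)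

theorem succ_ne_zero (n : Nats M) : n.succ ≠ 0 := fun h =>
  not_lt_zero n (h ▸ lt_succ_self n)

theorem exists_least {p : Nats M → Prop} (hp : Df M p) (h : ∃ n, p n) :
    ∃ n, p n ∧ ∀ k, k < n → ¬ p k := by
  by_contra hc
  push Not at hc
  have : ∀ n m : Nats M, m < n → ¬ p m := ind
    (p := fun n : Nats M => ∀ m : Nats M, m < n → ¬ p m) (by fun_prop)
    (fun m hm => absurd hm (not_lt_zero m)) (fun n ih m hm hpm => by
      obtain ⟨k, hk, hpk⟩ := hc m hpm
      exact ih k (hk.trans_le (lt_succ.1 hm)) hpk)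
  obtain ⟨n, hn⟩ := h
  exact this n.succ n (lt_succ_self n) hn

end Nats

/-! ### Iteration -/

section Iteration

variable {α : Type v} [Coded M α] [DefType M α] [SetType M α]

/-- `b` is the `n`-th iterate of `F` at `a`. -/
def IterRel (M : Type u) [Membership M M] [ZF M] [DefType M α] (F : α → α) (n : Nats M)
    (a b : α) : Prop :=
  ∀ Q : PSet M (Nats M × α), Q.Has (0, a) → (∀ n b, Q.Has (n, b) → Q.Has (n.succ, F b)) →
    Q.Has (n, b)

@[fun_prop] theorem Df.iterRel {F : α → α} (hF : Df M F) {γ : Type*} [DefType M γ]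
    {f : γ → Nats M} {g h : γ → α} (hf : Df M f) (hg : Df M g) (hh : Df M h) :
    Df M fun x => IterRel M F (f x) (g x) (h x) := by
  unfold IterRel
  fun_prop

theorem iterRel_zero (F : α → α) (a : α) : IterRel M F 0 a a := fun _ h _ => h

theorem iterRel_succ {F : α → α} {n : Nats M} {a b : α} (h : IterRel M F n a b) :
    IterRel M F n.succ a (F b) := fun Q h0 hs => hs _ _ (h Q h0 hs)

/-- `IterRel` is the least relation with the two closure properties, so it is contained in the set
of pairs that moreover arise by one of the two rules. -/
theorem iterRel_inv {F : α → α} (hF : Df M F) {n : Nats M} {a b : α} (h : IterRel M F n a b) :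
    (n = 0 ∧ b = a) ∨ ∃ m c, n = m.succ ∧ b = F c ∧ IterRel M F m a c := by
  obtain ⟨Q, hQ⟩ := exists_pset (M := M) (p := fun z : Nats M × α => IterRel M F z.1 a z.2 ∧
    ((z.1 = 0 ∧ z.2 = a) ∨ ∃ m c, z.1 = m.succ ∧ z.2 = F c ∧ IterRel M F m a c)) (by fun_prop)
  refine ((hQ (n, b)).1 (h Q ?_ ?_)).2
  · rw [hQ]
    exact ⟨iterRel_zero F a, Or.inl ⟨rfl, rfl⟩⟩
  · intro n b hb
    rw [hQ] at hb ⊢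
    exact ⟨iterRel_succ hb.1, Or.inr ⟨n, b, rfl, rfl, hb.1⟩⟩

theorem existsUnique_iterRel {F : α → α} (hF : Df M F) (n : Nats M) (a : α) :
    ∃! b, IterRel M F n a b := by
  refine Nats.ind (p := fun n : Nats M => ∃! b, IterRel M F n a b) (Df.exUnique (by fun_prop))
    ⟨a, iterRel_zero F a, fun b hb => ?_⟩ (fun n hn => ?_) n
  · rcases iterRel_inv hF hb with h | ⟨m, c, h, -⟩
    · exact h.2
    · exact absurd h.symm (Nats.succ_ne_zero m)
  · obtain ⟨b, hb, hu⟩ := hn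
    refine ⟨F b, iterRel_succ hb, fun b' hb' => ?_⟩
    rcases iterRel_inv hF hb' with h | ⟨m, c, h1, h2, h3⟩
    · exact absurd h.1 (Nats.succ_ne_zero n)
    · rw [Nats.succ_inj] at h1
      subst h1
      rw [h2, hu c h3]

/-- Iteration along the natural numbers of the model. -/
theorem exists_iter {F : α → α} (hF : Df M F) : ∃ it : Nats M → α → α,
    Df M (fun z : Nats M × α => it z.1 z.2) ∧ (∀ a, it 0 a = a) ∧
      ∀ n a, it n.succ a = F (it n a) := by
  choose it h1 h2 using fun n a => existsUnique_iterRel (M := M) hF n a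
  have h : ∀ n a b, it n a = b ↔ IterRel M F n a b := fun n a b =>
    ⟨by rintro rfl; exact h1 n a, fun h => (h2 n a b h).symm⟩
  refine ⟨it, Df.of_iff (p := fun z b => IterRel M F z.1 z.2 b) (fun z b => h _ _ _)
    (by fun_prop), fun a => (h _ _ _).2 (iterRel_zero F a), fun n a => (h _ _ _).2
    (iterRel_succ (h1 n a))⟩

end Iteration

end Naturals

/-! ### Finite sets -/

section Finite

variable {M : Type u} [Membership M M] [ZF M]

theorem El.val_congr {a : M} {x y : El a} (h : x = y) : x.1 = y.1 := h ▸ rfl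

/-- There is a bijection from `n` to `a` in the model. -/
def Equinumerous (n a : M) : Prop :=
  ∃ f : M, (∀ x, x ∈ n → ∃! y, y ∈ a ∧ pair x y ∈ f) ∧ ∀ y, y ∈ a → ∃! x, x ∈ n ∧ pair x y ∈ f

@[fun_prop] theorem Df.equinumerous {α : Type*} [DefType M α] {f g : α → M} (hf : Df M f)
    (hg : Df M g) : Df M fun x => Equinumerous (f x) (g x) := by
  unfold Equinumerous ExistsUnique
  fun_prop

theorem equinumerous_of_bijective {n a : M} {f : El n → El a} (hf : Df M f)
    (hb : Function.Bijective f) : Equinumerous n a := by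
  obtain ⟨g, hg⟩ := exists_set_of_df (M := M) (p := fun z : El n × El a => f z.1 = z.2)
    (by fun_prop)
  have key : ∀ (x : El n) (y : El a), pair x.1 y.1 ∈ g ↔ f x = y := by
    intro x y
    rw [hg]
    constructor
    · rintro ⟨⟨x', y'⟩, h1, h2⟩
      obtain ⟨h3, h4⟩ := pair_inj.1 h2
      rw [← Subtype.ext h3, ← Subtype.ext h4]
      exact h1
    · exact fun h => ⟨(x, y), h, rfl⟩
  refine ⟨g, fun x hx => ?_, fun y hy => ?_⟩
  · refine ⟨(f ⟨x, hx⟩).1, ⟨(f ⟨x, hx⟩).2, (key ⟨x, hx⟩ _).2 rfl⟩, fun y hy => ?_⟩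
    rw [(key ⟨x, hx⟩ ⟨y, hy.1⟩).1 hy.2]
  · obtain ⟨x, hx⟩ := hb.2 ⟨y, hy⟩
    refine ⟨x.1, ⟨x.2, (key x ⟨y, hy⟩).2 hx⟩, fun x' hx' => ?_⟩
    have := (key ⟨x', hx'.1⟩ ⟨y, hy⟩).1 hx'.2
    exact congrArg Subtype.val (hb.1 (this.trans hx.symm))

theorem Equinumerous.exists_bijective {n a : M} (h : Equinumerous n a) :
    ∃ f : El n → El a, Df M f ∧ Function.Bijective f := by
  obtain ⟨g, h1, h2⟩ := h
  choose f hf hu using h1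
  have key : ∀ (x : El n) (y : El a),
      (⟨f x.1 x.2, (hf x.1 x.2).1⟩ : El a) = y ↔ pair x.1 y.1 ∈ g := by
    intro x y
    constructor
    · rintro rfl
      exact (hf x.1 x.2).2
    · exact fun h => Subtype.ext (hu x.1 x.2 y.1 ⟨y.2, h⟩).symm
  refine ⟨fun x => ⟨f x.1 x.2, (hf x.1 x.2).1⟩, Df.of_iff key (by fun_prop), ?_, ?_⟩
  · intro x x' he
    obtain ⟨z, -, hz⟩ := h2 (f x.1 x.2) (hf x.1 x.2).1
    have e1 := hz x.1 ⟨x.2, (hf x.1 x.2).2⟩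
    have e2 := hz x'.1 ⟨x'.2, (key x' _).1 he.symm⟩
    exact Subtype.ext (e1.trans e2.symm)
  · intro y
    obtain ⟨x, hx, -⟩ := h2 y.1 y.2
    exact ⟨⟨x, hx.1⟩, (key ⟨x, hx.1⟩ y).2 hx.2⟩

/-- `IsFin` quantifies over Lean functions, which no formula can express. `Equinumerous` quantifies
over a single set instead, and this makes finiteness definable. -/
theorem isFin_iff {a : M} : IsFin a ↔ ∃ n : Nats M, Equinumerous n.1 a := by
  unfold IsFin
  refine exists_congr fun n => ⟨?_, ?_⟩
  · rintro ⟨f, hf, hb⟩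
    exact equinumerous_of_bijective (funInModel_iff.1 hf) hb
  · intro h
    obtain ⟨f, hf, hb⟩ := h.exists_bijective
    exact ⟨f, funInModel_iff.2 hf, hb⟩

@[fun_prop] theorem Df.isFin {α : Type*} [DefType M α] {f : α → M} (hf : Df M f) :
    Df M fun x => IsFin (f x) := by
  simp only [isFin_iff]
  fun_prop

theorem isFin_emp : IsFin (emp M) :=
  isFin_iff.2 ⟨0, emp M, fun x hx => absurd hx (notMem_emp x), fun x hx => absurd hx (notMem_emp x)⟩

theorem IsFin.ins {x a : M} (h : IsFin a) : IsFin (ins x a) := by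
  by_cases hx : x ∈ a
  · rwa [ins_eq_self hx]
  obtain ⟨n, hn⟩ := isFin_iff.1 h
  obtain ⟨f, hf, hb⟩ := hn.exists_bijective
  classical
  -- The elements of `n + 1` are those of `n`, on which the bijection is kept, and `n` itself, which
  -- is sent to `x`.
  let g : El n.succ.1 → El (ZFModel.ins x a) := fun z =>
    if h : z.1 ∈ n.1 then ⟨(f ⟨z.1, h⟩).1, mem_ins.2 (Or.inl (f ⟨z.1, h⟩).2)⟩
    else ⟨x, mem_ins.2 (Or.inr rfl)⟩
  have hg1 : ∀ (z : El n.succ.1) (h : z.1 ∈ n.1), (g z).1 = (f ⟨z.1, h⟩).1 := fun z h =>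
    El.val_congr (dif_pos h)
  have hg2 : ∀ (z : El n.succ.1) (_ : z.1 ∉ n.1), (g z).1 = x := fun z h =>
    El.val_congr (dif_neg h)
  refine isFin_iff.2 ⟨n.succ, equinumerous_of_bijective (f := g) ?_ ⟨?_, ?_⟩⟩
  · refine Df.of_iff (p := fun z y => (∃ w : El n.1, w.1 = z.1 ∧ (f w).1 = y.1) ∨
      (z.1 ∉ n.1 ∧ x = y.1)) (fun z y => ?_) (by fun_prop)
    by_cases hz : z.1 ∈ n.1
    · constructor
      · rintro rfl
        exact Or.inl ⟨⟨z.1, hz⟩, rfl, (hg1 z hz).symm⟩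
      · rintro (⟨w, h1, h2⟩ | h)
        · apply Subtype.ext
          rw [hg1 z hz, ← h2, show (⟨z.1, hz⟩ : El n.1) = w from Subtype.ext h1.symm]
        · exact absurd hz h.1
    · constructor
      · rintro rfl
        exact Or.inr ⟨hz, (hg2 z hz).symm⟩
      · rintro (⟨w, h1, h2⟩ | h)
        · exact absurd (h1 ▸ w.2) hz
        · exact Subtype.ext ((hg2 z hz).trans h.2)
  · intro z z' he
    have he' := congrArg Subtype.val he
    apply Subtype.ext
    by_cases hz : z.1 ∈ n.1 <;> by_cases hz' : z'.1 ∈ n.1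
    · rw [hg1 z hz, hg1 z' hz'] at he'
      have e := El.val_congr (hb.1 (Subtype.ext he'))
      exact e
    · rw [hg1 z hz, hg2 z' hz'] at he'
      exact absurd (he' ▸ (f ⟨z.1, hz⟩).2) hx
    · rw [hg2 z hz, hg1 z' hz'] at he'
      exact absurd (he' ▸ (f ⟨z'.1, hz'⟩).2) hx
    · exact ((Nats.mem_succ.1 z.2).resolve_left hz).trans
        ((Nats.mem_succ.1 z'.2).resolve_left hz').symm
  · intro y
    rcases mem_ins.1 y.2 with hy | hy
    · obtain ⟨w, hw⟩ := hb.2 ⟨y.1, hy⟩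
      refine ⟨⟨w.1, Nats.mem_succ.2 (Or.inl w.2)⟩, Subtype.ext ?_⟩
      exact (hg1 ⟨w.1, Nats.mem_succ.2 (Or.inl w.2)⟩ w.2).trans (El.val_congr hw)
    · refine ⟨⟨n.1, Nats.mem_succ.2 (Or.inr rfl)⟩, Subtype.ext ?_⟩
      exact (hg2 ⟨n.1, Nats.mem_succ.2 (Or.inr rfl)⟩ (notMem_self _)).trans hy.symm

/-- Induction on finite sets. -/
theorem IsFin.ind {p : M → Prop} (hp : Df M p) (h0 : p (emp M))
    (hs : ∀ x a, IsFin a → x ∉ a → p a → p (ZFModel.ins x a)) {a : M} (ha : IsFin a) : p a := by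
  obtain ⟨n, hn⟩ := isFin_iff.1 ha
  refine Nats.ind (p := fun n : Nats M => ∀ a : M, Equinumerous n.1 a → p a) (by fun_prop)
    ?_ ?_ n a hn
  · rintro a ⟨f, -, h⟩
    have he : a = emp M := isEmptySet_iff.1 fun z hz => ?_
    · rwa [he]
    · obtain ⟨x, hx, -⟩ := h z hz
      exact notMem_emp _ hx.1
  · rintro n ih a ⟨f, h1, h2⟩
    obtain ⟨y, hy, hyu⟩ := h1 n.1 (Nats.mem_succ.2 (Or.inr rfl))
    -- Removing the image `y` of the last element `n` leaves a set of size `n`. The same `f` serves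
    -- as witness, since `Equinumerous` only looks at pairs inside the two given sets.
    obtain ⟨b, hb⟩ := exists_sep_df (p := fun z => z ≠ y) (by fun_prop) a
    have hab : a = ZFModel.ins y b := ext_mem fun z => by
      rw [mem_ins, hb]
      by_cases hz : z = y
      · simp [hz, hy.1]
      · simp [hz]
    have hE : Equinumerous n.1 b := by
      refine ⟨f, fun x hx => ?_, fun z hz => ?_⟩
      · obtain ⟨z, hz, hzu⟩ := h1 x (Nats.mem_succ.2 (Or.inl hx))
        refine ⟨z, ⟨(hb z).2 ⟨hz.1, ?_⟩, hz.2⟩, fun w hw => hzu w ⟨((hb w).1 hw.1).1, hw.2⟩⟩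
        rintro rfl
        obtain ⟨x', -, hu⟩ := h2 z hz.1
        have e1 := hu x ⟨Nats.mem_succ.2 (Or.inl hx), hz.2⟩
        have e2 := hu n.1 ⟨Nats.mem_succ.2 (Or.inr rfl), hy.2⟩
        rw [e1, ← e2] at hx
        exact notMem_self _ hx
      · rw [hb] at hz
        obtain ⟨x, hx, hxu⟩ := h2 z hz.1
        refine ⟨x, ⟨?_, hx.2⟩, fun w hw => hxu w ⟨Nats.mem_succ.2 (Or.inl hw.1), hw.2⟩⟩
        rcases Nats.mem_succ.1 hx.1 with h | rfl
        · exact h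
        · exact absurd (hyu z ⟨hz.1, hx.2⟩) hz.2
    rw [hab]
    exact hs y b (isFin_iff.2 ⟨n, hE⟩) (fun h => ((hb y).1 h).2 rfl) (ih b hE)

theorem IsFin.subset {a : M} (ha : IsFin a) : ∀ {b : M}, (∀ z, z ∈ b → z ∈ a) → IsFin b := by
  have := IsFin.ind (p := fun a : M => ∀ b : M, (∀ z, z ∈ b → z ∈ a) → IsFin b) (by fun_prop)
    (fun b hb => by
      rw [isEmptySet_iff.1 fun z hz => notMem_emp z (hb z hz)]
      exact isFin_emp)
    (fun x a _ _ ih b hb => by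
      obtain ⟨c, hc⟩ := exists_sep_df (p := fun z => z ≠ x) (by fun_prop) b
      have hcf : IsFin c := ih c fun z hz => by
        rw [hc] at hz
        exact (mem_ins.1 (hb z hz.1)).resolve_right hz.2
      by_cases hx : x ∈ b
      · have : b = ZFModel.ins x c := ext_mem fun z => by
          rw [mem_ins, hc]
          by_cases hz : z = x
          · simp [hz, hx]
          · simp [hz]
        rw [this]
        exact hcf.ins
      · have : b = c := ext_mem fun z => by
          rw [hc]
          exact ⟨fun h => ⟨h, fun e => hx (e ▸ h)⟩, fun h => h.1⟩
        rwa [this]) ha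
  exact fun {b} => this b

theorem IsFin.binUnion {a b : M} (ha : IsFin a) (hb : IsFin b) :
    ∃ c : M, IsFin c ∧ ∀ z, z ∈ c ↔ z ∈ a ∨ z ∈ b :=
  IsFin.ind (p := fun b : M => ∃ c : M, IsFin c ∧ ∀ z, z ∈ c ↔ z ∈ a ∨ z ∈ b) (by fun_prop)
    ⟨a, ha, fun z => by simp⟩ (fun x b _ _ ⟨c, hc, h⟩ =>
      ⟨ZFModel.ins x c, hc.ins, fun z => by rw [mem_ins, mem_ins, h, or_assoc]⟩) hb

theorem IsFin.image {F : M → M} (hF : Df M F) {a : M} (ha : IsFin a) :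
    ∃ c : M, IsFin c ∧ ∀ z, z ∈ c ↔ ∃ x, x ∈ a ∧ z = F x :=
  IsFin.ind (p := fun a : M => ∃ c : M, IsFin c ∧ ∀ z, z ∈ c ↔ ∃ x, x ∈ a ∧ z = F x)
    (by fun_prop) ⟨emp M, isFin_emp, fun z => by simp⟩ (fun x b _ _ ⟨c, hc, h⟩ =>
      ⟨ZFModel.ins (F x) c, hc.ins, fun z => by
        rw [mem_ins, h]
        constructor
        · rintro (⟨y, h1, h2⟩ | h)
          · exact ⟨y, mem_ins.2 (Or.inl h1), h2⟩
          · exact ⟨x, mem_ins.2 (Or.inr rfl), h⟩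
        · rintro ⟨y, h1, h2⟩
          rcases mem_ins.1 h1 with h1 | rfl
          · exact Or.inl ⟨y, h1, h2⟩
          · exact Or.inr h2⟩) ha

/-- The subsets of `a ∪ {x}` are the subsets of `a` together with the sets `w ∪ {x}` for `w ⊆ a`. -/
theorem IsFin.powerset {a : M} (ha : IsFin a) :
    ∃ c : M, IsFin c ∧ ∀ z, z ∈ c ↔ ∀ y, y ∈ z → y ∈ a := by
  refine IsFin.ind (p := fun a : M => ∃ c : M, IsFin c ∧ ∀ z, z ∈ c ↔ ∀ y, y ∈ z → y ∈ a)
    (by fun_prop) ⟨ZFModel.ins (emp M) (emp M), isFin_emp.ins, fun z => ?_⟩ ?_ ha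
  · rw [mem_ins, ← isEmptySet_iff]
    simp [IsEmptySet]
  · rintro x a - - ⟨c, hc, h⟩
    obtain ⟨d, hd, hd'⟩ := hc.image (F := fun z => ZFModel.ins x z) (by fun_prop)
    obtain ⟨e, he, he'⟩ := hc.binUnion hd
    refine ⟨e, he, fun z => ?_⟩
    rw [he', hd', h]
    constructor
    · rintro (h1 | ⟨w, h1, rfl⟩) y hy
      · exact mem_ins.2 (Or.inl (h1 y hy))
      · rw [mem_ins] at hy ⊢
        exact hy.imp ((h w).1 h1 y) fun h => h
    · intro hz
      by_cases hx : x ∈ z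
      · obtain ⟨w, hw⟩ := exists_sep_df (p := fun y => y ≠ x) (by fun_prop) z
        refine Or.inr ⟨w, (h w).2 fun y hy => ?_, ext_mem fun y => ?_⟩
        · rw [hw] at hy
          exact (mem_ins.1 (hz y hy.1)).resolve_right hy.2
        · rw [mem_ins, hw]
          by_cases hy : y = x
          · simp [hy, hx]
          · simp [hy]
      · exact Or.inl fun y hy => (mem_ins.1 (hz y hy)).resolve_right fun e => hx (e ▸ hy)

/-- A finite set contains no infinite sequence of distinct elements. -/
theorem IsFin.not_injective {a : M} (ha : IsFin a) {f : Nats M → El a} (hf : Df M f) :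
    ¬ Function.Injective f := by
  obtain ⟨f, rfl⟩ : ∃ F : Fn M (Nats M) (El a), F.ev = f :=
    (exists_fn hf).imp fun _ h => funext h
  intro hi
  -- The induction runs over a set `b` containing all the values, while the codomain stays `El a`.
  refine IsFin.ind (p := fun b : M => ∀ f : Fn M (Nats M) (El a),
    (∀ m n, f.ev m = f.ev n → m = n) → ¬ ∀ n, (f.ev n).1 ∈ b) (by fun_prop) ?_ ?_ ha f
    (fun m n h => hi h) (fun n => (f.ev n).2)
  · exact fun f _ h => notMem_emp _ (h 0)
  · classical
    intro b c _ _ ih f hi h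
    -- To avoid the value `b`, drop the term `f 0` and use it as a substitute wherever `b` occurs
    -- later. Injectivity survives because `b` occurs at most once.
    obtain ⟨g, hg⟩ := exists_fn (M := M) (f := fun k : Nats M =>
      if (f.ev k.succ).1 = b then f.ev 0 else f.ev k.succ) (by fun_prop)
    have h0 : ∀ k : Nats M, f.ev 0 ≠ f.ev k.succ := fun k e => Nats.succ_ne_zero k (hi _ _ e).symm
    refine ih g (fun m n e => ?_) fun n => ?_
    · rw [hg, hg] at e
      split_ifs at e with h1 h2 h2
      · exact Nats.succ_inj.1 (hi _ _ (Subtype.ext (h1.trans h2.symm)))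
      · exact absurd e (h0 n)
      · exact absurd e.symm (h0 m)
      · exact Nats.succ_inj.1 (hi _ _ e)
    · rw [hg]
      split_ifs with h1
      · exact (mem_ins.1 (h 0)).resolve_right fun e => h0 n (Subtype.ext (e.trans h1.symm))
      · exact (mem_ins.1 (h n.succ)).resolve_right h1

/-! ### The type of finite subsets -/

instance (X : M) : DefType M (FinSub X) where
  cd s := s.1
  cd_injective := Subtype.val_injective
  relDef_range := DefType.relDef_of_iff (p := fun s : M => (∀ z, z ∈ s → z ∈ X) ∧ IsFin s)
    (by fun_prop) fun m => ⟨by rintro ⟨x, rfl⟩; exact x.2, fun h => ⟨⟨m, h⟩, rfl⟩⟩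

instance (X : M) : SetType M (FinSub X) :=
  ⟨fun _ => rfl, by
    obtain ⟨p, hp⟩ := ZF.powerset X
    exact ⟨p, fun s => (hp _).2 s.2.1⟩⟩

@[fun_prop] theorem Df.finSubVal {α : Type*} [DefType M α] {X : M} {f : α → FinSub X}
    (hf : Df M f) : Df M fun x => (f x).1 := hf

namespace FinSub

variable {X : M}

noncomputable instance : EmptyCollection (FinSub X) :=
  ⟨⟨emp M, fun z hz => absurd hz (notMem_emp z), isFin_emp⟩⟩

/-- `F ∪ {x}` -/
noncomputable def insert (x : El X) (F : FinSub X) : FinSub X :=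
  ⟨ins x.1 F.1, fun z hz => by
    rcases mem_ins.1 hz with h | rfl
    · exact F.2.1 z h
    · exact x.2, F.2.2.ins⟩

theorem mem_insert {x : El X} {F : FinSub X} {z : M} : z ∈ (insert x F).1 ↔ z ∈ F.1 ∨ z = x.1 :=
  mem_ins

@[fun_prop] theorem _root_.ZFModel.Df.finSubInsert {α : Type*} [DefType M α] {f : α → El X}
    {g : α → FinSub X} (hf : Df M f) (hg : Df M g) : Df M fun x => insert (f x) (g x) :=
  Df.of_cd (M := M) (by fun_prop : Df M fun x => ins (f x).1 (g x).1)

theorem ext {F G : FinSub X} (h : ∀ z, z ∈ F.1 ↔ z ∈ G.1) : F = G := Subtype.ext (ext_mem h)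

theorem exists_union (F G : FinSub X) : ∃ H : FinSub X, ∀ z, z ∈ H.1 ↔ z ∈ F.1 ∨ z ∈ G.1 := by
  obtain ⟨c, hc, h⟩ := F.2.2.binUnion G.2.2
  exact ⟨⟨c, fun z hz => ((h z).1 hz).elim (F.2.1 z) (G.2.1 z), hc⟩, h⟩

theorem exists_sep (F : FinSub X) {p : M → Prop} (hp : Df M p) :
    ∃ H : FinSub X, ∀ z, z ∈ H.1 ↔ z ∈ F.1 ∧ p z := by
  obtain ⟨c, hc⟩ := exists_sep_df hp F.1
  exact ⟨⟨c, fun z hz => F.2.1 z ((hc z).1 hz).1,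
    F.2.2.subset fun z hz => ((hc z).1 hz).1⟩, hc⟩

theorem ind {p : FinSub X → Prop} (hp : Df M p) (h0 : p ∅)
    (hs : ∀ x F, x.1 ∉ F.1 → p F → p (insert x F)) (F : FinSub X) : p F := by
  refine IsFin.ind (p := fun a : M => ∀ F : FinSub X, F.1 = a → p F) (by fun_prop) ?_ ?_
    F.2.2 F rfl
  · intro F hF
    rwa [show F = ∅ from Subtype.ext hF]
  · intro x a ha hx ih F hF
    have hxX : x ∈ X := F.2.1 x (hF ▸ mem_ins.2 (Or.inr rfl))
    have haX : ∀ z, z ∈ a → z ∈ X := fun z hz => F.2.1 z (hF ▸ mem_ins.2 (Or.inl hz))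
    have : F = insert ⟨x, hxX⟩ ⟨a, haX, ha⟩ := Subtype.ext hF
    rw [this]
    exact hs _ _ hx (ih _ rfl)

end FinSub

/-! ### Dedekind-finiteness of the type of finite subsets -/

theorem dedekindFinite_iff {α : Type v} [Coded M α] [DefType M α] [SetType M α] :
    DedekindFinite α ↔ ∀ f : α → α, Df M f → Function.Injective f → Function.Surjective f := by
  unfold DedekindFinite
  exact forall_congr' fun f => by rw [funInModel_iff]

/-- A function on finite subsets which strictly enlarges each of them. -/
def Enlarges {X : M} (Φ : FinSub X → FinSub X) : Prop :=
  ∀ U, (∀ z, z ∈ U.1 → z ∈ (Φ U).1) ∧ ∃ z, z ∈ (Φ U).1 ∧ z ∉ U.1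

/-- Adjoin to `U` the first member of the family not contained in it: least `m`, then least `n`.
Well-ordering of the index sets replaces choice. -/
theorem exists_enlarges_of_family {X : M} {F : Nats M → Nats M → FinSub X}
    (hF : Df M fun z : Nats M × Nats M => F z.1 z.2)
    (h : ∀ U : FinSub X, ∃ m n z, z ∈ (F m n).1 ∧ z ∉ U.1) :
    ∃ Φ : FinSub X → FinSub X, Df M Φ ∧ Enlarges Φ := by
  have hF' : Df M fun w : (FinSub X × Nats M) × Nats M => F w.1.2 w.2 :=
    Df.comp (g := fun z : Nats M × Nats M => F z.1 z.2) hF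
      (by fun_prop : Df M fun w : (FinSub X × Nats M) × Nats M => (w.1.2, w.2))
  let P : FinSub X → Nats M → Prop := fun U m => ∃ n z, z ∈ (F m n).1 ∧ z ∉ U.1
  have hP : Df M fun w : FinSub X × Nats M => P w.1 w.2 := by
    change Df M fun w : FinSub X × Nats M => ∃ n z, z ∈ (F w.2 n).1 ∧ z ∉ w.1.1
    fun_prop
  let P' : FinSub X → Nats M → Prop := fun U m => P U m ∧ ∀ k, k < m → ¬ P U k
  have hP' : Df M fun w : FinSub X × Nats M => P' w.1 w.2 := by
    have : Df M fun w : (FinSub X × Nats M) × Nats M => P w.1.1 w.2 :=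
      Df.comp (g := fun w : FinSub X × Nats M => P w.1 w.2) hP
        (by fun_prop : Df M fun w : (FinSub X × Nats M) × Nats M => (w.1.1, w.2))
    change Df M fun w : FinSub X × Nats M => P w.1 w.2 ∧ ∀ k, k < w.2 → ¬ P w.1 k
    fun_prop
  have h1 : ∀ U, ∃! m, P' U m := by
    intro U
    have hPU : Df M fun m => P U m :=
      Df.comp (g := fun w : FinSub X × Nats M => P w.1 w.2) hP
        (by fun_prop : Df M fun m : Nats M => (U, m))
    obtain ⟨m, hm, hm'⟩ := Nats.exists_least hPU (h U)
    exact ⟨m, ⟨hm, hm'⟩, fun k hk => le_antisymm (not_lt.1 fun e => hk.2 m e hm)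
      (not_lt.1 fun e => hm' k e hk.1)⟩
  choose μ hμ hμu using h1
  have hμD : Df M μ := Df.of_iff (p := fun U m => P' U m)
    (fun U m => ⟨by rintro rfl; exact hμ U, fun e => (hμu U m e).symm⟩) hP'
  let Q : FinSub X → Nats M → Prop := fun U n => ∃ z, z ∈ (F (μ U) n).1 ∧ z ∉ U.1
  have hFμ : Df M fun w : FinSub X × Nats M => F (μ w.1) w.2 :=
    Df.comp (g := fun z : Nats M × Nats M => F z.1 z.2) hF
      (by fun_prop : Df M fun w : FinSub X × Nats M => (μ w.1, w.2))
  have hQ : Df M fun w : FinSub X × Nats M => Q w.1 w.2 := by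
    change Df M fun w : FinSub X × Nats M => ∃ z, z ∈ (F (μ w.1) w.2).1 ∧ z ∉ w.1.1
    fun_prop
  let Q' : FinSub X → Nats M → Prop := fun U m => Q U m ∧ ∀ k, k < m → ¬ Q U k
  have hQ' : Df M fun w : FinSub X × Nats M => Q' w.1 w.2 := by
    have : Df M fun w : (FinSub X × Nats M) × Nats M => Q w.1.1 w.2 :=
      Df.comp (g := fun w : FinSub X × Nats M => Q w.1 w.2) hQ
        (by fun_prop : Df M fun w : (FinSub X × Nats M) × Nats M => (w.1.1, w.2))
    change Df M fun w : FinSub X × Nats M => Q w.1 w.2 ∧ ∀ k, k < w.2 → ¬ Q w.1 k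
    fun_prop
  have h2 : ∀ U, ∃! n, Q' U n := by
    intro U
    have hQU : Df M fun m => Q U m :=
      Df.comp (g := fun w : FinSub X × Nats M => Q w.1 w.2) hQ
        (by fun_prop : Df M fun m : Nats M => (U, m))
    obtain ⟨m, hm, hm'⟩ := Nats.exists_least hQU (hμ U).1
    exact ⟨m, ⟨hm, hm'⟩, fun k hk => le_antisymm (not_lt.1 fun e => hk.2 m e hm)
      (not_lt.1 fun e => hm' k e hk.1)⟩
  choose ν hν hνu using h2
  have hνD : Df M ν := Df.of_iff (p := fun U m => Q' U m)
    (fun U m => ⟨by rintro rfl; exact hν U, fun e => (hνu U m e).symm⟩) hQ'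
  choose Φ hΦ using fun U : FinSub X => FinSub.exists_union U (F (μ U) (ν U))
  have hG : Df M fun U => F (μ U) (ν U) :=
    Df.comp (g := fun z : Nats M × Nats M => F z.1 z.2) hF
      (by fun_prop : Df M fun U : FinSub X => (μ U, ν U))
  refine ⟨Φ, Df.of_iff (p := fun U V => ∀ z, z ∈ V.1 ↔ z ∈ U.1 ∨ z ∈ (F (μ U) (ν U)).1)
    (fun U V => ⟨by rintro rfl; exact hΦ U, fun e => FinSub.ext fun z => by rw [hΦ, e]⟩)
    (by fun_prop), fun U => ⟨fun z hz => (hΦ U z).2 (Or.inl hz), ?_⟩⟩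
  obtain ⟨z, h3, h4⟩ := (hν U).1
  exact ⟨z, (hΦ U z).2 (Or.inr h3), h4⟩

/-- The iterates of a non-surjective injection at a point `F₀` outside its range are distinct. A
finite `U` containing all of them would have an infinite sequence of distinct subsets, contradicting
finiteness of its power set. -/
theorem exists_enlarges_of_not_dedekindFinite {X : M} (h : ¬ DedekindFinite (FinSub X)) :
    ∃ Φ : FinSub X → FinSub X, Df M Φ ∧ Enlarges Φ := by
  rw [dedekindFinite_iff] at h
  push Not at h
  obtain ⟨f, hf, hi, hs⟩ := h
  obtain ⟨F₀, hF₀⟩ := not_forall.1 hs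
  push Not at hF₀
  obtain ⟨it, hit, h0, h1⟩ := exists_iter hf
  have hD : Df M fun n => it n F₀ := Df.comp (g := fun z : Nats M × FinSub X => it z.1 z.2) hit
    (by fun_prop : Df M fun n : Nats M => (n, F₀))
  have hinj : ∀ n m : Nats M, it n F₀ = it m F₀ → n = m := by
    refine Nats.ind (p := fun n : Nats M => ∀ m : Nats M, it n F₀ = it m F₀ → n = m)
      (by fun_prop) (fun m hm => ?_) (fun n ih m hm => ?_)
    · rcases Nats.eq_zero_or_succ m with rfl | ⟨k, rfl⟩
      · rfl
      · rw [h0, h1] at hm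
        exact absurd hm.symm (hF₀ _)
    · rcases Nats.eq_zero_or_succ m with rfl | ⟨k, rfl⟩
      · rw [h0, h1] at hm
        exact absurd hm (hF₀ _)
      · rw [h1, h1] at hm
        rw [ih k (hi hm)]
  -- A singly indexed family suffices here, so the second index is a dummy.
  refine exists_enlarges_of_family (F := fun n _ => it n F₀) (by fun_prop) fun U => ?_
  by_contra hc
  push Not at hc
  obtain ⟨c, hc1, hc2⟩ := U.2.2.powerset
  refine hc1.not_injective (f := fun n => ⟨(it n F₀).1, (hc2 _).2 fun z hz => hc n 0 z hz⟩)
    (Df.of_cd (M := M) (by fun_prop : Df M fun n => (it n F₀).1)) fun m n e => ?_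
  exact hinj m n (Subtype.ext (El.val_congr e))

/-- A strictly increasing sequence of finite subsets. -/
theorem exists_strictMono_of_enlarges {X : M} {Φ : FinSub X → FinSub X} (hΦ : Df M Φ)
    (h : Enlarges Φ) : ∃ U : Nats M → FinSub X, Df M U ∧
      (∀ m n, m ≤ n → ∀ z, z ∈ (U m).1 → z ∈ (U n).1) ∧
      ∀ n, ∃ z, z ∈ (U n.succ).1 ∧ z ∉ (U n).1 := by
  obtain ⟨it, hit, h0, h1⟩ := exists_iter hΦ
  have hD : Df M fun n => it n ∅ := Df.comp (g := fun z : Nats M × FinSub X => it z.1 z.2) hit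
    (by fun_prop : Df M fun n : Nats M => (n, (∅ : FinSub X)))
  refine ⟨fun n => it n ∅, hD, ?_, fun n => ?_⟩
  · intro m n
    revert m
    refine Nats.ind (p := fun n : Nats M => ∀ m, m ≤ n → ∀ z, z ∈ (it m ∅).1 → z ∈ (it n ∅).1)
      (by fun_prop) (fun m hm z hz => ?_) (fun n ih m hm z hz => ?_) n
    · rwa [← le_antisymm hm (not_lt.1 (Nats.not_lt_zero m))]
    · rcases hm.lt_or_eq with hm | rfl
      · rw [h1]
        exact (h _).1 z (ih m (Nats.lt_succ.1 hm) z hz)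
      · exact hz
  · simp only [h1]
    exact (h _).2

/-- Along a strictly increasing sequence `U`, the map sending `U n` to `U (n + 1)` and fixing every
other finite set is injective and misses `U 0`. -/
theorem not_dedekindFinite_of_enlarges {X : M} {Φ : FinSub X → FinSub X} (hΦ : Df M Φ)
    (h : Enlarges Φ) : ¬ DedekindFinite (FinSub X) := by
  obtain ⟨U, hU, h1, h2⟩ := exists_strictMono_of_enlarges hΦ h
  have hlt : ∀ m n, m < n → U m ≠ U n := fun m n hmn e => by
    obtain ⟨z, h3, h4⟩ := h2 m
    exact h4 (e ▸ h1 m.succ n (Nats.succ_le.2 hmn) z h3)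
  have hinj : ∀ m n, U m = U n → m = n := fun m n e => by
    rcases lt_trichotomy m n with h | h | h
    · exact absurd e (hlt m n h)
    · exact h
    · exact absurd e.symm (hlt n m h)
  have key : ∀ F : FinSub X, ∃! G : FinSub X,
      (∃ n, F = U n ∧ G = U n.succ) ∨ ((∀ n, F ≠ U n) ∧ G = F) := by
    intro F
    by_cases hF : ∃ n, F = U n
    · obtain ⟨n, rfl⟩ := hF
      refine ⟨U n.succ, Or.inl ⟨n, rfl, rfl⟩, ?_⟩
      rintro G (⟨m, e1, e2⟩ | ⟨e, -⟩)
      · rw [e2, hinj _ _ e1]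
      · exact absurd rfl (e n)
    · push Not at hF
      refine ⟨F, Or.inr ⟨hF, rfl⟩, ?_⟩
      rintro G (⟨m, e1, e2⟩ | ⟨e, e1⟩)
      · exact absurd e1 (hF m)
      · exact e1
  choose g hg hgu using key
  rw [dedekindFinite_iff]
  intro hfin
  have hs := hfin g (Df.of_iff (p := fun F G => (∃ n, F = U n ∧ G = U n.succ) ∨
    ((∀ n, F ≠ U n) ∧ G = F)) (fun F G => ⟨by rintro rfl; exact hg F,
      fun e => (hgu F G e).symm⟩) (by fun_prop)) ?_
  · obtain ⟨F, hF⟩ := hs (U 0)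
    rcases hg F with ⟨n, e1, e2⟩ | ⟨e1, e2⟩
    · rw [hF] at e2
      exact Nats.succ_ne_zero n (hinj _ _ e2).symm
    · rw [hF] at e2
      exact e1 0 e2.symm
  · intro F G e
    rcases hg F with ⟨n, e1, e2⟩ | ⟨e1, e2⟩ <;> rcases hg G with ⟨m, e3, e4⟩ | ⟨e3, e4⟩
    · rw [e2, e4] at e
      rw [e1, e3, Nats.succ_inj.1 (hinj _ _ e)]
    · rw [e2, e4] at e
      exact absurd e.symm (e3 _)
    · rw [e2, e4] at e
      exact absurd e (e1 _)
    · rw [← e2, ← e4, e]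

end Finite

/-! ### Real and complex numbers -/

section Numbers

variable {M : Type u} [Membership M M] [ZF M] {R : M} [Field (El R)] [LinearOrder (El R)]
  [IsReals R] {α : Type*} [DefType M α]

instance : IsStrictOrderedRing (El R) := IsReals.toIsStrictOrderedRing
instance : IsOrderedRing (El R) := IsStrictOrderedRing.toIsOrderedRing
instance : IsOrderedAddMonoid (El R) := IsOrderedRing.toIsOrderedAddMonoid
instance : AddLeftMono (El R) := IsOrderedAddMonoid.toAddLeftMono
instance : AddRightMono (El R) := IsOrderedAddMonoid.toAddRightMono
instance : AddRightStrictMono (El R) := inferInstance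
instance : AddRightReflectLE (El R) := inferInstance
instance : AddLeftReflectLT (El R) := inferInstance
instance : AddRightReflectLT (El R) := inferInstance
instance : PosMulMono (El R) := inferInstance
instance : MulPosMono (El R) := inferInstance
instance : PosMulStrictMono (El R) := inferInstance
instance : MulPosStrictMono (El R) := inferInstance
instance : ZeroLEOneClass (El R) := inferInstance
instance : ExistsAddOfLE (El R) := inferInstance
instance : CharZero (El R) := inferInstance

namespace Df

@[fun_prop] theorem realAdd {f g : α → El R} (hf : Df M f) (hg : Df M g) :
    Df M fun x => f x + g x :=
  Df.comp (g := fun p : El R × El R => p.1 + p.2) (funInModel_iff.1 IsReals.add_inModel)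
    (hf.prodMk hg)

@[fun_prop] theorem realMul {f g : α → El R} (hf : Df M f) (hg : Df M g) :
    Df M fun x => f x * g x :=
  Df.comp (g := fun p : El R × El R => p.1 * p.2) (funInModel_iff.1 IsReals.mul_inModel)
    (hf.prodMk hg)

@[fun_prop] theorem realLe {f g : α → El R} (hf : Df M f) (hg : Df M g) :
    Df M fun x => f x ≤ g x :=
  Df.comp (g := fun p : El R × El R => p.1 ≤ p.2) (inModel_iff.1 IsReals.le_inModel)
    (hf.prodMk hg)

@[fun_prop] theorem realLt {f g : α → El R} (hf : Df M f) (hg : Df M g) :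
    Df M fun x => f x < g x := by
  simp only [← not_le]
  fun_prop

@[fun_prop] theorem realNeg {f : α → El R} (hf : Df M f) : Df M fun x => -f x :=
  of_iff (p := fun x y => f x + y = 0) (fun _ _ => neg_eq_iff_add_eq_zero) (by fun_prop)

@[fun_prop] theorem realSub {f g : α → El R} (hf : Df M f) (hg : Df M g) :
    Df M fun x => f x - g x := by
  simp only [sub_eq_add_neg]
  fun_prop

@[fun_prop] theorem realSq {f : α → El R} (hf : Df M f) : Df M fun x => f x ^ 2 := by
  simp only [sq]
  fun_prop

@[fun_prop] theorem realInv {f : α → El R} (hf : Df M f) : Df M fun x => (f x)⁻¹ := by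
  -- The first clause records the convention `0⁻¹ = 0`.
  refine of_iff (p := fun x y => (f x = 0 ∧ y = 0) ∨ f x * y = 1) (fun x y => ?_) (by fun_prop)
  by_cases h : f x = 0
  · simp [h, eq_comm]
  · simp only [h, false_and, false_or]
    constructor
    · rintro rfl
      exact mul_inv_cancel₀ h
    · exact fun e => (eq_inv_of_mul_eq_one_right e).symm

end Df

noncomputable instance : DefType M (Cx R) where
  cd z := cd (z.re, z.im)
  cd_injective z w h := by
    have := cd_inj.1 h
    exact QuadraticAlgebra.ext (congrArg Prod.fst this) (congrArg Prod.snd this)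
  relDef_range := DefType.relDef_of_iff (p := fun m => ∃ z : El R × El R, cd z = m)
    (by fun_prop) fun m => ⟨by rintro ⟨z, rfl⟩; exact ⟨_, rfl⟩, by
      rintro ⟨z, rfl⟩; exact ⟨⟨z.1, z.2⟩, rfl⟩⟩

instance : SetType M (Cx R) :=
  ⟨fun z => SetType.cd_eq_code (z.re, z.im), by
    obtain ⟨a, ha⟩ := SetType.exists_bound (M := M) (α := El R × El R)
    exact ⟨a, fun z => ha (z.re, z.im)⟩⟩

namespace Df

@[fun_prop] theorem cxMk {f g : α → El R} (hf : Df M f) (hg : Df M g) :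
    Df M fun x => (⟨f x, g x⟩ : Cx R) :=
  of_cd (hf.prodMk hg).cd

theorem cxPair {f : α → Cx R} (hf : Df M f) : Df M fun x => ((f x).re, (f x).im) := hf

@[fun_prop] theorem cxRe {f : α → Cx R} (hf : Df M f) : Df M fun x => (f x).re :=
  (cxPair hf).fst

@[fun_prop] theorem cxIm {f : α → Cx R} (hf : Df M f) : Df M fun x => (f x).im :=
  (cxPair hf).snd

theorem cx_of_re_im {f : α → Cx R} (hr : Df M fun x => (f x).re) (hi : Df M fun x => (f x).im) :
    Df M f := cxMk hr hi

@[fun_prop] theorem cxAdd {f g : α → Cx R} (hf : Df M f) (hg : Df M g) :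
    Df M fun x => f x + g x :=
  cx_of_re_im (by simp only [QuadraticAlgebra.re_add]; fun_prop)
    (by simp only [QuadraticAlgebra.im_add]; fun_prop)

@[fun_prop] theorem cxSub {f g : α → Cx R} (hf : Df M f) (hg : Df M g) :
    Df M fun x => f x - g x :=
  cx_of_re_im (by simp only [QuadraticAlgebra.re_sub]; fun_prop)
    (by simp only [QuadraticAlgebra.im_sub]; fun_prop)

@[fun_prop] theorem cxMul {f g : α → Cx R} (hf : Df M f) (hg : Df M g) :
    Df M fun x => f x * g x :=
  cx_of_re_im (by simp only [QuadraticAlgebra.re_mul]; fun_prop)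
    (by simp only [QuadraticAlgebra.im_mul]; fun_prop)

@[fun_prop] theorem cxStar {f : α → Cx R} (hf : Df M f) : Df M fun x => star (f x) :=
  cx_of_re_im (by simp only [QuadraticAlgebra.re_star]; fun_prop)
    (by simp only [QuadraticAlgebra.im_star]; fun_prop)

@[fun_prop] theorem absSq {f : α → Cx R} (hf : Df M f) : Df M fun x => absSq (f x) := by
  unfold ZFModel.absSq
  fun_prop

end Df

/-- A real number as a complex number. -/
def ofReal (r : El R) : Cx R := ⟨r, 0⟩

@[simp] theorem ofReal_re (r : El R) : (ofReal r).re = r := rfl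

@[simp] theorem ofReal_im (r : El R) : (ofReal r).im = 0 := rfl

@[fun_prop] theorem Df.ofReal {f : α → El R} (hf : Df M f) : Df M fun x => ofReal (f x) := by
  unfold ZFModel.ofReal
  fun_prop

theorem absSq_nonneg (z : Cx R) : 0 ≤ absSq z := by unfold absSq; positivity

@[simp] theorem absSq_zero : absSq (0 : Cx R) = 0 := by simp [absSq]

theorem absSq_mul (z w : Cx R) : absSq (z * w) = absSq z * absSq w := by
  simp only [absSq, QuadraticAlgebra.re_mul, QuadraticAlgebra.im_mul]; ring

theorem absSq_ofReal (r : El R) : absSq (ofReal r) = r ^ 2 := by simp [absSq]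

theorem absSq_eq_zero {z : Cx R} : absSq z = 0 ↔ z = 0 := by
  constructor
  · intro h
    unfold absSq at h
    have h1 : z.re ^ 2 = 0 := by nlinarith [sq_nonneg z.re, sq_nonneg z.im]
    have h2 : z.im ^ 2 = 0 := by nlinarith [sq_nonneg z.re, sq_nonneg z.im]
    exact QuadraticAlgebra.ext (pow_eq_zero_iff two_ne_zero |>.1 h1)
      (pow_eq_zero_iff two_ne_zero |>.1 h2)
  · rintro rfl
    simp

theorem absSq_add_le (z w : Cx R) : absSq (z + w) ≤ 2 * (absSq z + absSq w) := by
  simp only [absSq, QuadraticAlgebra.re_add, QuadraticAlgebra.im_add]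
  nlinarith [sq_nonneg (z.re - w.re), sq_nonneg (z.im - w.im)]

theorem mul_star_eq (z : Cx R) : z * star z = ofReal (absSq z) := by
  apply QuadraticAlgebra.ext
  · simp [absSq]; ring
  · simp; ring

theorem ofReal_mul_ofReal (r s : El R) : ofReal r * ofReal s = ofReal (r * s) := by
  apply QuadraticAlgebra.ext <;> simp

theorem exists_mul_eq_one {z : Cx R} (hz : z ≠ 0) : ∃ w, w * z = 1 := by
  have h : absSq z ≠ 0 := fun e => hz (absSq_eq_zero.1 e)
  refine ⟨ofReal (absSq z)⁻¹ * star z, ?_⟩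
  rw [mul_assoc, mul_comm (star z), mul_star_eq, ofReal_mul_ofReal, inv_mul_cancel₀ h]
  rfl

theorem ofReal_one : ofReal (1 : El R) = 1 := rfl

theorem star_ofReal (r : El R) : star (ofReal r) = ofReal r := by
  apply QuadraticAlgebra.ext <;> simp

theorem exists_isLUB {p : El R → Prop} (hp : Df M p) (h : ∃ x, p x) {b : El R}
    (hb : ∀ x, p x → x ≤ b) : ∃ s, (∀ x, p x → x ≤ s) ∧ ∀ c, (∀ x, p x → x ≤ c) → s ≤ c := by
  obtain ⟨s, h1, h2⟩ := IsReals.exists_isLUB {x : El R | p x} (inModel_iff.2 hp) h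
    ⟨b, fun x hx => hb x hx⟩
  exact ⟨s, fun x hx => h1 hx, fun c hc => h2 fun x hx => hc x hx⟩

/-- The infimum is the supremum of the lower bounds. It is stated with `ε` because that is how
near-minimisers are produced later. -/
theorem exists_isGLB {p : El R → Prop} (hp : Df M p) (h : ∃ x, p x) {b : El R}
    (hb : ∀ x, p x → b ≤ x) : ∃ s, (∀ x, p x → s ≤ x) ∧ ∀ ε, 0 < ε → ∃ x, p x ∧ x < s + ε := by
  obtain ⟨x₀, hx₀⟩ := h
  obtain ⟨s, h1, h2⟩ := exists_isLUB (p := fun y => ∀ x, p x → y ≤ x) (by fun_prop) ⟨b, hb⟩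
    fun y hy => hy x₀ hx₀
  refine ⟨s, fun x hx => h2 x fun y hy => hy x hx, fun ε hε => ?_⟩
  by_contra hc
  push Not at hc
  have := h1 (s + ε) hc
  linarith

/-- Square roots. -/
theorem exists_sq_eq {r : El R} (hr : 0 < r) : ∃ s, 0 < s ∧ s ^ 2 = r := by
  obtain ⟨s, h1, h2⟩ := exists_isLUB (p := fun y : El R => 0 ≤ y ∧ y ^ 2 ≤ r) (by fun_prop)
    ⟨0, le_rfl, by simpa using hr.le⟩ (b := r + 1) (fun x hx => by nlinarith [hx.1, hx.2])
  have hs0 : 0 ≤ s := h1 0 ⟨le_rfl, by simpa using hr.le⟩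
  have hle : r ≤ s ^ 2 := by
    by_contra hc
    push Not at hc
    -- With `h ≤ 1` one has `(s + h)^2 ≤ s^2 + h(2s + 1) ≤ r`, so `s` was not an upper bound.
    set h := min 1 ((r - s ^ 2) / (2 * s + 1)) with hh
    have hpos : 0 < h := lt_min one_pos (div_pos (by linarith) (by linarith))
    have hle1 : h ≤ 1 := min_le_left _ _
    have hle2 : h * (2 * s + 1) ≤ r - s ^ 2 := by
      rw [← le_div_iff₀ (by linarith)]
      exact min_le_right _ _
    have := h1 (s + h) ⟨by linarith, by nlinarith⟩
    linarith
  have hs : 0 < s := by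
    rcases hs0.lt_or_eq with h | h
    · exact h
    · rw [← h] at hle
      simp only [ne_eq, OfNat.ofNat_ne_zero, not_false_eq_true, zero_pow] at hle
      exact absurd hle (not_le.2 hr)
  refine ⟨s, hs, le_antisymm ?_ hle⟩
  by_contra hc
  push Not at hc
  -- This makes `(s - h)^2 = r + h^2 > r`, so `s - h` is a smaller upper bound.
  set h := (s ^ 2 - r) / (2 * s) with hh
  have hpos : 0 < h := div_pos (by linarith) (by linarith)
  have heq : h * (2 * s) = s ^ 2 - r := div_mul_cancel₀ _ (by positivity)
  have hlt : h < s := by nlinarith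
  have := h2 (s - h) fun y hy => by
    by_contra hy'
    push Not at hy'
    nlinarith [hy.1, hy.2]
  linarith

theorem sq_inj_of_pos {s t : El R} (hs : 0 < s) (ht : 0 < t) (h : s ^ 2 = t ^ 2) : s = t :=
  (sq_eq_sq₀ hs.le ht.le).1 h

variable (R) in
/-- A sequence of positive numbers tending to zero. -/
theorem exists_null_seq : ∃ δ : Nats M → El R, Df M δ ∧ (∀ n, 0 < δ n) ∧
    (∀ m n, m ≤ n → δ n ≤ δ m) ∧ ∀ ε, 0 < ε → ∃ n, δ n < ε := by
  obtain ⟨it, hit, h0, h1⟩ := exists_iter (M := M) (F := fun x : El R => x * 2⁻¹) (by fun_prop)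
  have hD : Df M fun n => it n 1 := Df.comp (g := fun z : Nats M × El R => it z.1 z.2) hit
    (by fun_prop : Df M fun n : Nats M => (n, (1 : El R)))
  have hpos : ∀ n, 0 < it n 1 := Nats.ind (p := fun n => 0 < it n 1) (by fun_prop)
    (by rw [h0]; exact one_pos) fun n h => by rw [h1]; positivity
  refine ⟨fun n => it n 1, hD, hpos, fun m n => ?_, fun ε hε => ?_⟩
  · refine Nats.ind (p := fun n => ∀ m, m ≤ n → it n 1 ≤ it m 1) (by fun_prop) (fun m hm => ?_)
      (fun n ih m hm => ?_) n m
    · rw [le_antisymm hm (not_lt.1 (Nats.not_lt_zero m))]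
    · rcases hm.lt_or_eq with hm | rfl
      · have e1 := ih m (Nats.lt_succ.1 hm)
        have e2 := hpos n
        rw [h1]
        linarith
      · exact le_rfl
  · by_contra hc
    push Not at hc
    obtain ⟨s, h2, h3⟩ := exists_isLUB (p := fun x : El R => ∀ n, x ≤ it n 1) (by fun_prop)
      ⟨ε, hc⟩ (b := it 0 1) fun x hx => hx 0
    have h4 : ∀ n, s ≤ it n 1 := fun n => h3 _ fun x hx => hx n
    -- The sequence is `2^(-n)`. Its lower bounds are closed under doubling, since `s` lies below
    -- the next term, which is half of the present one. Hence `2s ≤ s`, against `0 < ε ≤ s`.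
    have h5 := h2 (2 * s) fun n => by
      have := h4 n.succ
      rw [h1] at this
      linarith
    have h6 := h2 ε hc
    linarith

/-- Plays the role of letting `ε` tend to `0`: the value `ε = a / (2(|C| + 1))` would give `a ≤ a /
2`. -/
theorem nonpos_of_forall_le_mul {a C : El R} (h : ∀ ε, 0 < ε → a ≤ C * ε) : a ≤ 0 := by
  by_contra ha
  push Not at ha
  have hC : 0 < |C| + 1 := by positivity
  have h1 := h (a / (2 * (|C| + 1))) (by positivity)
  have h2 : C * (a / (2 * (|C| + 1))) ≤ (|C| + 1) * (a / (2 * (|C| + 1))) :=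
    mul_le_mul_of_nonneg_right (by linarith [le_abs_self C]) (by positivity)
  have h3 : (|C| + 1) * (a / (2 * (|C| + 1))) = a / 2 := by field_simp
  linarith

end Numbers

namespace InnerSpace

variable {M : Type u} [Membership M M] [ZF M] {R : M} [Field (El R)] [LinearOrder (El R)]
  [IsReals R] {α : Type*} [DefType M α] {H : InnerSpace R}

/-! ### Definability of the operations -/

@[fun_prop] theorem df_add {f g : α → H.Vec} (hf : Df M f) (hg : Df M g) :
    Df M fun x => f x + g x :=
  Df.comp (g := fun p : H.Vec × H.Vec => p.1 + p.2) (funInModel_iff.1 H.add_inModel)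
    (hf.prodMk hg)

@[fun_prop] theorem df_smul {f : α → Cx R} {g : α → H.Vec} (hf : Df M f) (hg : Df M g) :
    Df M fun x => f x • g x :=
  Df.comp (g := fun p : Cx R × H.Vec => p.1 • p.2) (funInModel_iff.1 H.smul_inModel)
    (hf.prodMk hg)

@[fun_prop] theorem df_inner {f g : α → H.Vec} (hf : Df M f) (hg : Df M g) :
    Df M fun x => H.inner (f x) (g x) :=
  Df.comp (g := fun p : H.Vec × H.Vec => H.inner p.1 p.2) (funInModel_iff.1 H.inner_inModel)
    (hf.prodMk hg)

@[fun_prop] theorem df_neg {f : α → H.Vec} (hf : Df M f) : Df M fun x => -f x :=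
  Df.of_iff (p := fun x y => f x + y = 0) (fun _ _ => neg_eq_iff_add_eq_zero) (by fun_prop)

@[fun_prop] theorem df_sub {f g : α → H.Vec} (hf : Df M f) (hg : Df M g) :
    Df M fun x => f x - g x := by
  simp only [sub_eq_add_neg]
  fun_prop

@[fun_prop] theorem df_normSq {f : α → H.Vec} (hf : Df M f) : Df M fun x => H.normSq (f x) := by
  unfold normSq
  fun_prop

/-! ### Algebra of the inner product -/

variable (x y z : H.Vec) (c : Cx R)

theorem inner_add_right : H.inner x (y + z) = H.inner x y + H.inner x z := by
  rw [← H.inner_conj_symm, H.inner_add_left, star_add, H.inner_conj_symm, H.inner_conj_symm]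

theorem inner_smul_right : H.inner x (c • y) = star c * H.inner x y := by
  rw [← H.inner_conj_symm, H.inner_smul_left, star_mul, H.inner_conj_symm, mul_comm]

@[simp] theorem inner_zero_left : H.inner 0 x = 0 := by
  have := H.inner_smul_left 0 0 x
  rwa [zero_smul, zero_mul] at this

@[simp] theorem inner_zero_right : H.inner x 0 = 0 := by
  rw [← H.inner_conj_symm, inner_zero_left, star_zero]

theorem inner_neg_left : H.inner (-x) y = -H.inner x y := by
  rw [eq_neg_iff_add_eq_zero, ← H.inner_add_left, neg_add_cancel, inner_zero_left]

theorem inner_neg_right : H.inner x (-y) = -H.inner x y := by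
  rw [eq_neg_iff_add_eq_zero, ← inner_add_right, neg_add_cancel, inner_zero_right]

theorem inner_sub_left : H.inner (x - y) z = H.inner x z - H.inner y z := by
  rw [sub_eq_add_neg, H.inner_add_left, inner_neg_left, sub_eq_add_neg]

variable {x y} in
theorem inner_eq_zero_symm (h : H.inner x y = 0) : H.inner y x = 0 := by
  rw [← H.inner_conj_symm, h, star_zero]

theorem inner_self : H.inner x x = ofReal (H.normSq x) := by
  refine QuadraticAlgebra.ext rfl ?_
  have := congrArg QuadraticAlgebra.im (H.inner_conj_symm x x)
  rw [QuadraticAlgebra.im_star] at this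
  simp only [ofReal_im]
  linarith

theorem normSq_nonneg : 0 ≤ H.normSq x := H.inner_self_nonneg x

variable {x} in
theorem normSq_eq_zero : H.normSq x = 0 ↔ x = 0 := by
  constructor
  · intro h
    apply H.inner_self_eq_zero
    rw [inner_self, h]
    rfl
  · rintro rfl
    simp [normSq]

variable {x} in
theorem normSq_pos (h : x ≠ 0) : 0 < H.normSq x :=
  lt_of_le_of_ne (normSq_nonneg x) fun e => h (normSq_eq_zero.1 e.symm)

theorem normSq_add : H.normSq (x + y) = H.normSq x + H.normSq y + 2 * (H.inner x y).re := by
  have : (H.inner y x).re = (H.inner x y).re := by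
    rw [← H.inner_conj_symm]; simp
  simp only [normSq, H.inner_add_left, inner_add_right, QuadraticAlgebra.re_add, this]
  ring

theorem normSq_neg : H.normSq (-x) = H.normSq x := by
  simp only [normSq, inner_neg_left, inner_neg_right, neg_neg]

theorem normSq_sub : H.normSq (x - y) = H.normSq x + H.normSq y - 2 * (H.inner x y).re := by
  rw [sub_eq_add_neg, normSq_add, normSq_neg, inner_neg_right, QuadraticAlgebra.re_neg]
  ring

theorem normSq_sub_comm : H.normSq (x - y) = H.normSq (y - x) := by rw [← neg_sub, normSq_neg]

theorem normSq_smul : H.normSq (c • x) = absSq c * H.normSq x := by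
  have : H.inner (c • x) (c • x) = ofReal (absSq c * H.normSq x) := by
    rw [H.inner_smul_left, inner_smul_right, ← mul_assoc, mul_star_eq, inner_self,
      ofReal_mul_ofReal]
  rw [normSq, this]
  rfl

/-- A substitute for the triangle inequality that avoids square roots, obtained from the
parallelogram identity at the cost of a factor `2`. -/
theorem normSq_add_le : H.normSq (x + y) ≤ 2 * (H.normSq x + H.normSq y) := by
  have h1 := normSq_add x y
  have h2 := normSq_sub x y
  have h3 := normSq_nonneg (x - y)
  linarith

theorem normSq_sub_le : H.normSq (x - z) ≤ 2 * (H.normSq (x - y) + H.normSq (y - z)) := by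
  have := normSq_add_le (x - y) (y - z)
  rwa [sub_add_sub_cancel] at this

variable {x z} in
/-- Almost minimal vectors are almost orthogonal. -/
theorem absSq_inner_le {d ε : El R} (h : ∀ c : Cx R, d ≤ H.normSq (x - c • z))
    (hx : H.normSq x ≤ d + ε) : absSq (H.inner x z) ≤ ε * H.normSq z := by
  by_cases hz : z = 0
  · subst hz
    simp [normSq]
  have hN := normSq_pos hz
  -- The coefficient of the projection of `x` to the line through `z`; subtracting that projection
  -- lowers `‖x‖^2` by `|⟨x, z⟩|^2 / ‖z‖^2`.
  have h1 := h (ofReal (H.normSq z)⁻¹ * H.inner x z)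
  have h2 : H.normSq (x - (ofReal (H.normSq z)⁻¹ * H.inner x z) • z) =
      H.normSq x - (H.normSq z)⁻¹ * absSq (H.inner x z) := by
    have e : (H.inner x ((ofReal (H.normSq z)⁻¹ * H.inner x z) • z)).re =
        (H.normSq z)⁻¹ * absSq (H.inner x z) := by
      rw [inner_smul_right, star_mul, star_ofReal, mul_comm (star _), mul_assoc,
        mul_comm (star _), mul_star_eq, ofReal_mul_ofReal]
      rfl
    rw [normSq_sub, e, normSq_smul, absSq_mul, absSq_ofReal]
    field_simp
    ring
  rw [h2] at h1
  have h3 : (H.normSq z)⁻¹ * absSq (H.inner x z) ≤ ε := by linarith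
  rwa [inv_mul_le_iff₀ hN, mul_comm] at h3

theorem cauchy_schwarz : absSq (H.inner x y) ≤ H.normSq x * H.normSq y :=
  absSq_inner_le (d := 0) (fun _ => normSq_nonneg _) (by simp)

/-! ### Closed sets and completeness -/

/-- `x` is in the closure of `s`. -/
def Near (s : H.Vec → Prop) (x : H.Vec) : Prop := ∀ ε, 0 < ε → ∃ y, s y ∧ H.normSq (x - y) < ε

omit x y z c

theorem Near.mono {s t : H.Vec → Prop} {x : H.Vec} (h : Near s x) (hst : ∀ y, s y → t y) :
    Near t x := fun ε hε => (h ε hε).imp fun _ hy => ⟨hst _ hy.1, hy.2⟩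

theorem near_iff {s : Set H.Vec} {x : H.Vec} :
    Near (· ∈ s) x ↔ ∀ ε : El R, 0 < ε → ∃ y ∈ s, H.normSq (x - y) < ε ^ 2 := by
  refine ⟨fun h ε hε => h _ (by positivity), fun h ε hε => ?_⟩
  obtain ⟨η, hη, rfl⟩ := exists_sq_eq hε
  exact h η hη

theorem isClosedSet_iff {s : Set H.Vec} : H.IsClosedSet s ↔ ∀ x, Near (· ∈ s) x → x ∈ s := by
  simp only [near_iff]
  rfl

theorem Near.near {s : H.Vec → Prop} {x : H.Vec} (h : Near (Near s) x) : Near s x := by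
  intro ε hε
  obtain ⟨y, hy, h1⟩ := h (ε / 4) (by positivity)
  obtain ⟨z, hz, h2⟩ := hy (ε / 4) (by positivity)
  exact ⟨z, hz, by linarith [normSq_sub_le x y z]⟩

theorem eq_of_near {x y : H.Vec} (h : ∀ ε, 0 < ε → H.normSq (x - y) ≤ ε) : x = y := by
  have : H.normSq (x - y) ≤ 0 := nonpos_of_forall_le_mul (C := 1) fun ε hε => by
    rw [one_mul]; exact h ε hε
  exact sub_eq_zero.1 (normSq_eq_zero.1 (le_antisymm this (normSq_nonneg _)))

/-- The choice-free form of completeness. `A ε` is the set of all solutions up to error `ε`; the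
closures of the `A (δ n)` decrease and their diameters tend to `0`, so no sequence of approximate
solutions has to be selected. -/
theorem IsSigmaComplete.exists_near (hH : H.IsSigmaComplete) {A : El R → H.Vec → Prop}
    (hA : Df M fun z : El R × H.Vec => A z.1 z.2) (hne : ∀ ε, 0 < ε → ∃ x, A ε x)
    (hmono : ∀ ε ε', 0 < ε → ε ≤ ε' → ∀ x, A ε x → A ε' x) {C : El R} (hC : 0 < C)
    (hd : ∀ ε x y, 0 < ε → A ε x → A ε y → H.normSq (x - y) ≤ C * ε) :
    ∃ x, ∀ ε, 0 < ε → Near (A ε) x := by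
  obtain ⟨δ, hδ, h1, h2, h3⟩ := exists_null_seq R
  have hB : Df M fun p : Nats M × H.Vec => Near (A (δ p.1)) p.2 := by
    unfold Near
    have : Df M fun w : ((Nats M × H.Vec) × El R) × H.Vec => A (δ w.1.1.1) w.2 :=
      Df.comp (g := fun z : El R × H.Vec => A z.1 z.2) hA
        (by fun_prop : Df M fun w : ((Nats M × H.Vec) × El R) × H.Vec => (δ w.1.1.1, w.2))
    fun_prop
  suffices h : ∃ x, ∀ n, x ∈ {x | Near (A (δ n)) x} by
    obtain ⟨x, hx⟩ := h
    refine ⟨x, fun ε hε => ?_⟩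
    obtain ⟨n, hn⟩ := h3 ε hε
    exact Near.mono (hx n) (hmono _ _ (h1 n) hn.le)
  refine hH (fun n => {x | Near (A (δ n)) x}) (inModel_iff.2 hB) ?_ ?_ ?_ ?_
  · intro n
    obtain ⟨x, hx⟩ := hne (δ n) (h1 n)
    exact ⟨x, fun ε hε => ⟨x, hx, by simpa [normSq] using hε⟩⟩
  · intro n
    rw [isClosedSet_iff]
    intro x hx
    exact Near.near hx
  · intro m n hmn x hx
    exact Near.mono hx (hmono _ _ (h1 n) (h2 m n (Or.inl hmn)))
  · intro ε hε
    -- Moving `x` and `y` to points of `A (δ n)` costs `2δ + 2(2Cδ + 2δ) = (6 + 4C)δ` by two uses of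
    -- `normSq_sub_le`.
    obtain ⟨n, hn⟩ := h3 (ε ^ 2 / (6 + 4 * C)) (by positivity)
    rw [lt_div_iff₀ (by positivity)] at hn
    refine ⟨n, fun x hx y hy => lt_of_le_of_lt ?_ hn⟩
    obtain ⟨x', hx', h4⟩ := hx (δ n) (h1 n)
    obtain ⟨y', hy', h5⟩ := hy (δ n) (h1 n)
    have h6 := normSq_sub_le x x' y
    have h7 := normSq_sub_le x' y' y
    have h8 := hd _ x' y' (h1 n) hx' hy'
    rw [normSq_sub_comm y y'] at h5
    linarith

/-! ### Orthogonal projection -/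

/-- A closed subspace of the model. -/
structure ClosedSubspace (K : Submodule (Cx R) H.Vec) : Prop where
  df : Df M fun x => x ∈ K
  closed : ∀ x, Near (· ∈ K) x → x ∈ K

/-- The classical nearest-point argument: near-minimisers of the distance from `x` to `K` cluster by
the parallelogram law, and a point approximated by them is orthogonal by `absSq_inner_le`. -/
theorem exists_projection (hH : H.IsSigmaComplete) {K : Submodule (Cx R) H.Vec}
    (hK : ClosedSubspace K) (x : H.Vec) : ∃ y, y ∈ K ∧ ∀ z, z ∈ K → H.inner (x - y) z = 0 := by
  have hKd := hK.df
  obtain ⟨d, hd1, hd2⟩ := exists_isGLB (p := fun r => ∃ y, y ∈ K ∧ r = H.normSq (x - y))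
    (by fun_prop) ⟨_, 0, K.zero_mem, rfl⟩ (b := 0) (by
      rintro _ ⟨y, -, rfl⟩; exact normSq_nonneg _)
  have hd1' : ∀ y, y ∈ K → d ≤ H.normSq (x - y) := fun y hy => hd1 _ ⟨y, hy, rfl⟩
  suffices h : ∃ y, ∀ ε, 0 < ε → Near (fun y => y ∈ K ∧ H.normSq (x - y) < d + ε) y by
    obtain ⟨y, hy⟩ := h
    refine ⟨y, hK.closed y ((hy 1 one_pos).mono fun _ h => h.1), fun z hz => ?_⟩
    rw [← absSq_eq_zero]
    refine le_antisymm (nonpos_of_forall_le_mul (C := 4 * H.normSq z) fun ε hε => ?_)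
      (absSq_nonneg _)
    obtain ⟨w, ⟨hw1, hw2⟩, hw3⟩ := hy ε hε ε hε
    have h1 : absSq (H.inner (x - w) z) ≤ ε * H.normSq z :=
      absSq_inner_le (d := d) (fun c => by
        rw [sub_sub]
        exact hd1' _ (K.add_mem hw1 (K.smul_mem c hz))) hw2.le
    have h2 := cauchy_schwarz (w - y) z
    have h3 := absSq_add_le (H.inner (x - w) z) (H.inner (w - y) z)
    rw [← H.inner_add_left, sub_add_sub_cancel] at h3
    rw [normSq_sub_comm] at hw3
    nlinarith [normSq_nonneg z]
  refine hH.exists_near (A := fun ε y => y ∈ K ∧ H.normSq (x - y) < d + ε)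
    (by fun_prop) (fun ε hε => by
      obtain ⟨_, ⟨y, hy, rfl⟩, h⟩ := hd2 ε hε
      exact ⟨y, hy, h⟩) (fun ε ε' _ h y hy => ⟨hy.1, by linarith [hy.2]⟩)
    (C := 4) (by norm_num) ?_
  -- The midpoint of `y` and `z` lies in `K`, so `‖y - z‖^2` is at most `2(d + ε) + 2(d + ε) - 4d =
  -- 4ε`.
  · rintro ε y z - ⟨hy1, hy2⟩ ⟨hz1, hz2⟩
    have hm : d ≤ H.normSq (x - (ofReal 2⁻¹ : Cx R) • (y + z)) :=
      hd1' _ (K.smul_mem _ (K.add_mem hy1 hz1))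
    have e1 : (ofReal 2 : Cx R) • (x - (ofReal 2⁻¹ : Cx R) • (y + z)) = (x - y) + (x - z) := by
      rw [smul_sub, smul_smul, ofReal_mul_ofReal, mul_inv_cancel₀ two_ne_zero, ofReal_one,
        one_smul, show (ofReal 2 : Cx R) = 1 + 1 by
          apply QuadraticAlgebra.ext
          · simp only [ofReal_re, QuadraticAlgebra.re_add, QuadraticAlgebra.re_one]; norm_num
          · simp only [ofReal_im, QuadraticAlgebra.im_add, QuadraticAlgebra.im_one, add_zero], add_smul, one_smul]
      abel
    have h1 := normSq_smul (x - (ofReal 2⁻¹ : Cx R) • (y + z)) (ofReal 2 : Cx R)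
    rw [e1, absSq_ofReal] at h1
    have h2 := normSq_add (x - y) (x - z)
    have h3 := normSq_sub (x - y) (x - z)
    rw [sub_sub_sub_cancel_left, normSq_sub_comm] at h3
    linarith

theorem exists_orthogonal (hH : H.IsSigmaComplete) {K : Submodule (Cx R) H.Vec}
    (hK : ClosedSubspace K) (hne : K ≠ ⊤) : ∃ w, w ≠ 0 ∧ ∀ z, z ∈ K → H.inner w z = 0 := by
  obtain ⟨x, hx⟩ : ∃ x, x ∉ K := by
    by_contra hc
    push Not at hc
    exact hne (Submodule.eq_top_iff'.2 hc)
  obtain ⟨y, hy, h⟩ := exists_projection hH hK x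
  exact ⟨x - y, fun e => hx (sub_eq_zero.1 e ▸ hy), h⟩

/-- An orthogonal sequence can be normalised. -/
theorem hasOrthonormalSeq_of_orthogonal {w : Nats M → H.Vec} (hw : Df M w) (h0 : ∀ n, w n ≠ 0)
    (h : ∀ m n, m < n → H.inner (w m) (w n) = 0) : H.HasOrthonormalSeq := by
  choose t ht ht' using fun n => exists_sq_eq (normSq_pos (h0 n))
  have htD : Df M t := Df.of_iff (p := fun n y => 0 < y ∧ y ^ 2 = H.normSq (w n))
    (fun n y => ⟨by rintro rfl; exact ⟨ht n, ht' n⟩,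
      fun e => sq_inj_of_pos (ht n) e.1 ((ht' n).trans e.2.symm)⟩) (by fun_prop)
  refine ⟨fun n => ofReal (t n)⁻¹ • w n, funInModel_iff.2 (by fun_prop), fun n => ?_,
    fun m n hmn => ?_⟩
  · have hn := (ht n).ne'
    rw [inner_self, normSq_smul, absSq_ofReal, ← ht', inv_pow, inv_mul_cancel₀ (by positivity)]
    rfl
  · rw [H.inner_smul_left, inner_smul_right]
    rcases lt_or_gt_of_ne hmn with h' | h'
    · rw [h _ _ h']; simp
    · rw [inner_eq_zero_symm (h _ _ h')]; simp

end InnerSpace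

namespace InnerSpace

variable {M : Type u} [Membership M M] [ZF M] {R : M} [Field (El R)] [LinearOrder (El R)]
  [IsReals R] {H : InnerSpace R}

/-! ### The shift of an orthonormal sequence -/

section Shift

variable (e : Nats M → H.Vec)

/-- `(a, b)` is orthogonal to all `(e n, e (n + 1))` and to all `(z, z)` with `z` orthogonal to
the sequence `e`. -/
def ShiftPerp (a b : H.Vec) : Prop :=
  (∀ n, H.inner (e n) a + H.inner (e n.succ) b = 0) ∧
    ∀ z, (∀ n, H.inner z (e n) = 0) → H.inner z a + H.inner z b = 0

/-- The graph of the isometry which maps `e n` to `e (n + 1)` and fixes the vectors orthogonal to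
the sequence `e`. -/
def ShiftRel (x y : H.Vec) : Prop :=
  ∀ a b, ShiftPerp e a b → H.inner x a + H.inner y b = 0

variable {e}

theorem df_shiftRel (he : Df M e) : Df M fun z : H.Vec × H.Vec => ShiftRel e z.1 z.2 := by
  unfold ShiftRel ShiftPerp
  fun_prop

theorem ShiftRel.add {x y x' y' : H.Vec} (h : ShiftRel e x y) (h' : ShiftRel e x' y') :
    ShiftRel e (x + x') (y + y') := fun a b hab => by
  rw [H.inner_add_left, H.inner_add_left, add_add_add_comm, h a b hab, h' a b hab, add_zero]

theorem ShiftRel.smul {x y : H.Vec} (h : ShiftRel e x y) (c : Cx R) :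
    ShiftRel e (c • x) (c • y) := fun a b hab => by
  rw [H.inner_smul_left, H.inner_smul_left, ← mul_add, h a b hab, mul_zero]

theorem ShiftRel.sub {x y x' y' : H.Vec} (h : ShiftRel e x y) (h' : ShiftRel e x' y') :
    ShiftRel e (x - x') (y - y') := fun a b hab => by
  rw [inner_sub_left, inner_sub_left, sub_add_sub_comm, h a b hab, h' a b hab, sub_zero]

variable (h1 : ∀ n, H.inner (e n) (e n) = 1) (h2 : ∀ m n, m ≠ n → H.inner (e m) (e n) = 0)

include h1 h2

/-- Test against the pair `(e m, -e (m + 1))`, which orthonormality places in `ShiftPerp`. The next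
lemmas likewise each exhibit one suitable test pair. -/
theorem ShiftRel.inner_seq {x y : H.Vec} (h : ShiftRel e x y) (m : Nats M) :
    H.inner x (e m) = H.inner y (e m.succ) := by
  have := h (e m) (-e m.succ) ⟨fun n => ?_, fun z hz => ?_⟩
  · rwa [inner_neg_right, ← sub_eq_add_neg, sub_eq_zero] at this
  · rw [inner_neg_right, ← sub_eq_add_neg, sub_eq_zero]
    by_cases hmn : n = m
    · rw [hmn, h1, h1]
    · rw [h2 _ _ hmn, h2 _ _ fun e => hmn (Nats.succ_inj.1 e)]
  · rw [inner_neg_right, hz, hz]; simp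

theorem ShiftRel.inner_fixed {x y z : H.Vec} (h : ShiftRel e x y)
    (hz : ∀ n, H.inner z (e n) = 0) : H.inner x z = H.inner y z := by
  have := h z (-z) ⟨fun n => ?_, fun w _ => ?_⟩
  · rwa [inner_neg_right, ← sub_eq_add_neg, sub_eq_zero] at this
  · rw [inner_neg_right, inner_eq_zero_symm (hz n), inner_eq_zero_symm (hz n.succ)]; simp
  · rw [inner_neg_right, add_neg_cancel]

/-- If `(a, b)` lies in the graph, then `inner_seq` and `inner_fixed` say precisely that `(a, -b)`
is a test pair. This makes the relation isometric, and hence single-valued. -/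
theorem ShiftRel.inner_eq {x y a b : H.Vec} (h : ShiftRel e x y) (h' : ShiftRel e a b) :
    H.inner x a = H.inner y b := by
  have := h a (-b) ⟨fun n => ?_, fun z hz => ?_⟩
  · rwa [inner_neg_right, ← sub_eq_add_neg, sub_eq_zero] at this
  · rw [inner_neg_right, ← sub_eq_add_neg, sub_eq_zero, ← H.inner_conj_symm,
      h'.inner_seq h1 h2 n, H.inner_conj_symm]
  · rw [inner_neg_right, ← sub_eq_add_neg, sub_eq_zero, ← H.inner_conj_symm,
      h'.inner_fixed h1 h2 hz, H.inner_conj_symm]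

theorem ShiftRel.normSq_eq {x y : H.Vec} (h : ShiftRel e x y) : H.normSq x = H.normSq y := by
  rw [normSq, h.inner_eq h1 h2 h, normSq]

theorem ShiftRel.unique {x y y' : H.Vec} (h : ShiftRel e x y) (h' : ShiftRel e x y') : y = y' := by
  have := (h.sub h').normSq_eq h1 h2
  rw [sub_self, normSq_eq_zero.2 rfl, eq_comm, normSq_eq_zero] at this
  exact sub_eq_zero.1 this

theorem ShiftRel.inner_zero_eq {x y : H.Vec} (h : ShiftRel e x y) : H.inner y (e 0) = 0 := by
  have := h 0 (e 0) ⟨fun n => ?_, fun z hz => ?_⟩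
  · rwa [inner_zero_right, zero_add] at this
  · rw [inner_zero_right, zero_add, h2 _ _ (Nats.succ_ne_zero n)]
  · rw [inner_zero_right, zero_add, hz]

/-- The domain is closed because the graph is closed and isometric. It contains every `e n`, so a
vector `w` orthogonal to it is orthogonal to the sequence; then `(w, w)` is in the graph, `w` is in
the domain, and `w = 0`. -/
theorem exists_shiftRel (hH : H.IsSigmaComplete) (he : Df M e) (x : H.Vec) :
    ∃ y, ShiftRel e x y := by
  have hG := df_shiftRel he
  let D : Submodule (Cx R) H.Vec :=
    { carrier := {x | ∃ y, ShiftRel e x y}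
      add_mem' := fun ⟨y, hy⟩ ⟨y', hy'⟩ => ⟨y + y', hy.add hy'⟩
      zero_mem' := ⟨0, fun a b _ => by simp⟩
      smul_mem' := fun c _ ⟨y, hy⟩ => ⟨c • y, hy.smul c⟩ }
  have hD : ClosedSubspace D := by
    refine ⟨?_, fun x hx => ?_⟩
    · change Df M fun x : H.Vec => ∃ y, ShiftRel e x y
      fun_prop
    -- The image of a limit point `x` is sought among the images of points close to `x`; by isometry
    -- these images are close to one another.
    · obtain ⟨y, hy⟩ : ∃ y, ∀ ε, 0 < ε →
          Near (fun y => ∃ x', ShiftRel e x' y ∧ H.normSq (x - x') < ε) y := by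
        refine hH.exists_near (A := fun ε y => ∃ x', ShiftRel e x' y ∧ H.normSq (x - x') < ε) ?_
          ?_ ?_ (C := 4) (by norm_num) ?_
        · have : Df M fun w : (El R × H.Vec) × H.Vec => ShiftRel e w.2 w.1.2 :=
            Df.comp (g := fun z : H.Vec × H.Vec => ShiftRel e z.1 z.2) hG
              (by fun_prop : Df M fun w : (El R × H.Vec) × H.Vec => (w.2, w.1.2))
          fun_prop
        · intro ε hε
          obtain ⟨x', ⟨y, hy⟩, h⟩ := hx ε hε
          exact ⟨y, x', hy, h⟩
        · rintro ε ε' - hle y ⟨x', h, h'⟩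
          exact ⟨x', h, h'.trans_le hle⟩
        · rintro ε y y' - ⟨x₁, h, h'⟩ ⟨x₂, h'', h'''⟩
          rw [← (h.sub h'').normSq_eq h1 h2]
          have := normSq_sub_le x₁ x x₂
          rw [normSq_sub_comm x₁ x] at this
          linarith
      refine ⟨y, fun a b hab => ?_⟩
      rw [← absSq_eq_zero]
      refine le_antisymm (nonpos_of_forall_le_mul (C := 2 * (H.normSq a + H.normSq b))
        fun ε hε => ?_) (absSq_nonneg _)
      obtain ⟨y', ⟨x', h, h'⟩, h''⟩ := hy ε hε ε hε
      have e1 : H.inner x a + H.inner y b = H.inner (x - x') a + H.inner (y - y') b := by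
        rw [inner_sub_left, inner_sub_left, sub_add_sub_comm, h a b hab, sub_zero]
      rw [e1]
      have h3 := absSq_add_le (H.inner (x - x') a) (H.inner (y - y') b)
      have h4 := cauchy_schwarz (x - x') a
      have h5 := cauchy_schwarz (y - y') b
      have h6 := mul_le_mul_of_nonneg_right h'.le (normSq_nonneg a)
      have h7 := mul_le_mul_of_nonneg_right h''.le (normSq_nonneg b)
      linarith
  by_contra hx
  have hne : D ≠ ⊤ := fun h => hx (show x ∈ D from h ▸ Submodule.mem_top)
  obtain ⟨w, hw, hwD⟩ := exists_orthogonal hH hD hne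
  have hwe : ∀ n, H.inner w (e n) = 0 := fun n =>
    hwD (e n) ⟨e n.succ, fun a b hab => hab.1 n⟩
  have := hwD w ⟨w, fun a b hab => hab.2 w hwe⟩
  exact hw (H.inner_self_eq_zero w this)

end Shift

theorem hilbertDedekindInfinite_of_hasOrthonormalSeq (hH : H.IsSigmaComplete)
    (h : H.HasOrthonormalSeq) : H.HilbertDedekindInfinite := by
  obtain ⟨e, he, h1, h2⟩ := h
  have he := funInModel_iff.1 he
  choose V hV using exists_shiftRel h1 h2 hH he
  have hVD : Df M V := Df.of_iff (p := fun x y => ShiftRel e x y)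
    (fun x y => ⟨by rintro rfl; exact hV x, fun h => (hV x).unique h1 h2 h⟩) (df_shiftRel he)
  let L : H.Vec →ₗ[Cx R] H.Vec :=
    { toFun := V
      map_add' := fun x y => (hV _).unique h1 h2 ((hV x).add (hV y))
      map_smul' := fun c x => (hV _).unique h1 h2 ((hV x).smul c) }
  have hinj : Function.Injective L := by
    rw [← LinearMap.ker_eq_bot, LinearMap.ker_eq_bot']
    intro x hx
    have := (hV x).normSq_eq h1 h2
    rw [show V x = 0 from hx, normSq_eq_zero.2 rfl] at this
    exact normSq_eq_zero.1 this
  refine ⟨LinearMap.range L, inModel_iff.2 ?_, fun htop => ?_, LinearEquiv.ofInjective L hinj,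
    funInModel_iff.2 ?_, fun x => ?_⟩
  · refine Df.congr (p := fun y => ∃ x, V x = y) (by fun_prop) fun y => Iff.rfl
  · obtain ⟨x, hx⟩ : e 0 ∈ LinearMap.range L := htop ▸ Submodule.mem_top
    have := (hV x).inner_zero_eq h1 h2
    rw [show V x = e 0 from hx, h1] at this
    exact one_ne_zero this
  · exact hVD
  · exact ((hV x).normSq_eq h1 h2).symm

/-! ### From an isometry onto a proper subspace to a surjection with a kernel -/

/-- The surjection is the adjoint of the isometry `J`: `T x` is the unique `y` for which `x - J y`
is orthogonal to the range. It is a contraction, inverts `J` on the left, and kills the nonzero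
orthogonal complement of `K`. -/
theorem hilbertDuallyDedekindInfinite_of_hilbertDedekindInfinite (hH : H.IsSigmaComplete)
    (h : H.HilbertDedekindInfinite) : H.HilbertDuallyDedekindInfinite := by
  obtain ⟨K, hK, hne, V, hV, hiso⟩ := h
  obtain ⟨J, hJ, hJK, hKJ, hJiso⟩ : ∃ J : H.Vec →ₗ[Cx R] H.Vec, (Df M fun x => J x) ∧
      (∀ x, J x ∈ K) ∧ (∀ z, z ∈ K → ∃ x, J x = z) ∧ ∀ x, H.normSq (J x) = H.normSq x :=
    ⟨K.subtype ∘ₗ V.toLinearMap, funInModel_iff.1 hV, fun x => (V x).2,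
      fun z hz => ⟨V.symm ⟨z, hz⟩, congrArg Subtype.val (V.apply_symm_apply ⟨z, hz⟩)⟩, hiso⟩
  clear hV hiso V
  -- `K` is only assumed to be a linear subspace; as an isometric image of the complete space `H` it
  -- is closed.
  have hKc : ClosedSubspace K := by
    refine ⟨inModel_iff.1 hK, fun x hx => ?_⟩
    obtain ⟨y, hy⟩ : ∃ y, ∀ ε, 0 < ε → Near (fun y => H.normSq (x - J y) < ε) y := by
      refine hH.exists_near (A := fun ε y => H.normSq (x - J y) < ε) (by fun_prop)
        (fun ε hε => ?_) (fun ε ε' _ hle y hy => hy.trans_le hle) (C := 4) (by norm_num) ?_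
      · obtain ⟨z, hz, h⟩ := hx ε hε
        obtain ⟨y, rfl⟩ := hKJ z hz
        exact ⟨y, h⟩
      · intro ε y z _ hy hz
        rw [← hJiso, map_sub]
        have := normSq_sub_le (J y) x (J z)
        rw [normSq_sub_comm _ x] at this
        linarith
    have : x = J y := eq_of_near fun ε hε => by
      obtain ⟨z, h1, h2⟩ := hy (ε / 4) (by positivity) (ε / 4) (by positivity)
      rw [normSq_sub_comm, ← hJiso, map_sub] at h2
      have := normSq_sub_le x (J z) (J y)
      linarith
    exact this ▸ hJK y
  have hex : ∀ x, ∃ y, ∀ z, H.inner (x - J y) (J z) = 0 := fun x => by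
    obtain ⟨y, hy, h⟩ := exists_projection hH hKc x
    obtain ⟨y, rfl⟩ := hKJ y hy
    exact ⟨y, fun z => h _ (hJK z)⟩
  have huniq : ∀ x y y', (∀ z, H.inner (x - J y) (J z) = 0) →
      (∀ z, H.inner (x - J y') (J z) = 0) → y = y' := fun x y y' h h' => by
    have h1 : H.inner (J (y - y')) (J (y - y')) = 0 := by
      have := h (y - y')
      rw [show x - J y = (x - J y') - J (y - y') by rw [map_sub]; abel, inner_sub_left, h',
        zero_sub, neg_eq_zero] at this
      exact this
    rw [← sub_eq_zero, ← normSq_eq_zero, ← hJiso, normSq_eq_zero]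
    exact H.inner_self_eq_zero _ h1
  choose T hT using hex
  have hTD : Df M T := Df.of_iff (p := fun x y => ∀ z, H.inner (x - J y) (J z) = 0)
    (fun x y => ⟨by rintro rfl; exact hT x, fun h => huniq x _ _ (hT x) h⟩) (by fun_prop)
  let L : H.Vec →ₗ[Cx R] H.Vec :=
    { toFun := T
      map_add' := fun x y => huniq _ _ _ (hT _) fun z => by
        rw [map_add, add_sub_add_comm, H.inner_add_left, hT, hT, add_zero]
      map_smul' := fun c x => huniq _ _ _ (hT _) fun z => by
        rw [map_smul, RingHom.id_apply, ← smul_sub, H.inner_smul_left, hT, mul_zero] }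
  refine ⟨L, funInModel_iff.2 hTD, ⟨1, fun x => ?_⟩, fun y => ⟨J y, ?_⟩, fun hinj => ?_⟩
  · have h1 := normSq_add (x - J (T x)) (J (T x))
    rw [hT, sub_add_cancel, hJiso, QuadraticAlgebra.re_zero] at h1
    have h2 := normSq_nonneg (x - J (T x))
    change H.normSq (T x) ≤ _
    linarith
  · exact huniq _ _ _ (hT _) fun z => by rw [sub_self, inner_zero_left]
  · obtain ⟨w, hw, hwK⟩ := exists_orthogonal hH hKc hne
    refine hw (hinj (a₁ := w) (a₂ := 0) ?_)
    rw [map_zero]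
    exact huniq w _ _ (hT w) fun z => by
      rw [map_zero, sub_zero]; exact hwK _ (hJK z)

/-! ### From a surjection with a kernel to an orthonormal sequence -/

theorem hasOrthonormalSeq_of_hilbertDuallyDedekindInfinite (hH : H.IsSigmaComplete)
    (h : H.HilbertDuallyDedekindInfinite) : H.HasOrthonormalSeq := by
  obtain ⟨T, hT, ⟨c, hc⟩, hsurj, hninj⟩ := h
  have hT : Df M fun x => T x := funInModel_iff.1 hT
  obtain ⟨itT, hitT, hT0, hT1⟩ := exists_iter (M := M) hT
  have hadd : ∀ n x y, itT n (x + y) = itT n x + itT n y :=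
    Nats.ind (p := fun n => ∀ x y, itT n (x + y) = itT n x + itT n y) (by fun_prop)
      (fun x y => by simp only [hT0]) fun n ih x y => by rw [hT1, ih, map_add, hT1, hT1]
  have hsmul : ∀ n (a : Cx R) x, itT n (a • x) = a • itT n x :=
    Nats.ind (p := fun n => ∀ (a : Cx R) x, itT n (a • x) = a • itT n x) (by fun_prop)
      (fun a x => by simp only [hT0]) fun n ih a x => by rw [hT1, ih, map_smul, hT1]
  -- Boundedness of the iterates is what makes the kernels `K n` of `T^n` closed, so that
  -- projections onto them exist.
  have hbdd : ∀ n, ∃ C : El R, ∀ x, H.normSq (itT n x) ≤ C * H.normSq x :=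
    Nats.ind (p := fun n => ∃ C : El R, ∀ x, H.normSq (itT n x) ≤ C * H.normSq x) (by fun_prop)
      ⟨1, fun x => by rw [hT0, one_mul]⟩ fun n ⟨C, hC⟩ => ⟨c ^ 2 * C, fun x => by
        rw [hT1, mul_assoc]
        exact (hc _).trans (mul_le_mul_of_nonneg_left (hC x) (sq_nonneg c))⟩
  -- Iteration adds `T` on the outside; cancelling against `S` in `hv` needs it on the inside.
  have hshift : ∀ n x, itT n.succ x = itT n (T x) :=
    Nats.ind (p := fun n => ∀ x, itT n.succ x = itT n (T x)) (by fun_prop)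
      (fun x => by rw [hT1, hT0, hT0]) fun n ih x => by rw [hT1, ih, hT1]
  let K : Nats M → Submodule (Cx R) H.Vec := fun n =>
    { carrier := {x | itT n x = 0}
      add_mem' := fun {x y} (hx : itT n x = 0) (hy : itT n y = 0) =>
        show itT n (x + y) = 0 by rw [hadd, hx, hy, add_zero]
      zero_mem' := show itT n 0 = 0 by
        have := hsmul n 0 0
        rwa [zero_smul, zero_smul] at this
      smul_mem' := fun a x (hx : itT n x = 0) => show itT n (a • x) = 0 by
        rw [hsmul, hx, smul_zero] }
  have hK : ∀ n, ClosedSubspace (K n) := fun n => by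
    refine ⟨by change Df M fun x => itT n x = 0; fun_prop, fun x hx => ?_⟩
    obtain ⟨C, hC⟩ := hbdd n
    change itT n x = 0
    rw [← normSq_eq_zero]
    refine le_antisymm (nonpos_of_forall_le_mul (C := |C|) fun ε hε => ?_) (normSq_nonneg _)
    obtain ⟨y, hy, h⟩ := hx ε hε
    have e1 : itT n (x - y) = itT n x := by
      have := hadd n (x - y) y
      rw [sub_add_cancel, show itT n y = 0 from hy, add_zero] at this
      exact this.symm
    have h1 := hC (x - y)
    rw [e1] at h1
    have h2 : C * H.normSq (x - y) ≤ |C| * H.normSq (x - y) :=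
      mul_le_mul_of_nonneg_right (le_abs_self C) (normSq_nonneg _)
    have h3 : |C| * H.normSq (x - y) ≤ |C| * ε := mul_le_mul_of_nonneg_left h.le (abs_nonneg C)
    linarith
  have hmono : ∀ m n, m ≤ n → ∀ x, x ∈ K m → x ∈ K n := fun m n hmn x hx => by
    refine Nats.ind (p := fun n => m ≤ n → itT n x = 0) (by fun_prop) (fun h => ?_)
      (fun n ih h => ?_) n hmn
    · rwa [← le_antisymm h (not_lt.1 (Nats.not_lt_zero m))]
    · rcases h.lt_or_eq with h | rfl
      · rw [hT1, ih (Nats.lt_succ.1 h), map_zero]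
      · exact hx
  have hK1 : ∀ x, x ∈ K (Nats.succ 0) ↔ T x = 0 := fun x => by
    change itT _ x = 0 ↔ _
    rw [hT1, hT0]
  -- Among the preimages of `v` exactly one is orthogonal to `ker T`. This gives a canonical, hence
  -- definable, right inverse `S` of `T`.
  have hS : ∀ v, ∃! x, T x = v ∧ ∀ k, T k = 0 → H.inner x k = 0 := fun v => by
    obtain ⟨x, hx⟩ := hsurj v
    obtain ⟨y, hy, h⟩ := exists_projection hH (hK (Nats.succ 0)) x
    refine ⟨x - y, ⟨?_, fun k hk => h k ((hK1 k).2 hk)⟩, ?_⟩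
    · rw [map_sub, (hK1 y).1 hy, sub_zero, hx]
    · rintro z ⟨hz, hz'⟩
      have h1 : T (z - (x - y)) = 0 := by
        rw [map_sub, map_sub, (hK1 y).1 hy, hz, hx, sub_zero, sub_self]
      refine sub_eq_zero.1 (H.inner_self_eq_zero _ ?_)
      conv_lhs => rw [inner_sub_left]
      rw [hz' _ h1, h _ ((hK1 _).2 h1), sub_zero]
  choose S hS1 hS2 using hS
  have hSD : Df M S := Df.of_iff (p := fun v x => T x = v ∧ ∀ k, T k = 0 → H.inner x k = 0)
    (fun v x => ⟨by rintro rfl; exact hS1 v, fun h => (hS2 v x h).symm⟩) (by fun_prop)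
  obtain ⟨itS, hitS, hS0, hS1'⟩ := exists_iter hSD
  obtain ⟨v₀, hv₀, hv₀'⟩ : ∃ v, T v = 0 ∧ v ≠ 0 := by
    by_contra hc
    push Not at hc
    exact hninj (LinearMap.ker_eq_bot.1 (LinearMap.ker_eq_bot'.2 hc))
  have hvD : Df M fun n => itS n v₀ := Df.comp (g := fun z : Nats M × H.Vec => itS z.1 z.2) hitS
    (by fun_prop : Df M fun n : Nats M => (n, v₀))
  have hv : ∀ n, itT n (itS n v₀) = v₀ := Nats.ind (p := fun n => itT n (itS n v₀) = v₀)
    (by fun_prop) (by rw [hS0, hT0]) fun n ih => by rw [hshift, hS1', (hS1 _).1, ih]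
  have hvK : ∀ n, itS n v₀ ∈ K n.succ := fun n => by
    change itT n.succ (itS n v₀) = 0
    rw [hT1, hv, hv₀]
  have hvK' : ∀ n, itS n v₀ ∉ K n := fun n h => hv₀' ((hv n).symm.trans h)
  -- `w n` is the component of `S^n v₀` orthogonal to `K n`. It is nonzero since `S^n v₀` is not in
  -- `K n`.
  have hw : ∀ n, ∃! w, (∀ k, k ∈ K n → H.inner w k = 0) ∧ itS n v₀ - w ∈ K n := fun n => by
    obtain ⟨y, hy, h⟩ := exists_projection hH (hK n) (itS n v₀)
    refine ⟨itS n v₀ - y, ⟨h, by rwa [sub_sub_cancel]⟩, ?_⟩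
    rintro z ⟨hz, hz'⟩
    have h1 : z - (itS n v₀ - y) ∈ K n := by
      rw [show z - (itS n v₀ - y) = y - (itS n v₀ - z) by abel]
      exact (K n).sub_mem hy hz'
    refine sub_eq_zero.1 (H.inner_self_eq_zero _ ?_)
    conv_lhs => rw [inner_sub_left]
    rw [hz _ h1, h _ h1, sub_zero]
  choose w hw1 hw2 using hw
  have hwD : Df M w := Df.of_iff
    (p := fun n w => (∀ k, itT n k = 0 → H.inner w k = 0) ∧ itT n (itS n v₀ - w) = 0)
    (fun n x => ⟨by rintro rfl; exact hw1 n, fun h => (hw2 n x h).symm⟩) (by fun_prop)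
  refine hasOrthonormalSeq_of_orthogonal hwD (fun n h => ?_) fun m n hmn => ?_
  · have := (hw1 n).2
    rw [h, sub_zero] at this
    exact hvK' n this
  -- `w m` lies in `K (m + 1) ⊆ K n`, to which `w n` is orthogonal.
  · refine inner_eq_zero_symm ((hw1 n).1 _ (hmono m.succ n (Nats.succ_le.2 hmn) _ ?_))
    have := (K m.succ).sub_mem (hvK m) (hmono _ _ (Nats.lt_succ_self m).le _ (hw1 m).2)
    rwa [sub_sub_cancel] at this

theorem tfae_hilbertDedekindInfinite (hH : H.IsSigmaComplete) :
    List.TFAE [H.HasOrthonormalSeq, H.HilbertDedekindInfinite,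
      H.HilbertDuallyDedekindInfinite] := by
  tfae_have 1 → 2 := hilbertDedekindInfinite_of_hasOrthonormalSeq hH
  tfae_have 2 → 3 := hilbertDuallyDedekindInfinite_of_hilbertDedekindInfinite hH
  tfae_have 3 → 1 := hasOrthonormalSeq_of_hilbertDuallyDedekindInfinite hH
  tfae_finish

end InnerSpace

/-! ### Finite sums -/

section FiniteSums

variable {M : Type u} [Membership M M] [ZF M] {X : M}

namespace FinSub

/-- `F ∖ {x}` -/
noncomputable def erase (x : El X) (F : FinSub X) : FinSub X :=
  Classical.choose (F.exists_sep (p := fun z => z ≠ x.1) (by fun_prop))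

theorem mem_erase {x : El X} {F : FinSub X} {z : M} : z ∈ (erase x F).1 ↔ z ∈ F.1 ∧ z ≠ x.1 :=
  Classical.choose_spec (F.exists_sep (p := fun z => z ≠ x.1) (by fun_prop)) z

@[fun_prop] theorem _root_.ZFModel.Df.finSubErase {α : Type*} [DefType M α] {f : α → El X}
    {g : α → FinSub X} (hf : Df M f) (hg : Df M g) : Df M fun x => erase (f x) (g x) :=
  Df.of_iff (p := fun x G => ∀ z, z ∈ G.1 ↔ z ∈ (g x).1 ∧ z ≠ (f x).1)
    (fun x G => ⟨by rintro rfl z; exact mem_erase, fun h => ext fun z => by rw [mem_erase, h]⟩)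
    (by fun_prop)

theorem erase_insert {x : El X} {F : FinSub X} (h : x.1 ∉ F.1) : erase x (insert x F) = F :=
  ext fun z => by
    rw [mem_erase, mem_insert]
    constructor
    · rintro ⟨h1 | h1, h2⟩
      · exact h1
      · exact absurd h1 h2
    · exact fun h1 => ⟨Or.inl h1, fun e => h (e ▸ h1)⟩

theorem insert_erase {x : El X} {F : FinSub X} (h : x.1 ∈ F.1) : insert x (erase x F) = F :=
  ext fun z => by
    rw [mem_insert, mem_erase]
    by_cases hz : z = x.1
    · simp [hz, h]
    · simp [hz]

theorem erase_insert_of_ne {x y : El X} {F : FinSub X} (h : x.1 ≠ y.1) :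
    erase y (insert x F) = insert x (erase y F) :=
  ext fun z => by
    simp only [mem_erase, mem_insert]
    constructor
    · rintro ⟨h1 | h1, h2⟩
      · exact Or.inl ⟨h1, h2⟩
      · exact Or.inr h1
    · rintro (⟨h1, h2⟩ | h1)
      · exact ⟨Or.inl h1, h2⟩
      · exact ⟨Or.inr h1, fun e => h (h1 ▸ e)⟩

end FinSub

/-- `S F` is the sum of `g x` over `x ∈ F`, for every `F ⊆ B`. -/
def SumOn {α : Type v} [AddCommGroup α] (B : M) (g : El X → α) (S : FinSub X → α) : Prop :=
  S ∅ = 0 ∧ ∀ F x, x.1 ∉ F.1 → (∀ z, z ∈ (FinSub.insert x F).1 → z ∈ B) →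
    S (FinSub.insert x F) = S F + g x

theorem isFinSum_iff {α : Type v} [AddCommGroup α] [Coded M α] [DefType M α] [SetType M α]
    {g : El X → α} {S : FinSub X → α} : IsFinSum g S ↔ Df M S ∧ SumOn X g S := by
  unfold IsFinSum SumOn
  rw [funInModel_iff]
  refine and_congr_right fun _ => and_congr ⟨fun h => h ∅ notMem_emp, fun h F hF => ?_⟩
    ⟨fun h F x hx _ => h F _ x hx fun z => FinSub.mem_insert, fun h F G x hx hG => ?_⟩
  · rwa [show F = ∅ from Subtype.ext (isEmptySet_iff.1 hF)]
  · rw [show G = FinSub.insert x F from Subtype.ext (isInsert_iff.1 hG)]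
    exact h F x hx fun z hz => (FinSub.insert x F).2.1 z hz

variable {R : M} [Field (El R)] [LinearOrder (El R)] [IsReals R]

theorem SumOn.unique {B : M} {g : El X → El R} {S T : FinSub X → El R} (hS : Df M S)
    (hT : Df M T) (h : SumOn B g S) (h' : SumOn B g T) (F : FinSub X)
    (hF : ∀ z, z ∈ F.1 → z ∈ B) : S F = T F := by
  refine FinSub.ind (p := fun F => (∀ z, z ∈ F.1 → z ∈ B) → S F = T F) (by fun_prop)
    (fun _ => h.1.trans h'.1.symm) (fun x F hx ih hF => ?_) F hF
  rw [h.2 F x hx hF, h'.2 F x hx hF, ih fun z hz => hF z (FinSub.mem_insert.2 (Or.inl hz))]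

theorem SumOn.mono {B C : M} {g : El X → El R} {S : FinSub X → El R} (h : SumOn B g S)
    (hC : ∀ z, z ∈ C → z ∈ B) : SumOn C g S :=
  ⟨h.1, fun F x hx hF => h.2 F x hx fun z hz => hC z (hF z hz)⟩

@[fun_prop] theorem Df.sumOn {α : Type*} [DefType M α] {B : α → M} {g : α → El X → El R}
    {S : α → FinSub X → El R} (hB : Df M B) (hg : Df M fun z : α × El X => g z.1 z.2)
    (hS : Df M fun z : α × FinSub X => S z.1 z.2) : Df M fun a => SumOn (B a) (g a) (S a) := by
  unfold SumOn
  have h1 : Df M fun a => S a ∅ := Df.comp (g := fun z : α × FinSub X => S z.1 z.2) hS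
    (by fun_prop : Df M fun a => (a, (∅ : FinSub X)))
  have h2 : Df M fun w : (α × FinSub X) × El X => S w.1.1 (FinSub.insert w.2 w.1.2) :=
    Df.comp (g := fun z : α × FinSub X => S z.1 z.2) hS
    (by fun_prop : Df M fun w : (α × FinSub X) × El X => (w.1.1, FinSub.insert w.2 w.1.2))
  have h3 : Df M fun w : (α × FinSub X) × El X => S w.1.1 w.1.2 :=
    Df.comp (g := fun z : α × FinSub X => S z.1 z.2) hS
    (by fun_prop : Df M fun w : (α × FinSub X) × El X => (w.1.1, w.1.2))
  have h4 : Df M fun w : (α × FinSub X) × El X => g w.1.1 w.2 :=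
    Df.comp (g := fun z : α × El X => g z.1 z.2) hg
    (by fun_prop : Df M fun w : (α × FinSub X) × El X => (w.1.1, w.2))
  fun_prop

theorem exists_sumOn {g : El X → El R} (hg : Df M g) (F : FinSub X) :
    ∃ S : Fn M (FinSub X) (El R), SumOn F.1 g S.ev := by
  refine FinSub.ind (p := fun F => ∃ S : Fn M (FinSub X) (El R), SumOn F.1 g S.ev)
    (by fun_prop) ?_ ?_ F
  · obtain ⟨S, hS⟩ := exists_fn (M := M) (f := fun _ : FinSub X => (0 : El R)) (by fun_prop)
    exact ⟨S, hS _, fun F x _ h => absurd (h x.1 (FinSub.mem_insert.2 (Or.inr rfl)))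
      (notMem_emp _)⟩
  · rintro y F hy ⟨S, hS⟩
    classical
    -- Admitting `y` as a summand: sums over sets containing `y` are reduced to the set without `y`;
    -- all other values stay.
    obtain ⟨T, hT⟩ := exists_fn (M := M) (f := fun G : FinSub X =>
      if y.1 ∈ G.1 then S.ev (FinSub.erase y G) + g y else S.ev G) (by fun_prop)
    refine ⟨T, ?_, fun G x hx hG => ?_⟩
    · rw [hT, if_neg (show y.1 ∉ (∅ : FinSub X).1 from notMem_emp _), hS.1]
    · have hsub : ∀ z, z ∈ (FinSub.insert x G).1 → z ≠ y.1 → z ∈ F.1 := fun z hz hne =>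
        (FinSub.mem_insert.1 (hG z hz)).resolve_right hne
      rw [hT, hT]
      by_cases hxy : x.1 = y.1
      · obtain rfl : x = y := Subtype.ext hxy
        rw [if_pos (FinSub.mem_insert.2 (Or.inr rfl)), if_neg hx, FinSub.erase_insert hx]
      by_cases hyG : y.1 ∈ G.1
      · rw [if_pos (FinSub.mem_insert.2 (Or.inl hyG)), if_pos hyG,
          FinSub.erase_insert_of_ne hxy, hS.2 _ x (fun h => hx (FinSub.mem_erase.1 h).1)]
        · ring
        · rw [← FinSub.erase_insert_of_ne hxy]
          exact fun z hz => hsub z (FinSub.mem_erase.1 hz).1 (FinSub.mem_erase.1 hz).2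
      · have hyx : y.1 ∉ (FinSub.insert x G).1 := fun h =>
          (FinSub.mem_insert.1 h).elim hyG fun e => hxy e.symm
        rw [if_neg hyx, if_neg hyG]
        exact hS.2 G x hx fun z hz => hsub z hz fun e => hyx (e ▸ hz)

/-- The sum functions valid below each single `F` agree where they overlap, so their values at `F`
glue to one definable function without choosing among them. -/
theorem exists_sum {g : El X → El R} (hg : Df M g) :
    ∃ S : FinSub X → El R, Df M S ∧ SumOn X g S := by
  have key : ∀ F : FinSub X, ∃! r, ∃ S : Fn M (FinSub X) (El R), SumOn F.1 g S.ev ∧ S.ev F = r := by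
    intro F
    obtain ⟨S, hS⟩ := exists_sumOn hg F
    refine ⟨S.ev F, ⟨S, hS, rfl⟩, ?_⟩
    rintro _ ⟨T, hT, rfl⟩
    exact hT.unique T.df S.df hS F fun _ h => h
  choose S hS hSu using key
  refine ⟨S, Df.of_iff (p := fun F r => ∃ S : Fn M (FinSub X) (El R), SumOn F.1 g S.ev ∧
    S.ev F = r) (fun F r => ⟨by rintro rfl; exact hS F, fun h => (hSu F r h).symm⟩)
    (by fun_prop), ?_, fun F x hx _ => ?_⟩
  · obtain ⟨T, hT, h⟩ := hS ∅
    rw [← h, hT.1]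
  · obtain ⟨T, hT, h⟩ := hS (FinSub.insert x F)
    rw [← h, hT.2 F x hx fun _ h => h, hSu F (T.ev F) ⟨T, hT.mono fun z hz =>
      FinSub.mem_insert.2 (Or.inl hz), rfl⟩]

open Classical in
/-- The sum of `g x` over `x ∈ F`. -/
noncomputable def fsum (g : El X → El R) : FinSub X → El R :=
  -- For `g` outside the model the value is the zero function.
  if h : Df M g then Classical.choose (exists_sum h) else 0

theorem df_fsum {g : El X → El R} (hg : Df M g) : Df M (fsum g) := by
  rw [fsum, dif_pos hg]
  exact (Classical.choose_spec (exists_sum hg)).1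

theorem sumOn_fsum {g : El X → El R} (hg : Df M g) : SumOn X g (fsum g) := by
  rw [fsum, dif_pos hg]
  exact (Classical.choose_spec (exists_sum hg)).2

theorem SumOn.eq_fsum {g : El X → El R} {S : FinSub X → El R} (hg : Df M g) (hS : Df M S)
    (h : SumOn X g S) : S = fsum g :=
  funext fun F => h.unique hS (df_fsum hg) (sumOn_fsum hg) F F.2.1

theorem fsum_empty {g : El X → El R} (hg : Df M g) : fsum g ∅ = 0 := (sumOn_fsum hg).1

theorem fsum_insert {g : El X → El R} (hg : Df M g) {x : El X} {F : FinSub X} (hx : x.1 ∉ F.1) :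
    fsum g (FinSub.insert x F) = fsum g F + g x :=
  (sumOn_fsum hg).2 F x hx (FinSub.insert x F).2.1

theorem fsum_add {g h : El X → El R} (hg : Df M g) (hh : Df M h) (F : FinSub X) :
    fsum (fun x => g x + h x) F = fsum g F + fsum h F := by
  have h1 := df_fsum hg
  have h2 := df_fsum hh
  have h3 : Df M fun x => g x + h x := by fun_prop
  refine (congrFun (SumOn.eq_fsum (S := fun F => fsum g F + fsum h F) h3 (by fun_prop)
    ⟨?_, fun F x hx _ => ?_⟩) F).symm
  · beta_reduce; rw [fsum_empty hg, fsum_empty hh, add_zero]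
  · beta_reduce; rw [fsum_insert hg hx, fsum_insert hh hx]; ring

theorem fsum_const_mul {g : El X → El R} (hg : Df M g) (c : El R) (F : FinSub X) :
    fsum (fun x => c * g x) F = c * fsum g F := by
  have h1 := df_fsum hg
  have h3 : Df M fun x => c * g x := by fun_prop
  refine (congrFun (SumOn.eq_fsum (S := fun F => c * fsum g F) h3 (by fun_prop)
    ⟨?_, fun F x hx _ => ?_⟩) F).symm
  · beta_reduce; rw [fsum_empty hg, mul_zero]
  · beta_reduce; rw [fsum_insert hg hx]; ring

theorem fsum_le_fsum {g h : El X → El R} (hg : Df M g) (hh : Df M h) (hle : ∀ x, g x ≤ h x)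
    (F : FinSub X) : fsum g F ≤ fsum h F := by
  have h1 := df_fsum hg
  have h2 := df_fsum hh
  refine FinSub.ind (p := fun F => fsum g F ≤ fsum h F) (by fun_prop) ?_ (fun x F hx ih => ?_) F
  · rw [fsum_empty hg, fsum_empty hh]
  · rw [fsum_insert hg hx, fsum_insert hh hx]
    exact add_le_add ih (hle x)

theorem fsum_zero (F : FinSub X) : fsum (fun _ => (0 : El R)) F = 0 := by
  have := fsum_const_mul (X := X) (g := fun _ => (0 : El R)) (by fun_prop) 0 F
  simpa only [zero_mul] using this

theorem fsum_nonneg {g : El X → El R} (hg : Df M g) (hle : ∀ x, 0 ≤ g x) (F : FinSub X) :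
    0 ≤ fsum g F := by
  rw [← fsum_zero F]
  exact fsum_le_fsum (by fun_prop) hg hle F

theorem fsum_mono {g : El X → El R} (hg : Df M g) (hle : ∀ x, 0 ≤ g x) {F G : FinSub X}
    (h : ∀ z, z ∈ F.1 → z ∈ G.1) : fsum g F ≤ fsum g G := by
  have h1 := df_fsum hg
  refine FinSub.ind (p := fun G => ∀ F : FinSub X, (∀ z, z ∈ F.1 → z ∈ G.1) →
    fsum g F ≤ fsum g G) (by fun_prop) (fun F hF => ?_) (fun x G hx ih F hF => ?_) G F h
  · rw [FinSub.ext (F := F) (G := ∅) fun z => ⟨hF z, fun h => absurd h (notMem_emp z)⟩]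
  · rw [fsum_insert hg hx]
    by_cases hxF : x.1 ∈ F.1
    · rw [← FinSub.insert_erase hxF, fsum_insert hg fun h => (FinSub.mem_erase.1 h).2 rfl]
      refine add_le_add (ih _ fun z hz => ?_) le_rfl
      obtain ⟨h2, h3⟩ := FinSub.mem_erase.1 hz
      exact (FinSub.mem_insert.1 (hF z h2)).resolve_right h3
    · refine (ih F fun z hz => ?_).trans (le_add_of_nonneg_right (hle x))
      exact (FinSub.mem_insert.1 (hF z hz)).resolve_right fun e => hxF (e ▸ hz)

theorem le_fsum {g : El X → El R} (hg : Df M g) (hle : ∀ x, 0 ≤ g x) {F : FinSub X} {x : El X}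
    (hx : x.1 ∈ F.1) : g x ≤ fsum g F := by
  rw [← FinSub.insert_erase hx, fsum_insert hg fun h => (FinSub.mem_erase.1 h).2 rfl]
  exact le_add_of_nonneg_left (fsum_nonneg hg hle _)

/-! ### Sums of nets -/

@[fun_prop] theorem Df.realAbs {α : Type*} [DefType M α] {f : α → El R} (hf : Df M f) :
    Df M fun x => |f x| := by
  refine Df.of_iff (p := fun x y => (0 ≤ f x ∧ f x = y) ∨ (f x < 0 ∧ -f x = y)) (fun x y => ?_)
    (by fun_prop)
  rcases le_or_gt 0 (f x) with h | h
  · simp [abs_of_nonneg h, h, h.not_gt]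
  · simp [abs_of_neg h, h, h.not_ge]

/-- The net of the sums of `g` over finite subsets converges to `s`. -/
def NetSum (g : El X → El R) (s : El R) : Prop :=
  ∃ S : Fn M (FinSub X) (El R), SumOn X g S.ev ∧ ∀ ε, 0 < ε → ∃ F : FinSub X, ∀ G : FinSub X,
    (∀ z, z ∈ F.1 → z ∈ G.1) → |S.ev G - s| < ε

theorem df_netSum {α : Type*} [DefType M α] {g : α → El X → El R} {s : α → El R}
    (hg : Df M fun z : α × El X => g z.1 z.2) (hs : Df M s) :
    Df M fun a => NetSum (g a) (s a) := by
  unfold NetSum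
  have : Df M fun w : (α × Fn M (FinSub X) (El R)) × El X => g w.1.1 w.2 :=
    Df.comp (g := fun z : α × El X => g z.1 z.2) hg
      (by fun_prop : Df M fun w : (α × Fn M (FinSub X) (El R)) × El X => (w.1.1, w.2))
  fun_prop

/-- `NetSum` quantifies over sum functions of the model in order to be definable jointly in
parameters; for definable `g` the only one is `fsum g`. -/
theorem netSum_iff {g : El X → El R} (hg : Df M g) {s : El R} :
    NetSum g s ↔ ∀ ε, 0 < ε → ∃ F : FinSub X, ∀ G : FinSub X,
      (∀ z, z ∈ F.1 → z ∈ G.1) → |fsum g G - s| < ε := by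
  constructor
  · rintro ⟨S, hS, h⟩
    rwa [← hS.eq_fsum hg S.df]
  · intro h
    obtain ⟨S, hS⟩ := exists_fn (df_fsum hg)
    have : S.ev = fsum g := funext hS
    exact ⟨S, by rw [this]; exact sumOn_fsum hg, by rwa [this]⟩

theorem NetSum.unique {g : El X → El R} (hg : Df M g) {s t : El R} (hs : NetSum g s)
    (ht : NetSum g t) : s = t := by
  rw [netSum_iff hg] at hs ht
  rw [← sub_eq_zero, ← abs_eq_zero]
  refine le_antisymm (nonpos_of_forall_le_mul (C := 2) fun ε hε => ?_) (abs_nonneg _)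
  obtain ⟨F, hF⟩ := hs ε hε
  obtain ⟨G, hG⟩ := ht ε hε
  obtain ⟨K, hK⟩ := FinSub.exists_union F G
  have h1 := hF K fun z hz => (hK z).2 (Or.inl hz)
  have h2 := hG K fun z hz => (hK z).2 (Or.inr hz)
  have h3 := abs_sub_le s (fsum g K) t
  rw [abs_sub_comm s (fsum g K)] at h3
  linarith

theorem NetSum.add {g h : El X → El R} (hg : Df M g) (hh : Df M h) {s t : El R}
    (hs : NetSum g s) (ht : NetSum h t) : NetSum (fun x => g x + h x) (s + t) := by
  rw [netSum_iff hg] at hs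
  rw [netSum_iff hh] at ht
  rw [netSum_iff (by fun_prop)]
  intro ε hε
  obtain ⟨F, hF⟩ := hs (ε / 2) (by positivity)
  obtain ⟨G, hG⟩ := ht (ε / 2) (by positivity)
  obtain ⟨K, hK⟩ := FinSub.exists_union F G
  refine ⟨K, fun L hL => ?_⟩
  have h1 := hF L fun z hz => hL z ((hK z).2 (Or.inl hz))
  have h2 := hG L fun z hz => hL z ((hK z).2 (Or.inr hz))
  rw [fsum_add hg hh, add_sub_add_comm]
  exact (abs_add_le _ _).trans_lt (by linarith)

theorem NetSum.const_mul {g : El X → El R} (hg : Df M g) {s : El R} (hs : NetSum g s)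
    (c : El R) : NetSum (fun x => c * g x) (c * s) := by
  rw [netSum_iff hg] at hs
  rw [netSum_iff (by fun_prop)]
  intro ε hε
  obtain ⟨F, hF⟩ := hs (ε / (|c| + 1)) (by positivity)
  refine ⟨F, fun L hL => ?_⟩
  have h1 := hF L hL
  rw [lt_div_iff₀ (by positivity)] at h1
  rw [fsum_const_mul hg, ← mul_sub, abs_mul]
  nlinarith [abs_nonneg (fsum g L - s)]

theorem netSum_zero : NetSum (fun _ : El X => (0 : El R)) 0 := by
  rw [netSum_iff (by fun_prop)]
  exact fun ε hε => ⟨∅, fun G _ => by rwa [fsum_zero, sub_zero, abs_zero]⟩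

theorem NetSum.fsum_le {g : El X → El R} (hg : Df M g) (h0 : ∀ x, 0 ≤ g x) {s : El R}
    (hs : NetSum g s) (F : FinSub X) : fsum g F ≤ s := by
  rw [netSum_iff hg] at hs
  rw [← sub_nonpos]
  refine nonpos_of_forall_le_mul (C := 1) fun ε hε => ?_
  obtain ⟨G, hG⟩ := hs ε hε
  obtain ⟨K, hK⟩ := FinSub.exists_union F G
  have h1 := hG K fun z hz => (hK z).2 (Or.inr hz)
  have h2 := fsum_mono hg h0 (F := F) (G := K) fun z hz => (hK z).2 (Or.inl hz)
  have h3 := (abs_lt.1 h1).2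
  linarith

theorem NetSum.le {g : El X → El R} (hg : Df M g) {s B : El R} (hs : NetSum g s)
    (hB : ∀ F, fsum g F ≤ B) : s ≤ B := by
  rw [netSum_iff hg] at hs
  rw [← sub_nonpos]
  refine nonpos_of_forall_le_mul (C := 1) fun ε hε => ?_
  obtain ⟨G, hG⟩ := hs ε hε
  have h1 := hG G fun z hz => hz
  have h3 := (abs_lt.1 h1).1
  have := hB G
  linarith

/-- For nonnegative terms the finite sums increase with the set, so the net converges to their
supremum. -/
theorem exists_netSum_of_nonneg {g : El X → El R} (hg : Df M g) (h0 : ∀ x, 0 ≤ g x) {B : El R}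
    (hB : ∀ F, fsum g F ≤ B) : ∃ s, NetSum g s := by
  have h1 := df_fsum hg
  obtain ⟨s, h2, h3⟩ := exists_isLUB (p := fun r => ∃ F, r = fsum g F) (by fun_prop)
    ⟨_, ∅, rfl⟩ (b := B) (by rintro _ ⟨F, rfl⟩; exact hB F)
  refine ⟨s, (netSum_iff hg).2 fun ε hε => ?_⟩
  by_contra hc
  push Not at hc
  have : s ≤ s - ε := h3 _ (by
    rintro _ ⟨F, rfl⟩
    obtain ⟨G, hG, h4⟩ := hc F
    have h5 := fsum_mono hg h0 hG
    have h6 := h2 _ ⟨G, rfl⟩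
    rw [abs_of_nonpos (by linarith)] at h4
    linarith)
  linarith

/-- Dominated sums converge. -/
theorem exists_netSum_of_abs_le {g h : El X → El R} (hg : Df M g) (hh : Df M h)
    (hle : ∀ x, |g x| ≤ h x) {B : El R} (hB : ∀ F, fsum h F ≤ B) : ∃ s, NetSum g s := by
  have h0 : ∀ x, 0 ≤ h x := fun x => (abs_nonneg _).trans (hle x)
  obtain ⟨s, hs⟩ := exists_netSum_of_nonneg hh h0 hB
  -- Write `g = (g + h) - h`; both parts are nonnegative, and `g + h ≤ 2h` has bounded sums.
  obtain ⟨t, ht⟩ := exists_netSum_of_nonneg (g := fun x => g x + h x) (by fun_prop)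
    (fun x => by linarith [(abs_le.1 (hle x)).1]) (B := 2 * B) fun F => by
      have := fsum_le_fsum (g := fun x => g x + h x) (h := fun x => 2 * h x) (by fun_prop)
        (by fun_prop) (fun x => by linarith [(abs_le.1 (hle x)).2]) F
      rw [fsum_const_mul hh] at this
      linarith [hB F]
  have := NetSum.add (by fun_prop) (by fun_prop) ht (hs.const_mul hh (-1))
  exact ⟨_, by simpa using this⟩

theorem hasNetSum_iff {g : El X → Cx R} (hg : Df M g) {c : Cx R} :
    HasNetSum g c ↔ NetSum (fun x => (g x).re) c.re ∧ NetSum (fun x => (g x).im) c.im := by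
  have hre : Df M fun x => (g x).re := by fun_prop
  have him : Df M fun x => (g x).im := by fun_prop
  have hre' := df_fsum hre
  have him' := df_fsum him
  have key : ∀ S, IsFinSum g S ↔ S = fun F => ⟨fsum (fun x => (g x).re) F,
      fsum (fun x => (g x).im) F⟩ := by
    intro S
    rw [isFinSum_iff]
    constructor
    · rintro ⟨hS, h1, h2⟩
      have e1 := SumOn.eq_fsum (S := fun F => (S F).re) hre (by fun_prop)
        ⟨by change (S ∅).re = 0; rw [h1]; rfl, fun F x hx hF => by
          change (S (FinSub.insert x F)).re = (S F).re + (g x).re; rw [h2 F x hx hF]; rfl⟩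
      have e2 := SumOn.eq_fsum (S := fun F => (S F).im) him (by fun_prop)
        ⟨by change (S ∅).im = 0; rw [h1]; rfl, fun F x hx hF => by
          change (S (FinSub.insert x F)).im = (S F).im + (g x).im; rw [h2 F x hx hF]; rfl⟩
      rw [← e1, ← e2]
    · rintro rfl
      refine ⟨by fun_prop, ?_, fun F x hx _ => ?_⟩
      · beta_reduce; rw [fsum_empty hre, fsum_empty him]; rfl
      · beta_reduce; rw [fsum_insert hre hx, fsum_insert him hx]; rfl
  unfold HasNetSum
  simp only [key, exists_eq_left]
  rw [netSum_iff hre, netSum_iff him]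
  constructor
  · intro h
    constructor
    · intro ε hε
      obtain ⟨F, hF⟩ := h ε hε
      refine ⟨F, fun G hG => abs_lt_of_sq_lt_sq ?_ hε.le⟩
      have := hF G hG
      simp only [absSq, QuadraticAlgebra.re_sub, QuadraticAlgebra.im_sub] at this
      nlinarith [sq_nonneg (fsum (fun x => (g x).im) G - c.im)]
    · intro ε hε
      obtain ⟨F, hF⟩ := h ε hε
      refine ⟨F, fun G hG => abs_lt_of_sq_lt_sq ?_ hε.le⟩
      have := hF G hG
      simp only [absSq, QuadraticAlgebra.re_sub, QuadraticAlgebra.im_sub] at this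
      nlinarith [sq_nonneg (fsum (fun x => (g x).re) G - c.re)]
  · rintro ⟨h1, h2⟩ ε hε
    obtain ⟨F, hF⟩ := h1 (ε / 2) (by positivity)
    obtain ⟨G, hG⟩ := h2 (ε / 2) (by positivity)
    obtain ⟨K, hK⟩ := FinSub.exists_union F G
    refine ⟨K, fun L hL => ?_⟩
    have h3 := hF L fun z hz => hL z ((hK z).2 (Or.inl hz))
    have h4 := hG L fun z hz => hL z ((hK z).2 (Or.inr hz))
    simp only [absSq, QuadraticAlgebra.re_sub, QuadraticAlgebra.im_sub]
    have h5 := sq_lt_sq' (abs_lt.1 h3).1 (abs_lt.1 h3).2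
    have h6 := sq_lt_sq' (abs_lt.1 h4).1 (abs_lt.1 h4).2
    nlinarith

end FiniteSums

/-! ### Sums of complex functions -/

section EllTwoSpace

variable {M : Type u} [Membership M M] [ZF M] {X : M} {R : M} [Field (El R)]
  [LinearOrder (El R)] [IsReals R]

@[fun_prop] theorem Df.fsum {α : Type*} [DefType M α] {g : α → El X → El R} {G : α → FinSub X}
    (hg : Df M fun z : α × El X => g z.1 z.2) (hG : Df M G) : Df M fun a => fsum (g a) (G a) := by
  have hg' : ∀ a, Df M (g a) := fun a =>
    Df.comp (g := fun z : α × El X => g z.1 z.2) hg (by fun_prop : Df M fun x => (a, x))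
  have : Df M fun w : ((α × El R) × Fn M (FinSub X) (El R)) × El X => g w.1.1.1 w.2 :=
    Df.comp (g := fun z : α × El X => g z.1 z.2) hg
      (by fun_prop : Df M fun w : ((α × El R) × Fn M (FinSub X) (El R)) × El X => (w.1.1.1, w.2))
  refine Df.of_iff (p := fun a r => ∃ S : Fn M (FinSub X) (El R), SumOn X (g a) S.ev ∧
    S.ev (G a) = r) (fun a r => ?_) (by fun_prop)
  constructor
  · rintro rfl
    obtain ⟨S, hS⟩ := exists_fn (df_fsum (hg' a))
    refine ⟨S, ?_, hS _⟩
    rw [show S.ev = ZFModel.fsum (g a) from funext hS]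
    exact sumOn_fsum (hg' a)
  · rintro ⟨S, hS, rfl⟩
    rw [hS.eq_fsum (hg' a) S.df]

theorem NetSum.congr {g h : El X → El R} {s t : El R} (hs : NetSum g s) (e : ∀ x, g x = h x)
    (e' : s = t) : NetSum h t := by
  rwa [← show g = h from funext e, ← e']

namespace HasNetSum

variable {g h : El X → Cx R} {c d : Cx R}

theorem unique (hg : Df M g) (hc : HasNetSum g c) (hd : HasNetSum g d) : c = d := by
  rw [hasNetSum_iff hg] at hc hd
  exact QuadraticAlgebra.ext (hc.1.unique (by fun_prop) hd.1) (hc.2.unique (by fun_prop) hd.2)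

theorem add (hg : Df M g) (hh : Df M h) (hc : HasNetSum g c) (hd : HasNetSum h d) :
    HasNetSum (fun x => g x + h x) (c + d) := by
  rw [hasNetSum_iff hg] at hc
  rw [hasNetSum_iff hh] at hd
  exact (hasNetSum_iff (by fun_prop)).2 ⟨hc.1.add (by fun_prop) (by fun_prop) hd.1,
    hc.2.add (by fun_prop) (by fun_prop) hd.2⟩

theorem const_mul (hg : Df M g) (hc : HasNetSum g c) (a : Cx R) :
    HasNetSum (fun x => a * g x) (a * c) := by
  rw [hasNetSum_iff hg] at hc
  refine (hasNetSum_iff (by fun_prop)).2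
    ⟨((hc.1.const_mul (by fun_prop) a.re).add (by fun_prop) (by fun_prop)
      (hc.2.const_mul (by fun_prop) (-a.im))).congr (fun x => ?_) ?_,
    ((hc.2.const_mul (by fun_prop) a.re).add (by fun_prop) (by fun_prop)
      (hc.1.const_mul (by fun_prop) a.im)).congr (fun x => ?_) ?_⟩ <;>
  simp [QuadraticAlgebra.re_mul, QuadraticAlgebra.im_mul]

theorem star (hg : Df M g) (hc : HasNetSum g c) : HasNetSum (fun x => star (g x)) (star c) := by
  rw [hasNetSum_iff hg] at hc
  refine (hasNetSum_iff (by fun_prop)).2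
    ⟨hc.1.congr (fun x => ?_) ?_,
    (hc.2.const_mul (by fun_prop) (-1)).congr (fun x => ?_) ?_⟩ <;>
  simp [QuadraticAlgebra.re_star, QuadraticAlgebra.im_star]

theorem _root_.ZFModel.Df.hasNetSum {α : Type*} [DefType M α] {g : α → El X → Cx R} {c : α → Cx R}
    (hg : Df M fun z : α × El X => g z.1 z.2) (hc : Df M c) :
    Df M fun a => HasNetSum (g a) (c a) := by
  have hg' : ∀ a, Df M (g a) := fun a =>
    Df.comp (g := fun z : α × El X => g z.1 z.2) hg (by fun_prop : Df M fun x => (a, x))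
  exact Df.congr (Df.and (df_netSum (g := fun a x => (g a x).re) (by fun_prop) (by fun_prop))
    (df_netSum (g := fun a x => (g a x).im) (by fun_prop) (by fun_prop)))
    fun a => hasNetSum_iff (hg' a)

end HasNetSum

/-! ### Square-summable functions -/

/-- The sums of `|η x| ^ 2` over finite sets are bounded. -/
def SqSum (η : El X → Cx R) : Prop := ∃ B, ∀ F, fsum (fun x => absSq (η x)) F ≤ B

@[fun_prop] theorem Df.sqSum {α : Type*} [DefType M α] {η : α → El X → Cx R}
    (hη : Df M fun z : α × El X => η z.1 z.2) : Df M fun a => SqSum (η a) := by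
  unfold SqSum
  have : Df M fun w : ((α × El R) × FinSub X) × El X => η w.1.1.1 w.2 :=
    Df.comp (g := fun z : α × El X => η z.1 z.2) hη
      (by fun_prop : Df M fun w : ((α × El R) × FinSub X) × El X => (w.1.1.1, w.2))
  fun_prop

theorem isSqSummable_iff {η : El X → Cx R} : IsSqSummable η ↔ Df M η ∧ SqSum η := by
  unfold IsSqSummable SqSum
  rw [funInModel_iff]
  refine and_congr_right fun hη => ?_
  have h : Df M fun x => absSq (η x) := by fun_prop
  constructor
  · rintro ⟨S, hS, B, hB⟩
    rw [isFinSum_iff] at hS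
    rw [← hS.2.eq_fsum h hS.1]
    exact ⟨B, fun F => hB ⟨F, rfl⟩⟩
  · rintro ⟨B, hB⟩
    refine ⟨_, isFinSum_iff.2 ⟨df_fsum h, sumOn_fsum h⟩, B, ?_⟩
    rintro _ ⟨F, rfl⟩
    exact hB F

namespace SqSum

variable {η ζ : El X → Cx R}

theorem add (hη : Df M η) (hζ : Df M ζ) (h : SqSum η) (h' : SqSum ζ) :
    SqSum fun x => η x + ζ x := by
  obtain ⟨B, hB⟩ := h
  obtain ⟨C, hC⟩ := h'
  refine ⟨2 * (B + C), fun F => ?_⟩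
  have := fsum_le_fsum (g := fun x => absSq (η x + ζ x))
    (h := fun x => 2 * (absSq (η x) + absSq (ζ x))) (by fun_prop) (by fun_prop)
    (fun x => absSq_add_le _ _) F
  rw [fsum_const_mul (by fun_prop), fsum_add (by fun_prop) (by fun_prop)] at this
  linarith [hB F, hC F]

theorem const_mul (hη : Df M η) (h : SqSum η) (c : Cx R) : SqSum fun x => c * η x := by
  obtain ⟨B, hB⟩ := h
  refine ⟨absSq c * B, fun F => ?_⟩
  simp only [absSq_mul]
  rw [fsum_const_mul (by fun_prop)]
  exact mul_le_mul_of_nonneg_left (hB F) (absSq_nonneg c)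

theorem zero : SqSum fun _ : El X => (0 : Cx R) :=
  ⟨0, fun F => by simp only [absSq_zero, fsum_zero, le_refl]⟩

/-- Products of square-summable functions are summable. -/
theorem exists_hasNetSum (hη : Df M η) (hζ : Df M ζ) (h : SqSum η) (h' : SqSum ζ) :
    ∃ c, HasNetSum (fun x => η x * star (ζ x)) c := by
  obtain ⟨B, hB⟩ := h
  obtain ⟨C, hC⟩ := h'
  have hb : ∀ F, fsum (fun x => absSq (η x) + absSq (ζ x)) F ≤ B + C := fun F => by
    rw [fsum_add (by fun_prop) (by fun_prop)]
    exact add_le_add (hB F) (hC F)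
  have hre : ∀ x, |(η x * star (ζ x)).re| ≤ absSq (η x) + absSq (ζ x) := fun x => by
    simp only [absSq, QuadraticAlgebra.re_mul, QuadraticAlgebra.im_star,
      QuadraticAlgebra.re_star]
    rw [abs_le]
    constructor <;> nlinarith [sq_nonneg ((η x).re + (ζ x).re), sq_nonneg ((η x).re - (ζ x).re),
      sq_nonneg ((η x).im + (ζ x).im), sq_nonneg ((η x).im - (ζ x).im), sq_nonneg (η x).re,
      sq_nonneg (η x).im, sq_nonneg (ζ x).re, sq_nonneg (ζ x).im]
  have him : ∀ x, |(η x * star (ζ x)).im| ≤ absSq (η x) + absSq (ζ x) := fun x => by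
    simp only [absSq, QuadraticAlgebra.im_mul, QuadraticAlgebra.im_star,
      QuadraticAlgebra.re_star]
    rw [abs_le]
    constructor <;> nlinarith [sq_nonneg ((η x).re + (ζ x).im), sq_nonneg ((η x).re - (ζ x).im),
      sq_nonneg ((η x).im + (ζ x).re), sq_nonneg ((η x).im - (ζ x).re), sq_nonneg (η x).re,
      sq_nonneg (η x).im, sq_nonneg (ζ x).re, sq_nonneg (ζ x).im]
  obtain ⟨s, hs⟩ := exists_netSum_of_abs_le (by fun_prop) (by fun_prop) hre hb
  obtain ⟨t, ht⟩ := exists_netSum_of_abs_le (by fun_prop) (by fun_prop) him hb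
  exact ⟨⟨s, t⟩, (hasNetSum_iff (by fun_prop)).2 ⟨hs, ht⟩⟩

end SqSum

/-! ### Existence of `ℓ²(X)` -/

variable (X R) in
-- Every function of the model is a subset of a set bounding the codes of `X × ℂ`, so Separation in
-- a power set suffices.
theorem exists_ellTwo_carrier : ∃ c : M, ∀ m, m ∈ c ↔
    ∃ η : Fn M (El X) (Cx R), SqSum η.ev ∧ cd η = m := by
  obtain ⟨a, ha⟩ := SetType.exists_bound (M := M) (α := El X × Cx R)
  obtain ⟨b, hb⟩ := ZF.powerset a
  obtain ⟨c, hc⟩ := exists_sep_df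
    (p := fun m => ∃ η : Fn M (El X) (Cx R), SqSum η.ev ∧ cd η = m) (by fun_prop) b
  refine ⟨c, fun m => ?_⟩
  rw [hc, and_iff_right_of_imp]
  rintro ⟨η, -, rfl⟩
  rw [hb]
  intro y hy
  obtain ⟨z, rfl⟩ := η.1.sub y hy
  exact ha z

variable (X R) in
/-- The square-summable functions. -/
def sqSumSubmodule : Submodule (Cx R) (El X → Cx R) where
  carrier := {η | Df M η ∧ SqSum η}
  add_mem' := fun {η ζ} h h' => ⟨by
    have h1 := h.1
    have h2 := h'.1
    exact (by fun_prop : Df M fun x => η x + ζ x), h.2.add h.1 h'.1 h'.2⟩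
  zero_mem' := ⟨(by fun_prop : Df M fun _ : El X => (0 : Cx R)), SqSum.zero⟩
  smul_mem' := fun c {η} h => ⟨by
    have h1 := h.1
    exact (by fun_prop : Df M fun x => c * η x), h.2.const_mul h.1 c⟩

theorem exists_ellTwo_equiv {c : M} (hc : ∀ m, m ∈ c ↔
    ∃ η : Fn M (El X) (Cx R), SqSum η.ev ∧ cd η = m) :
    ∃ e : El c ≃ sqSumSubmodule X R, ∀ ξ m, m ∈ ξ.1 ↔ ∃ x, cd (x, (e ξ).1 x) = m := by
  choose f hf hf' using fun ξ : El c => (hc ξ.1).1 ξ.2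
  refine ⟨Equiv.ofBijective (fun ξ => ⟨(f ξ).ev, (f ξ).df, hf ξ⟩) ⟨fun ξ ζ h => ?_, fun η => ?_⟩,
    fun ξ m => ?_⟩
  · refine Subtype.ext ((hf' ξ).symm.trans (Eq.trans ?_ (hf' ζ)))
    rw [Fn.ext fun x => congrFun (congrArg Subtype.val h) x]
  · obtain ⟨g, hg⟩ := exists_fn η.2.1
    have hg' : g.ev = η.1 := funext hg
    have hm : cd g ∈ c := (hc _).2 ⟨g, by rw [hg']; exact η.2.2, rfl⟩
    refine ⟨⟨cd g, hm⟩, Subtype.ext ?_⟩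
    rw [← hg']
    exact congrArg Fn.ev (cd_inj.1 (hf' ⟨cd g, hm⟩))
  · rw [← hf' ξ]
    constructor
    · intro hm
      obtain ⟨⟨x, y⟩, rfl⟩ := (f ξ).1.sub m hm
      exact ⟨x, by rw [cd_inj, Prod.mk.injEq]; exact ⟨rfl, ((f ξ).ev_eq_iff x y).2 hm⟩⟩
    · rintro ⟨x, rfl⟩
      exact ((f ξ).ev_eq_iff x _).1 rfl

theorem df_of_mem_iff {c : M} {ev : El c → El X → Cx R}
    (h : ∀ (ξ : El c) (m : M), m ∈ ξ.1 ↔ ∃ x, cd (x, ev ξ x) = m) :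
    Df M fun z : El c × El X => ev z.1 z.2 := by
  refine Df.of_iff (p := fun z y => cd (z.2, y) ∈ z.1.1) (fun z y => ?_) (by fun_prop)
  rw [h]
  constructor
  · rintro rfl
    exact ⟨_, rfl⟩
  · rintro ⟨x, hx⟩
    rw [cd_inj, Prod.mk.injEq] at hx
    rw [← hx.1, ← hx.2]

/-- Vectors are determined by their coordinates, so the operations and the inner product have unique
pointwise descriptions. This yields both their definability and the inner product axioms. -/
theorem exists_isEllTwo_of_ev {c : M} [AddCommGroup (El c)] [Module (Cx R) (El c)]
    (ev : El c → El X → Cx R)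
    (he : ∀ (ξ : El c) (m : M), m ∈ ξ.1 ↔ ∃ x, cd (x, ev ξ x) = m)
    (hadd : ∀ ξ ζ x, ev (ξ + ζ) x = ev ξ x + ev ζ x)
    (hsmul : ∀ (a : Cx R) ξ x, ev (a • ξ) x = a * ev ξ x)
    (hsq : ∀ η, Df M η ∧ SqSum η ↔ ∃ ξ, ev ξ = η) : ∃ L : InnerSpace R, IsEllTwo X L := by
  have hdf : Df M fun z : El c × El X => ev z.1 z.2 := df_of_mem_iff he
  have hdf' : ∀ ξ, Df M (ev ξ) := fun ξ => ((hsq _).2 ⟨ξ, rfl⟩).1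
  have hsum : ∀ ξ, SqSum (ev ξ) := fun ξ => ((hsq _).2 ⟨ξ, rfl⟩).2
  have hinj : ∀ ξ ζ, (∀ x, ev ξ x = ev ζ x) → ξ = ζ := fun ξ ζ h =>
    Subtype.ext (ext_mem fun m => by simp only [he, h])
  choose ip hip using fun ξ ζ => SqSum.exists_hasNetSum (hdf' ξ) (hdf' ζ) (hsum ξ) (hsum ζ)
  have hprod : ∀ ξ ζ, Df M fun x => ev ξ x * star (ev ζ x) := fun ξ ζ => by
    have h1 := hdf' ξ
    have h2 := hdf' ζ
    fun_prop
  have hself : ∀ ξ, NetSum (fun x => absSq (ev ξ x)) (ip ξ ξ).re := fun ξ =>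
    ((hasNetSum_iff (hprod ξ ξ)).1 (hip ξ ξ)).1.congr (fun x => by rw [mul_star_eq]; rfl) rfl
  have habs : ∀ ξ, Df M fun x => absSq (ev ξ x) := fun ξ => by
    have h1 := hdf' ξ
    fun_prop
  refine ⟨⟨c, ip, ?_, ?_, ?_, ?_, ?_, ?_, ?_, ?_⟩, ev, ?_, ?_, hadd, hsmul, hip⟩
  · rw [funInModel_iff]
    refine Df.of_iff (p := fun p ξ => ∀ x, ev ξ x = ev p.1 x + ev p.2 x) (fun p ξ =>
      ⟨by rintro rfl x; exact hadd _ _ x, fun h => (hinj _ _ fun x => by rw [h, hadd])⟩) ?_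
    have h1 : Df M fun w : ((El c × El c) × El c) × El X => ev w.1.2 w.2 := hdf.comp
      (by fun_prop : Df M fun w : ((El c × El c) × El c) × El X => (w.1.2, w.2))
    have h2 : Df M fun w : ((El c × El c) × El c) × El X => ev w.1.1.1 w.2 := hdf.comp
      (by fun_prop : Df M fun w : ((El c × El c) × El c) × El X => (w.1.1.1, w.2))
    have h3 : Df M fun w : ((El c × El c) × El c) × El X => ev w.1.1.2 w.2 := hdf.comp
      (by fun_prop : Df M fun w : ((El c × El c) × El c) × El X => (w.1.1.2, w.2))
    fun_prop
  · rw [funInModel_iff]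
    refine Df.of_iff (p := fun p ξ => ∀ x, ev ξ x = p.1 * ev p.2 x) (fun p ξ =>
      ⟨by rintro rfl x; exact hsmul _ _ x, fun h => (hinj _ _ fun x => by rw [h, hsmul])⟩) ?_
    have h1 : Df M fun w : ((Cx R × El c) × El c) × El X => ev w.1.2 w.2 := hdf.comp
      (by fun_prop : Df M fun w : ((Cx R × El c) × El c) × El X => (w.1.2, w.2))
    have h3 : Df M fun w : ((Cx R × El c) × El c) × El X => ev w.1.1.2 w.2 := hdf.comp
      (by fun_prop : Df M fun w : ((Cx R × El c) × El c) × El X => (w.1.1.2, w.2))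
    fun_prop
  · rw [funInModel_iff]
    refine Df.of_iff (p := fun p a => HasNetSum (fun x => ev p.1 x * star (ev p.2 x)) a)
      (fun p a => ⟨by rintro rfl; exact hip _ _, fun h => (hip _ _).unique (hprod _ _) h⟩) ?_
    have h2 : Df M fun w : ((El c × El c) × Cx R) × El X => ev w.1.1.1 w.2 := hdf.comp
      (by fun_prop : Df M fun w : ((El c × El c) × Cx R) × El X => (w.1.1.1, w.2))
    have h3 : Df M fun w : ((El c × El c) × Cx R) × El X => ev w.1.1.2 w.2 := hdf.comp
      (by fun_prop : Df M fun w : ((El c × El c) × Cx R) × El X => (w.1.1.2, w.2))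
    exact Df.hasNetSum (g := fun (p : (El c × El c) × Cx R) x => ev p.1.1 x * star (ev p.1.2 x))
      (by fun_prop) (by fun_prop)
  · intro ξ ζ θ
    have := (hip ξ θ).add (hprod _ _) (hprod _ _) (hip ζ θ)
    simp only [← add_mul, ← hadd] at this
    exact (hip _ _).unique (hprod _ _) this
  · intro a ξ ζ
    have := (hip ξ ζ).const_mul (hprod _ _) a
    simp only [← mul_assoc, ← hsmul] at this
    exact (hip _ _).unique (hprod _ _) this
  · intro ξ ζ
    have := (hip ζ ξ).star (hprod _ _)
    simp only [star_mul, star_star] at this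
    exact this.unique (hprod _ _) (hip ξ ζ)
  · intro ξ
    have := (hself ξ).fsum_le (habs ξ) (fun x => absSq_nonneg _) ∅
    rwa [fsum_empty (habs ξ)] at this
  · intro ξ h
    refine hinj _ _ fun x => ?_
    have h0 : ev 0 x = 0 := by
      rw [← zero_smul (Cx R) (0 : El c), hsmul, zero_mul]
    rw [h0, ← absSq_eq_zero]
    -- A single coordinate satisfies `|ξ x|^2 ≤ ⟨ξ, ξ⟩`, by comparison with the sum over `{x}`.
    have h1 := (hself ξ).fsum_le (habs ξ) (fun x => absSq_nonneg _) (FinSub.insert x ∅)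
    rw [h] at h1
    exact le_antisymm ((le_fsum (habs ξ) (fun x => absSq_nonneg _)
      (FinSub.mem_insert.2 (Or.inr rfl))).trans h1) (absSq_nonneg _)
  · intro ξ m
    rw [he]
    simp only [SetType.cd_eq_code]
  · exact fun η => isSqSummable_iff.trans (hsq η)

variable (X R) in
theorem exists_isEllTwo : ∃ L : InnerSpace R, IsEllTwo X L := by
  obtain ⟨c, hc⟩ := exists_ellTwo_carrier X R
  obtain ⟨e, he⟩ := exists_ellTwo_equiv hc
  let _ : AddCommGroup (El c) := e.addCommGroup
  let _ : Module (Cx R) (El c) := e.module (Cx R)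
  refine exists_isEllTwo_of_ev (fun ξ => (e ξ).1) he (fun ξ ζ x => ?_) (fun a ξ x => ?_)
    fun η => ⟨fun h => ⟨e.symm ⟨η, h⟩, by simp only [Equiv.apply_symm_apply]⟩, ?_⟩
  · simp only [Equiv.add_def, Equiv.apply_symm_apply]; rfl
  · simp only [Equiv.smul_def, Equiv.apply_symm_apply]; rfl
  · rintro ⟨ξ, rfl⟩
    exact (e ξ).2

end EllTwoSpace

/-! ### Coordinatewise limits and the σ-completeness of `ℓ²(X)` -/

section EllTwoComplete

variable {M : Type u} [Membership M M] [ZF M] {X : M} {R : M} [Field (El R)]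
  [LinearOrder (El R)] [IsReals R] {L : InnerSpace R}

/-- A coordinate function has a limit along a decreasing sequence of sets on which its
oscillation tends to `0`. -/
theorem exists_limit {V : Type*} [DefType M V] {α : Type*} [DefType M α] {r : V → α → El R}
    (hr : Df M fun z : V × α => r z.1 z.2) {A : Nats M → V → Prop}
    (hA : Df M fun z : Nats M × V => A z.1 z.2) (hne : ∀ n, ∃ ξ, A n ξ)
    (hmono : ∀ m n, m ≤ n → ∀ ξ, A n ξ → A m ξ)
    (hc : ∀ a ε, 0 < ε → ∃ n, ∀ ξ ζ, A n ξ → A n ζ → r ξ a - r ζ a ≤ ε) :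
    ∃ l : α → El R, Df M l ∧ ∀ a ε, 0 < ε → ∃ n, ∀ ξ, A n ξ → |r ξ a - l a| ≤ ε := by
  have hp : Df M fun z : α × El R => ∃ n, ∀ ξ, A n ξ → z.2 ≤ r ξ z.1 := by
    have h1 : Df M fun w : ((α × El R) × Nats M) × V => A w.1.2 w.2 :=
      Df.comp (g := fun z : Nats M × V => A z.1 z.2) hA
        (by fun_prop : Df M fun w : ((α × El R) × Nats M) × V => (w.1.2, w.2))
    have h2 : Df M fun w : ((α × El R) × Nats M) × V => r w.2 w.1.1.1 :=
      Df.comp (g := fun z : V × α => r z.1 z.2) hr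
        (by fun_prop : Df M fun w : ((α × El R) × Nats M) × V => (w.2, w.1.1.1))
    fun_prop
  have key : ∀ a ε n ξ, (∀ ξ ζ, A n ξ → A n ζ → r ξ a - r ζ a ≤ ε) → A n ξ →
      ∀ t, (∃ n, ∀ ξ, A n ξ → t ≤ r ξ a) → t ≤ r ξ a + ε := by
    rintro a ε n ξ h1 hξ t ⟨m, hm⟩
    obtain ⟨ζ, hζ⟩ := hne (max m n)
    have h2 := hm ζ (hmono _ _ (le_max_left _ _) _ hζ)
    have h3 := h1 ζ ξ (hmono _ _ (le_max_right _ _) _ hζ) hξ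
    linarith
  -- The limit is taken to be the supremum of the eventual lower bounds, a canonical value that is
  -- definable in `a`.
  have hex : ∀ a, ∃ l : El R, (∀ t, (∃ n, ∀ ξ, A n ξ → t ≤ r ξ a) → t ≤ l) ∧
      ∀ b, (∀ t, (∃ n, ∀ ξ, A n ξ → t ≤ r ξ a) → t ≤ b) → l ≤ b := by
    intro a
    obtain ⟨n, hn⟩ := hc a 1 one_pos
    obtain ⟨ξ, hξ⟩ := hne n
    exact exists_isLUB (p := fun t => ∃ n, ∀ ξ, A n ξ → t ≤ r ξ a)
      (Df.comp (g := fun z : α × El R => ∃ n, ∀ ξ, A n ξ → z.2 ≤ r ξ z.1) hp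
        (by fun_prop : Df M fun t : El R => (a, t)))
      ⟨r ξ a - 1, n, fun ζ hζ => by linarith [hn ξ ζ hξ hζ]⟩ (fun t ht => key a 1 n ξ hn hξ t ht)
  choose l h1 h2 using hex
  refine ⟨l, Df.of_iff (p := fun a l => (∀ t, (∃ n, ∀ ξ, A n ξ → t ≤ r ξ a) → t ≤ l) ∧
      ∀ b, (∀ t, (∃ n, ∀ ξ, A n ξ → t ≤ r ξ a) → t ≤ b) → l ≤ b)
      (fun a t => ⟨by rintro rfl; exact ⟨h1 a, h2 a⟩, fun ht =>
        le_antisymm (h2 a t ht.1) (ht.2 _ (h1 a))⟩) ?_, fun a ε hε => ?_⟩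
  · have h3 : Df M fun w : (α × El R) × El R => ∃ n, ∀ ξ, A n ξ → w.2 ≤ r ξ w.1.1 :=
      Df.comp (g := fun z : α × El R => ∃ n, ∀ ξ, A n ξ → z.2 ≤ r ξ z.1) hp
        (by fun_prop : Df M fun w : (α × El R) × El R => (w.1.1, w.2))
    have h4 : Df M fun w : ((α × El R) × El R) × El R => ∃ n, ∀ ξ, A n ξ → w.2 ≤ r ξ w.1.1.1 :=
      Df.comp (g := fun z : α × El R => ∃ n, ∀ ξ, A n ξ → z.2 ≤ r ξ z.1) hp
        (by fun_prop : Df M fun w : ((α × El R) × El R) × El R => (w.1.1.1, w.2))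
    fun_prop
  · obtain ⟨n, hn⟩ := hc a ε hε
    refine ⟨n, fun ξ hξ => abs_le.2 ⟨?_, ?_⟩⟩
    · have := h2 a _ (key a ε n ξ hn hξ)
      linarith
    · have := h1 a (r ξ a - ε) ⟨n, fun ζ hζ => by linarith [hn ξ ζ hξ hζ]⟩
      linarith

/-! ### Evaluation of the vectors of `ℓ²(X)` -/

variable (X L) in
/-- The identification of the vectors of `L` with the square-summable functions on `X`. -/
structure EvalMap where
  ev : L.Vec → El X → Cx R
  df : Df M fun z : L.Vec × El X => ev z.1 z.2
  ext : ∀ ξ ζ, (∀ x, ev ξ x = ev ζ x) → ξ = ζ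
  sqSum : ∀ ξ, SqSum (ev ξ)
  surj : ∀ η, Df M η → SqSum η → ∃ ξ, ∀ x, ev ξ x = η x
  add : ∀ ξ ζ x, ev (ξ + ζ) x = ev ξ x + ev ζ x
  smul : ∀ (c : Cx R) ξ x, ev (c • ξ) x = c * ev ξ x
  hasNetSum : ∀ ξ ζ, HasNetSum (fun x => ev ξ x * star (ev ζ x)) (L.inner ξ ζ)

theorem IsEllTwo.nonempty_evalMap (h : IsEllTwo X L) : Nonempty (EvalMap X L) := by
  obtain ⟨ev, he, hsq, hadd, hsmul, hsum⟩ := h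
  simp only [isSqSummable_iff] at hsq
  refine ⟨⟨ev, df_of_mem_iff fun ξ m => ?_, fun ξ ζ h => ?_, fun ξ => ((hsq _).2 ⟨ξ, rfl⟩).2,
    fun η h1 h2 => ?_, hadd, hsmul, hsum⟩⟩
  · rw [he]
    simp only [SetType.cd_eq_code]
  · exact Subtype.ext (ext_mem fun m => by simp only [he, h])
  · obtain ⟨ξ, rfl⟩ := (hsq η).1 ⟨h1, h2⟩
    exact ⟨ξ, fun _ => rfl⟩

namespace EvalMap

variable (h : EvalMap X L)

@[fun_prop] theorem df_ev {α : Type*} [DefType M α] {f : α → L.Vec} {g : α → El X} (hf : Df M f)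
    (hg : Df M g) : Df M fun a => h.ev (f a) (g a) := h.df.comp (hf.prodMk hg)

theorem df_ev_left (ξ : L.Vec) : Df M (h.ev ξ) := (by fun_prop : Df M fun x => h.ev ξ x)

theorem zero (x : El X) : h.ev 0 x = 0 := by
  rw [← zero_smul (Cx R) (0 : L.Vec), h.smul, zero_mul]

theorem neg (ξ : L.Vec) (x : El X) : h.ev (-ξ) x = -h.ev ξ x := by
  rw [← neg_one_smul (Cx R) ξ, h.smul, neg_one_mul]

theorem sub (ξ ζ : L.Vec) (x : El X) : h.ev (ξ - ζ) x = h.ev ξ x - h.ev ζ x := by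
  rw [sub_eq_add_neg, h.add, h.neg, sub_eq_add_neg]

theorem df_absSq (ξ : L.Vec) : Df M fun x => absSq (h.ev ξ x) := by fun_prop

theorem netSum_normSq (ξ : L.Vec) : NetSum (fun x => absSq (h.ev ξ x)) (L.normSq ξ) := by
  exact ((hasNetSum_iff (by fun_prop)).1 (h.hasNetSum ξ ξ)).1.congr
    (fun x => by rw [mul_star_eq]; rfl) rfl

theorem fsum_le_normSq (ξ : L.Vec) (F : FinSub X) :
    fsum (fun x => absSq (h.ev ξ x)) F ≤ L.normSq ξ :=
  (h.netSum_normSq ξ).fsum_le (h.df_absSq ξ) (fun _ => absSq_nonneg _) F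

theorem absSq_le_normSq (ξ : L.Vec) (x : El X) : absSq (h.ev ξ x) ≤ L.normSq ξ :=
  (le_fsum (h.df_absSq ξ) (fun _ => absSq_nonneg _) (FinSub.mem_insert.2 (Or.inr rfl))).trans
    (h.fsum_le_normSq ξ (FinSub.insert x ∅))

theorem normSq_le {ξ : L.Vec} {B : El R} (hB : ∀ F, fsum (fun x => absSq (h.ev ξ x)) F ≤ B) :
    L.normSq ξ ≤ B :=
  (h.netSum_normSq ξ).le (h.df_absSq ξ) hB

theorem exists_pointwise_limit {A : Nats M → L.Vec → Prop}
    (hA : Df M fun z : Nats M × L.Vec => A z.1 z.2) (hne : ∀ n, ∃ ξ, A n ξ)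
    (hmono : ∀ m n, m ≤ n → ∀ ξ, A n ξ → A m ξ)
    (hc : ∀ ε, 0 < ε → ∃ n, ∀ ξ ζ, A n ξ → A n ζ → L.normSq (ξ - ζ) < ε ^ 2) :
    ∃ η : El X → Cx R, Df M η ∧ ∀ x ε, 0 < ε → ∃ n, ∀ ξ, A n ξ → absSq (η x - h.ev ξ x) ≤ ε := by
  have hc' : ∀ ε, 0 < ε → ∃ n, ∀ ξ ζ, A n ξ → A n ζ → ∀ x, (h.ev ξ x).re - (h.ev ζ x).re ≤ ε ∧
      (h.ev ξ x).im - (h.ev ζ x).im ≤ ε := by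
    intro ε hε
    obtain ⟨n, hn⟩ := hc ε hε
    refine ⟨n, fun ξ ζ hξ hζ x => ?_⟩
    have h1 := (h.absSq_le_normSq (ξ - ζ) x).trans_lt (hn ξ ζ hξ hζ)
    rw [h.sub] at h1
    simp only [absSq, QuadraticAlgebra.re_sub, QuadraticAlgebra.im_sub] at h1
    exact ⟨(abs_le_of_sq_le_sq' (by nlinarith [sq_nonneg ((h.ev ξ x).im - (h.ev ζ x).im)]) hε.le).2,
      (abs_le_of_sq_le_sq' (by nlinarith [sq_nonneg ((h.ev ξ x).re - (h.ev ζ x).re)]) hε.le).2⟩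
  obtain ⟨a, ha, ha'⟩ := exists_limit (r := fun ξ x => (h.ev ξ x).re) (by fun_prop) hA hne hmono
    fun x ε hε => by
      obtain ⟨n, hn⟩ := hc' ε hε
      exact ⟨n, fun ξ ζ hξ hζ => (hn ξ ζ hξ hζ x).1⟩
  obtain ⟨b, hb, hb'⟩ := exists_limit (r := fun ξ x => (h.ev ξ x).im) (by fun_prop) hA hne hmono
    fun x ε hε => by
      obtain ⟨n, hn⟩ := hc' ε hε
      exact ⟨n, fun ξ ζ hξ hζ => (hn ξ ζ hξ hζ x).2⟩
  refine ⟨fun x => ⟨a x, b x⟩, by fun_prop, fun x ε hε => ?_⟩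
  obtain ⟨δ, hδ, hδ'⟩ := exists_sq_eq (show 0 < ε / 2 by positivity)
  obtain ⟨m, hm⟩ := ha' x δ hδ
  obtain ⟨n, hn⟩ := hb' x δ hδ
  refine ⟨max m n, fun ξ hξ => ?_⟩
  have h1 := hm ξ (hmono _ _ (le_max_left _ _) _ hξ)
  have h2 := hn ξ (hmono _ _ (le_max_right _ _) _ hξ)
  have h3 := sq_le_sq' (abs_le.1 h1).1 (abs_le.1 h1).2
  have h4 := sq_le_sq' (abs_le.1 h2).1 (abs_le.1 h2).2
  simp only [absSq, QuadraticAlgebra.re_sub, QuadraticAlgebra.im_sub]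
  linarith [sub_sq_comm (a x) (h.ev ξ x).re, sub_sq_comm (b x) (h.ev ξ x).im]

/-- Coordinatewise convergence is uniform over finitely many coordinates, by induction on `F`. -/
theorem fsum_sub_le {A : Nats M → L.Vec → Prop} (hA : Df M fun z : Nats M × L.Vec => A z.1 z.2)
    (hmono : ∀ m n, m ≤ n → ∀ ξ, A n ξ → A m ξ) {η : El X → Cx R} (hη : Df M η)
    (hlim : ∀ x ε, 0 < ε → ∃ n, ∀ ξ, A n ξ → absSq (η x - h.ev ξ x) ≤ ε) (F : FinSub X) :
    ∀ ε, 0 < ε → ∃ n, ∀ ξ, A n ξ → fsum (fun x => absSq (η x - h.ev ξ x)) F ≤ ε := by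
  have hd : ∀ ξ, Df M fun x => absSq (η x - h.ev ξ x) := fun ξ => by fun_prop
  refine FinSub.ind (p := fun F => ∀ ε, 0 < ε → ∃ n, ∀ ξ, A n ξ →
    fsum (fun x => absSq (η x - h.ev ξ x)) F ≤ ε) ?_ ?_ (fun x F hx ih ε hε => ?_) F
  · have h2 : Df M fun w : ((FinSub X × El R) × Nats M) × L.Vec => A w.1.2 w.2 :=
      Df.comp (g := fun z : Nats M × L.Vec => A z.1 z.2) hA
        (by fun_prop : Df M fun w : ((FinSub X × El R) × Nats M) × L.Vec => (w.1.2, w.2))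
    fun_prop
  · exact fun ε hε => ⟨0, fun ξ _ => by rw [fsum_empty (hd ξ)]; exact hε.le⟩
  · obtain ⟨m, hm⟩ := ih (ε / 2) (by positivity)
    obtain ⟨n, hn⟩ := hlim x (ε / 2) (by positivity)
    refine ⟨max m n, fun ξ hξ => ?_⟩
    have h1 := hm ξ (hmono _ _ (le_max_left _ _) _ hξ)
    have h2 := hn ξ (hmono _ _ (le_max_right _ _) _ hξ)
    rw [fsum_insert (hd ξ) hx]
    linarith

theorem isSigmaComplete (h : EvalMap X L) : L.IsSigmaComplete := by
  intro A hA hne hcl hmono hdiam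
  rw [inModel_iff] at hA
  have hmono' : ∀ m n : Nats M, m ≤ n → ∀ ξ, ξ ∈ A n → ξ ∈ A m := by
    intro m n hmn ξ hξ
    rcases hmn.lt_or_eq with h1 | rfl
    · exact hmono m n h1 hξ
    · exact hξ
  have hdiam' : ∀ ε : El R, 0 < ε → ∃ n, ∀ ξ ζ, ξ ∈ A n → ζ ∈ A n → L.normSq (ξ - ζ) < ε ^ 2 :=
    fun ε hε => (hdiam ε hε).imp fun n hn ξ ζ hξ hζ => hn ξ hξ ζ hζ
  obtain ⟨η, hη, hlim⟩ := h.exists_pointwise_limit (A := fun n ξ => ξ ∈ A n) hA hne hmono' hdiam'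
  have hfs := h.fsum_sub_le (A := fun n ξ => ξ ∈ A n) hA hmono' hη hlim
  have hd : ∀ ξ, Df M (h.ev ξ) := h.df_ev_left
  -- Compare `ξ` with a `ζ` taken so far along the sequence that it is `ε`-close to `η` on `F`: the
  -- sum is at most `2(ε^2 + ε^2)`. The index `n` does not depend on `F`, although `ζ` does.
  have hb : ∀ ε, 0 < ε → ∃ n, ∀ ξ ∈ A n, ∀ F,
      fsum (fun x => absSq (η x - h.ev ξ x)) F ≤ 4 * ε ^ 2 := by
    intro ε hε
    obtain ⟨n, hn⟩ := hdiam' ε hε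
    refine ⟨n, fun ξ hξ F => ?_⟩
    obtain ⟨m, hm⟩ := hfs F (ε ^ 2) (by positivity)
    obtain ⟨ζ, hζ⟩ := hne (max m n)
    have h1 := hm ζ (hmono' _ _ (le_max_left _ _) _ hζ)
    have h2 := hn ζ ξ (hmono' _ _ (le_max_right _ _) _ hζ) hξ
    have h3 := h.fsum_le_normSq (ζ - ξ) F
    simp only [h.sub] at h3
    have h4 := fsum_le_fsum (g := fun x => absSq (η x - h.ev ξ x))
      (h := fun x => 2 * (absSq (η x - h.ev ζ x) + absSq (h.ev ζ x - h.ev ξ x))) (by fun_prop)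
      (by fun_prop) (fun x => by
        have := absSq_add_le (η x - h.ev ζ x) (h.ev ζ x - h.ev ξ x)
        rwa [sub_add_sub_cancel] at this) F
    rw [fsum_const_mul (by fun_prop), fsum_add (by fun_prop) (by fun_prop)] at h4
    linarith
  -- `η` is square-summable as the sum of `η - ξ` and `ξ`, so it is a vector.
  obtain ⟨θ, hθ⟩ : ∃ θ, ∀ x, h.ev θ x = η x := by
    refine h.surj η hη ?_
    obtain ⟨n, hn⟩ := hb 1 one_pos
    obtain ⟨ξ, hξ⟩ := hne n
    have : SqSum fun x => (η x - h.ev ξ x) + h.ev ξ x :=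
      SqSum.add (by fun_prop) (hd ξ) ⟨_, hn ξ hξ⟩ (h.sqSum ξ)
    simpa only [sub_add_cancel] using this
  refine ⟨θ, fun m => hcl m θ fun ε hε => ?_⟩
  obtain ⟨n, hn⟩ := hb (ε / 4) (by positivity)
  obtain ⟨ξ, hξ⟩ := hne (max m n)
  refine ⟨ξ, hmono' _ _ (le_max_left _ _) _ hξ, ?_⟩
  have h1 : L.normSq (θ - ξ) ≤ 4 * (ε / 4) ^ 2 := h.normSq_le fun F => by
    simp only [h.sub, hθ]
    exact hn ξ (hmono' _ _ (le_max_right _ _) _ hξ) F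
  have : 0 < ε ^ 2 := by positivity
  nlinarith

end EvalMap

end EllTwoComplete

/-! ### Ascending families of subspaces -/

namespace InnerSpace

variable {M : Type u} [Membership M M] [ZF M] {R : M} [Field (El R)] [LinearOrder (El R)]
  [IsReals R] {H : InnerSpace R}

/-- `s` is a linear subspace. -/
def IsLinear (s : H.Vec → Prop) : Prop := s 0 ∧ ∀ (c : Cx R) x y, s x → s y → s (x - c • y)

@[fun_prop] theorem _root_.ZFModel.Df.isLinear {α : Type*} [DefType M α] {s : α → H.Vec → Prop}
    (hs : Df M fun z : α × H.Vec => s z.1 z.2) : Df M fun a => IsLinear (s a) := by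
  unfold IsLinear
  have h0 : Df M fun a => s a 0 := Df.comp (g := fun z : α × H.Vec => s z.1 z.2) hs
    (by fun_prop : Df M fun a => (a, (0 : H.Vec)))
  have h1 : Df M fun w : ((α × Cx R) × H.Vec) × H.Vec => s w.1.1.1 w.1.2 :=
    Df.comp (g := fun z : α × H.Vec => s z.1 z.2) hs
      (by fun_prop : Df M fun w : ((α × Cx R) × H.Vec) × H.Vec => (w.1.1.1, w.1.2))
  have h2 : Df M fun w : ((α × Cx R) × H.Vec) × H.Vec => s w.1.1.1 w.2 :=
    Df.comp (g := fun z : α × H.Vec => s z.1 z.2) hs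
      (by fun_prop : Df M fun w : ((α × Cx R) × H.Vec) × H.Vec => (w.1.1.1, w.2))
  have h3 : Df M fun w : ((α × Cx R) × H.Vec) × H.Vec => s w.1.1.1 (w.1.2 - w.1.1.2 • w.2) :=
    Df.comp (g := fun z : α × H.Vec => s z.1 z.2) hs
      (by fun_prop : Df M fun w : ((α × Cx R) × H.Vec) × H.Vec =>
        (w.1.1.1, w.1.2 - w.1.1.2 • w.2))
  fun_prop

variable (ι : Type*) [Coded M ι] [DefType M ι] [SetType M ι]

/-- Every family of subspaces of `U` indexed by `ι` has a maximal member. -/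
def IsNoetherian (U : H.Vec → Prop) : Prop :=
  ∀ Q : PSet M (ι × H.Vec), (∀ i, IsLinear fun x => Q.Has (i, x)) →
    (∀ i x, Q.Has (i, x) → U x) →
    ∃ i, ∀ j, (∀ x, Q.Has (i, x) → Q.Has (j, x)) → ∀ x, Q.Has (j, x) → Q.Has (i, x)

@[fun_prop] theorem _root_.ZFModel.Df.isNoetherian {α : Type*} [DefType M α]
    {U : α → H.Vec → Prop} (hU : Df M fun z : α × H.Vec => U z.1 z.2) :
    Df M fun a => IsNoetherian ι (U a) := by
  unfold IsNoetherian
  have h1 : Df M fun w : ((α × PSet M (ι × H.Vec)) × ι) × H.Vec => U w.1.1.1 w.2 :=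
    Df.comp (g := fun z : α × H.Vec => U z.1 z.2) hU
      (by fun_prop : Df M fun w : ((α × PSet M (ι × H.Vec)) × ι) × H.Vec => (w.1.1.1, w.2))
  have h2 : Df M fun w : (α × PSet M (ι × H.Vec)) × ι =>
      IsLinear fun x => w.1.2.Has (w.2, x) :=
    Df.isLinear (by fun_prop)
  fun_prop

variable {ι}

theorem isNoetherian_of_zero [Nonempty ι] {U : H.Vec → Prop} (h : ∀ x, U x → x = 0) :
    IsNoetherian ι U := fun Q hQ hU =>
  ⟨Classical.arbitrary ι, fun j _ x hx => by rw [h x (hU j x hx)]; exact (hQ _).1⟩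

/-- A subspace of `U'` exceeds its intersection with `U` by at most one dimension. Past an index `i`
where the intersections are maximal, a chain can therefore grow only once: given `i < j < k`, a
vector of the `k`-th space is reduced modulo one of the `j`-th into `U`, hence into the `i`-th. -/
theorem IsNoetherian.step {U U' : H.Vec → Prop} (hU : Df M U)
    (hl : IsLinear U) (hN : IsNoetherian ι U) (w : H.Vec)
    (hU' : ∀ x, U' x → ∃ c : Cx R, U (x - c • w)) : IsNoetherian ι U' := by
  intro Q hQ hQU
  obtain ⟨P, hP⟩ := exists_pset (M := M) (p := fun z : ι × H.Vec => Q.Has z ∧ U z.2) (by fun_prop)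
  obtain ⟨i, hi⟩ := hN P (fun i => by
    simp only [hP]
    exact ⟨⟨(hQ i).1, hl.1⟩, fun c x y hx hy => ⟨(hQ i).2 c x y hx.1 hy.1,
      hl.2 c x y hx.2 hy.2⟩⟩) (fun i x hx => ((hP _).1 hx).2)
  simp only [hP] at hi
  by_contra hc
  push Not at hc
  obtain ⟨j, hij, v, hv, hvi⟩ := hc i
  obtain ⟨k, hjk, x, hx, hxj⟩ := hc j
  have hk := hi k (fun y hy => ⟨hjk y (hij y hy.1), hy.2⟩)
  obtain ⟨c, hc'⟩ := hU' v (hQU j v hv)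
  obtain ⟨d, hd⟩ := hU' x (hQU k x hx)
  have hc0 : c ≠ 0 := by
    rintro rfl
    rw [zero_smul, sub_zero] at hc'
    exact hvi (hi j (fun y hy => ⟨hij y hy.1, hy.2⟩) v ⟨hv, hc'⟩).1
  obtain ⟨b, hb⟩ := exists_mul_eq_one hc0
  -- The coefficient `d / c` cancels the `w`-components of `x` and `v`.
  have h1 : U (x - (d * b) • v) := by
    have h2 := hl.2 (d * b) _ _ hd hc'
    rwa [smul_sub, smul_smul, mul_assoc, hb, mul_one, sub_sub_sub_cancel_right] at h2
  have h3 := hij _ (hk _ ⟨(hQ k).2 (d * b) x v hx (hjk v hv), h1⟩).1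
  have h4 := (hQ j).2 (-(d * b)) _ _ h3 hv
  rw [neg_smul, sub_neg_eq_add, sub_add_cancel] at h4
  exact hxj h4

/-- The spanning vectors are adjoined one at a time, starting from the zero space and using
`IsNoetherian.step`. The resulting subspace lies in the model, so finite-dimensionality forces it to
be everything. -/
theorem IsFiniteDimensional.isNoetherian [Nonempty ι]
    (h : H.IsFiniteDimensional) : IsNoetherian ι fun _ : H.Vec => True := by
  obtain ⟨F, hF⟩ := h
  have key : ∃ U : PSet M H.Vec, IsLinear U.Has ∧ (∀ x : H.Vec, x.1 ∈ F.1 → U.Has x) ∧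
      IsNoetherian ι U.Has := by
    refine FinSub.ind (p := fun F => ∃ U : PSet M H.Vec, IsLinear U.Has ∧
      (∀ x : H.Vec, x.1 ∈ F.1 → U.Has x) ∧ IsNoetherian ι U.Has) ?_ ?_ ?_ F
    · have h1 : Df M fun z : FinSub H.carrier × PSet M H.Vec => IsLinear z.2.Has :=
        Df.isLinear (by fun_prop)
      have h2 : Df M fun z : FinSub H.carrier × PSet M H.Vec => IsNoetherian ι z.2.Has :=
        Df.isNoetherian ι (by fun_prop)
      fun_prop
    · obtain ⟨U, hU⟩ := exists_pset (M := M) (p := fun x : H.Vec => x = 0) (by fun_prop)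
      refine ⟨U, ⟨(hU _).2 rfl, fun c x y hx hy => ?_⟩, fun x hx => absurd hx (notMem_emp _),
        isNoetherian_of_zero fun x hx => (hU x).1 hx⟩
      rw [hU] at hx hy ⊢
      rw [hx, hy, smul_zero, sub_zero]
    · rintro w F - ⟨U, h1, h2, h3⟩
      obtain ⟨V, hV⟩ := exists_pset (M := M) (p := fun x : H.Vec => ∃ c : Cx R, U.Has (x - c • w))
        (by fun_prop)
      refine ⟨V, ⟨(hV _).2 ⟨0, by rw [zero_smul, sub_zero]; exact h1.1⟩, fun c x y hx hy => ?_⟩,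
        fun x hx => (hV _).2 ?_, h3.step U.df h1 w fun x hx => (hV x).1 hx⟩
      · obtain ⟨a, ha⟩ := (hV _).1 hx
        obtain ⟨b, hb⟩ := (hV _).1 hy
        refine (hV _).2 ⟨a - c * b, ?_⟩
        have := h1.2 c _ _ ha hb
        rwa [smul_sub, smul_smul, sub_sub_sub_comm, ← sub_smul] at this
      · rcases FinSub.mem_insert.1 hx with hx | hx
        · exact ⟨0, by rw [zero_smul, sub_zero]; exact h2 x hx⟩
        · rw [show x = w from Subtype.ext hx]
          exact ⟨1, by rw [one_smul, sub_self]; exact h1.1⟩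
  obtain ⟨U, h1, h2, h3⟩ := key
  let K : Submodule (Cx R) H.Vec :=
    { carrier := {x | U.Has x}
      add_mem' := fun {x y} hx hy => by
        have := h1.2 (-1) x y hx hy
        rwa [neg_one_smul, sub_neg_eq_add] at this
      zero_mem' := h1.1
      smul_mem' := fun c x hx => by
        have := h1.2 (-c) 0 x h1.1 hx
        rwa [neg_smul, sub_neg_eq_add, zero_add] at this }
  have hK : K = ⊤ := hF K (inModel_iff.2 U.df) h2
  have hU : U.Has = fun _ => True := funext fun x => eq_true (by
    have : x ∈ K := by rw [hK]; trivial
    exact this)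
  rwa [hU] at h3

end InnerSpace

section EllTwoSupports

variable {M : Type u} [Membership M M] [ZF M] {X : M} {R : M} [Field (El R)]
  [LinearOrder (El R)] [IsReals R] {L : InnerSpace R}

/-! ### Vectors with finite support -/

/-- Points outside the support contribute nothing, so `F` may be replaced by its intersection with
`G`. Hence finitely supported functions are square-summable. -/
theorem fsum_eq_of_support {g : El X → El R} (hg : Df M g) {G : FinSub X}
    (h0 : ∀ x, x.1 ∉ G.1 → g x = 0) (F : FinSub X) :
    ∀ K : FinSub X, (∀ z, z ∈ K.1 ↔ z ∈ F.1 ∧ z ∈ G.1) → fsum g F = fsum g K := by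
  refine FinSub.ind (p := fun F => ∀ K : FinSub X, (∀ z, z ∈ K.1 ↔ z ∈ F.1 ∧ z ∈ G.1) →
    fsum g F = fsum g K) ?_ (fun K hK => ?_) (fun x F hx ih K hK => ?_) F
  · have := df_fsum hg
    fun_prop
  · rw [FinSub.ext (F := ∅) (G := K) fun z => by
      rw [hK]; exact (and_iff_left_of_imp fun h => absurd h (notMem_emp z)).symm]
  · rw [fsum_insert hg hx]
    by_cases hxG : x.1 ∈ G.1
    · have hxK : x.1 ∈ K.1 := (hK _).2 ⟨FinSub.mem_insert.2 (Or.inr rfl), hxG⟩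
      rw [← FinSub.insert_erase hxK, fsum_insert hg fun h => (FinSub.mem_erase.1 h).2 rfl,
        ih (FinSub.erase x K) fun z => ?_]
      rw [FinSub.mem_erase, hK, FinSub.mem_insert]
      constructor
      · rintro ⟨⟨h1 | h1, h2⟩, h3⟩
        · exact ⟨h1, h2⟩
        · exact absurd h1 h3
      · exact fun h => ⟨⟨Or.inl h.1, h.2⟩, fun e => hx (e ▸ h.1)⟩
    · rw [h0 x hxG, add_zero]
      refine ih K fun z => ?_
      rw [hK, FinSub.mem_insert]
      constructor
      · rintro ⟨h1 | h1, h2⟩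
        · exact ⟨h1, h2⟩
        · exact absurd (h1 ▸ h2) hxG
      · exact fun h => ⟨Or.inl h.1, h.2⟩

theorem sqSum_of_support {η : El X → Cx R} (hη : Df M η) {G : FinSub X}
    (h0 : ∀ x, x.1 ∉ G.1 → η x = 0) : SqSum η := by
  have hd : Df M fun x => absSq (η x) := by fun_prop
  refine ⟨fsum (fun x => absSq (η x)) G, fun F => ?_⟩
  obtain ⟨K, hK⟩ := F.exists_sep (p := fun z => z ∈ G.1) (by fun_prop)
  rw [fsum_eq_of_support hd (G := G) (fun x hx => by rw [h0 x hx, absSq_zero]) F K hK]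
  exact fsum_mono hd (fun x => absSq_nonneg _) fun z hz => ((hK z).1 hz).2

namespace EvalMap

open InnerSpace

variable (h : EvalMap X L)

/-- The indicator function of a finite set. -/
theorem exists_indicator {p : M → Prop} (hp : Df M p) (G : FinSub X) (hG : ∀ z, p z → z ∈ G.1) :
    ∃ ξ, ∀ x : El X, (p x.1 → h.ev ξ x = 1) ∧ (¬ p x.1 → h.ev ξ x = 0) := by
  classical
  obtain ⟨ξ, hξ⟩ := h.surj (fun x => if p x.1 then 1 else 0) (by fun_prop)
    (sqSum_of_support (by fun_prop) (G := G) fun x hx => if_neg fun hx' => hx (hG _ hx'))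
  exact ⟨ξ, fun x => ⟨fun hx => by rw [hξ, if_pos hx], fun hx => by rw [hξ, if_neg hx]⟩⟩

/-- The indicator function of a point. -/
theorem exists_single (y : El X) :
    ∃ ξ, h.ev ξ y = 1 ∧ ∀ x : El X, x.1 ≠ y.1 → h.ev ξ x = 0 := by
  obtain ⟨ξ, hξ⟩ := h.exists_indicator (p := fun z => z = y.1) (by fun_prop)
    (FinSub.insert y ∅) (fun z hz => FinSub.mem_insert.2 (Or.inr hz))
  exact ⟨ξ, (hξ y).1 rfl, fun x => (hξ x).2⟩

theorem df_supported : Df M fun z : FinSub X × L.Vec => ∀ x : El X, x.1 ∉ z.1.1 → h.ev z.2 x = 0 := by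
  fun_prop

theorem isLinear_supported (A : M) :
    IsLinear fun ξ : L.Vec => ∀ x : El X, x.1 ∉ A → h.ev ξ x = 0 :=
  ⟨fun x _ => h.zero x, fun c ξ ζ hξ hζ x hx => by
    rw [h.sub, h.smul, hξ x hx, hζ x hx, mul_zero, sub_zero]⟩

/-- The space of the vectors supported on a finite set is Noetherian. -/
theorem isNoetherian_supported {ι : Type*} [Coded M ι] [DefType M ι] [SetType M ι] [Nonempty ι]
    (A : FinSub X) : IsNoetherian ι fun ξ : L.Vec => ∀ x : El X, x.1 ∉ A.1 → h.ev ξ x = 0 := by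
  refine FinSub.ind (p := fun A : FinSub X =>
    IsNoetherian ι fun ξ : L.Vec => ∀ x : El X, x.1 ∉ A.1 → h.ev ξ x = 0)
    (Df.isNoetherian ι h.df_supported) (isNoetherian_of_zero fun ξ hξ => ?_)
    (fun y A _ ih => ?_) A
  · exact h.ext _ _ fun x => by rw [hξ x (notMem_emp _), h.zero]
  · obtain ⟨δ, hδ, hδ'⟩ := h.exists_single y
    refine ih.step (h.df_supported.comp (by fun_prop : Df M fun ξ : L.Vec => (A, ξ)))
      (h.isLinear_supported A.1) δ fun ξ hξ => ⟨h.ev ξ y, fun x hx => ?_⟩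
    rw [h.sub, h.smul]
    by_cases hxy : x.1 = y.1
    · rw [show x = y from Subtype.ext hxy, hδ, mul_one, sub_self]
    · rw [hδ' x hxy, mul_zero, sub_zero]
      exact hξ x fun hx' => (FinSub.mem_insert.1 hx').elim hx hxy

/-- `ℓ²(X)` is infinite-dimensional if `X` is infinite. -/
theorem not_isFiniteDimensional (h : EvalMap X L) (hX : ¬ IsFin X) : ¬ L.IsFiniteDimensional := by
  intro hL
  obtain ⟨Q, hQ⟩ := exists_pset h.df_supported
  have : Nonempty (FinSub X) := ⟨∅⟩
  -- The family is indexed by `Fin(X)` itself: the vectors supported on `A`. If `A` gave a maximal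
  -- member, adding a point of `X` outside `A` would contradict it.
  obtain ⟨A, hA⟩ := hL.isNoetherian (ι := FinSub X) Q (fun A => by
    simp only [hQ]
    exact h.isLinear_supported A.1) (fun _ _ _ => trivial)
  simp only [hQ] at hA
  obtain ⟨y, hy⟩ : ∃ y : El X, y.1 ∉ A.1 := by
    by_contra hc
    push Not at hc
    refine hX ?_
    rw [show X = A.1 from ext_mem fun z => ⟨fun hz => hc ⟨z, hz⟩, A.2.1 z⟩]
    exact A.2.2
  obtain ⟨δ, hδ, hδ'⟩ := h.exists_single y
  have h1 := hA (FinSub.insert y A) (fun ξ hξ x hx => hξ x fun hx' =>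
    hx (FinSub.mem_insert.2 (Or.inl hx'))) δ (fun x hx =>
      hδ' x fun e => hx (FinSub.mem_insert.2 (Or.inr e))) y hy
  rw [hδ] at h1
  exact one_ne_zero h1

/-- There is no infinite orthonormal sequence of vectors supported on a finite set. -/
theorem exists_notMem_support {e : Nats M → L.Vec} (he : Df M e)
    (h1 : ∀ n, L.inner (e n) (e n) = 1) (h0 : ∀ m n, m ≠ n → L.inner (e m) (e n) = 0)
    (A : FinSub X) : ∃ n, ∃ x : El X, x.1 ∉ A.1 ∧ h.ev (e n) x ≠ 0 := by
  by_contra hc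
  push Not at hc
  have hd : Df M fun z : Nats M × L.Vec => ∀ x : El X, x.1 ∉ A.1 → h.ev z.2 x = 0 :=
    h.df_supported.comp (by fun_prop : Df M fun z : Nats M × L.Vec => (A, z.2))
  -- The `n`-th space consists of the vectors supported on `A` and orthogonal to all `e m` with `m ≥
  -- n`. These spaces increase strictly, since `e n` enters at stage `n + 1`.
  obtain ⟨Q, hQ⟩ := exists_pset (p := fun z : Nats M × L.Vec =>
    (∀ x : El X, x.1 ∉ A.1 → h.ev z.2 x = 0) ∧ ∀ m, z.1 ≤ m → L.inner z.2 (e m) = 0) (by fun_prop)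
  have : Nonempty (Nats M) := ⟨0⟩
  obtain ⟨n, hn⟩ := h.isNoetherian_supported (ι := Nats M) A Q (fun n => by
    simp only [hQ]
    refine ⟨⟨(h.isLinear_supported A.1).1, fun m _ => InnerSpace.inner_zero_left _⟩, fun c x y hx hy =>
      ⟨(h.isLinear_supported A.1).2 c x y hx.1 hy.1, fun m hm => ?_⟩⟩
    rw [InnerSpace.inner_sub_left, L.inner_smul_left, hx.2 m hm, hy.2 m hm, mul_zero, sub_zero])
    (fun n ξ hξ => ((hQ _).1 hξ).1)
  simp only [hQ] at hn
  have h2 := (hn n.succ (fun ξ hξ => ⟨hξ.1, fun m hm => hξ.2 m (Nats.succ_le.1 hm).le⟩) (e n)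
    ⟨hc n, fun m hm => h0 _ _ (Nats.succ_le.1 hm).ne⟩).2 n le_rfl
  rw [h1] at h2
  exact one_ne_zero h2

/-- A square-summable function is small outside a finite set. -/
theorem exists_large (ξ : L.Vec) {ε : El R} (hε : 0 < ε) :
    ∃ G : FinSub X, ∀ x : El X, x.1 ∈ G.1 ↔ ε ≤ absSq (h.ev ξ x) := by
  have hd := h.df_absSq ξ
  -- Beyond `F` all sums are within `ε / 2` of the limit, so adding one point outside `F` changes
  -- the sum by less than `ε`. All large values thus occur inside `F`.
  obtain ⟨F, hF⟩ := (netSum_iff hd).1 (h.netSum_normSq ξ) (ε / 2) (by positivity)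
  obtain ⟨G, hG⟩ := F.exists_sep (p := fun z => ∃ x : El X, x.1 = z ∧ ε ≤ absSq (h.ev ξ x))
    (by fun_prop)
  refine ⟨G, fun x => ?_⟩
  rw [hG]
  constructor
  · rintro ⟨-, y, hy, h1⟩
    rwa [← show y = x from Subtype.ext hy]
  · refine fun h1 => ⟨?_, x, rfl, h1⟩
    by_contra hx
    have h2 := (abs_lt.1 (hF F fun _ hz => hz)).1
    have h3 := (abs_lt.1 (hF (FinSub.insert x F) fun z hz => FinSub.mem_insert.2 (Or.inl hz))).2
    rw [fsum_insert hd hx] at h3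
    linarith

/-- The finite sets `F m n` on which `|e m|^2 ≥ δ n` exhaust the supports of the sequence. By
`exists_notMem_support` no finite `U` contains them all, so they drive an enlarging map. -/
theorem not_dedekindFinite_of_hasOrthonormalSeq (h : EvalMap X L) (hL : L.HasOrthonormalSeq) :
    ¬ DedekindFinite (FinSub X) := by
  obtain ⟨e, he, h1, h0⟩ := hL
  rw [funInModel_iff] at he
  obtain ⟨δ, hδ, hpos, -, hnull⟩ := exists_null_seq R
  choose F hF using fun m n => h.exists_large (e m) (hpos n)
  have hFd : Df M fun z : Nats M × Nats M => F z.1 z.2 := by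
    refine Df.of_iff (p := fun z G => ∀ x : El X, x.1 ∈ G.1 ↔ δ z.2 ≤ absSq (h.ev (e z.1) x))
      (fun z G => ⟨by rintro rfl; exact hF _ _, fun hG => FinSub.ext fun y => ?_⟩) (by fun_prop)
    constructor
    · exact fun hy => (hG ⟨y, (F z.1 z.2).2.1 y hy⟩).2 ((hF _ _ _).1 hy)
    · exact fun hy => (hF z.1 z.2 ⟨y, G.2.1 y hy⟩).2 ((hG _).1 hy)
  obtain ⟨Φ, hΦ, hΦ'⟩ := exists_enlarges_of_family hFd fun U => by
    obtain ⟨m, x, hx, hne⟩ := h.exists_notMem_support he h1 h0 U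
    obtain ⟨n, hn⟩ := hnull (absSq (h.ev (e m) x))
      (lt_of_le_of_ne (absSq_nonneg _) fun h2 => hne (absSq_eq_zero.1 h2.symm))
    exact ⟨m, n, x.1, (hF m n x).2 hn.le, hx⟩
  exact not_dedekindFinite_of_enlarges hΦ hΦ'

/-- The differences of consecutive members of a strictly increasing sequence of finite sets are
nonempty, finite and pairwise disjoint, so their indicators are nonzero and orthogonal. -/
theorem hasOrthonormalSeq_of_not_dedekindFinite (h : EvalMap X L) (hX : ¬ DedekindFinite (FinSub X)) :
    L.HasOrthonormalSeq := by
  obtain ⟨Φ, hΦ, hΦ'⟩ := exists_enlarges_of_not_dedekindFinite hX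
  obtain ⟨U, hU, hmono, hne⟩ := exists_strictMono_of_enlarges hΦ hΦ'
  choose w hw using fun n : Nats M => h.exists_indicator
    (p := fun z => z ∈ (U n.succ).1 ∧ z ∉ (U n).1) (by fun_prop) (U n.succ) fun z hz => hz.1
  refine hasOrthonormalSeq_of_orthogonal (w := w) (Df.of_iff (p := fun n ξ => ∀ x : El X,
    ((x.1 ∈ (U n.succ).1 ∧ x.1 ∉ (U n).1) → h.ev ξ x = 1) ∧
    (¬ (x.1 ∈ (U n.succ).1 ∧ x.1 ∉ (U n).1) → h.ev ξ x = 0)) (fun n ξ => ⟨by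
      rintro rfl x; exact hw n x, fun hξ => h.ext _ _ fun x => ?_⟩) (by fun_prop))
    (fun n hn => ?_) (fun m n hmn => ?_)
  · by_cases hx : x.1 ∈ (U n.succ).1 ∧ x.1 ∉ (U n).1
    · rw [(hw n x).1 hx, (hξ x).1 hx]
    · rw [(hw n x).2 hx, (hξ x).2 hx]
  · obtain ⟨z, h1, h2⟩ := hne n
    obtain ⟨x, rfl⟩ : ∃ x : El X, x.1 = z := ⟨⟨z, (U n.succ).2.1 z h1⟩, rfl⟩
    have h3 := (hw n x).1 ⟨h1, h2⟩
    rw [hn, h.zero] at h3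
    exact one_ne_zero h3.symm
  · have h1 := h.hasNetSum (w m) (w n)
    have h2 : (fun x => h.ev (w m) x * star (h.ev (w n) x)) = fun _ => 0 := funext fun x => by
      by_cases hx : x.1 ∈ (U m.succ).1 ∧ x.1 ∉ (U m).1
      · rw [(hw n x).2 fun hx' => hx'.2 (hmono _ _ (Nats.succ_le.2 hmn) _ hx.1), star_zero,
          mul_zero]
      · rw [(hw m x).2 hx, zero_mul]
    rw [h2] at h1
    exact h1.unique (by fun_prop) ((hasNetSum_iff (by fun_prop)).2 ⟨netSum_zero, netSum_zero⟩)

end EvalMap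

end EllTwoSupports

end ZFModel

/-! ### The main theorem -/

theorem mainTheorem10 {M : Type u} [Membership M M] [ZFModel.ZF M]
    (R : M) [Field (ZFModel.El R)] [LinearOrder (ZFModel.El R)] [ZFModel.IsReals R] :
    (∀ H : ZFModel.InnerSpace R, H.IsSigmaComplete →
      List.TFAE [H.HasOrthonormalSeq, H.HilbertDedekindInfinite,
        H.HilbertDuallyDedekindInfinite]) ∧
    (∀ X : M, ¬ ZFModel.IsFin X →
      (∃ L : ZFModel.InnerSpace R, ZFModel.IsEllTwo X L ∧ L.IsSigmaComplete) ∧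
      ∀ L : ZFModel.InnerSpace R, ZFModel.IsEllTwo X L →
        List.TFAE [ZFModel.IsCF X, L.IsHDF, L.IsHDDF]) := by
  refine ⟨fun H hH => ZFModel.InnerSpace.tfae_hilbertDedekindInfinite hH, fun X hX => ⟨?_, ?_⟩⟩
  · obtain ⟨L, hL⟩ := ZFModel.exists_isEllTwo X R
    obtain ⟨h⟩ := hL.nonempty_evalMap
    exact ⟨L, hL, h.isSigmaComplete⟩
  · intro L hL
    obtain ⟨h⟩ := hL.nonempty_evalMap
    have h1 := ZFModel.InnerSpace.tfae_hilbertDedekindInfinite h.isSigmaComplete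
    have hfin := h.not_isFiniteDimensional hX
    have h12 : L.HasOrthonormalSeq ↔ L.HilbertDedekindInfinite := h1.out 0 1
    have h13 : L.HasOrthonormalSeq ↔ L.HilbertDuallyDedekindInfinite := h1.out 0 2
    have hcf : ZFModel.DedekindFinite (ZFModel.FinSub X) ↔ ¬ L.HasOrthonormalSeq :=
      ⟨fun hX hL => h.not_dedekindFinite_of_hasOrthonormalSeq hL hX, fun hL =>
        by_contra fun hX => hL (h.hasOrthonormalSeq_of_not_dedekindFinite hX)⟩
    have e1 : ZFModel.IsCF X ↔ L.IsHDF :=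
      (and_iff_right hX).trans ((hcf.trans (not_congr h12)).trans (and_iff_right hfin).symm)
    have e2 : ZFModel.IsCF X ↔ L.IsHDDF :=
      (and_iff_right hX).trans ((hcf.trans (not_congr h13)).trans (and_iff_right hfin).symm)
    tfae_have 1 ↔ 2 := e1
    tfae_have 1 ↔ 3 := e2
    tfae_finish
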